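/- For each $n\ge 1$ let $\mathcal T_n\subset[0,1]$ be the set of centres of a minimal covering of $[0,1]$ by closed balls (relative to $[0,1]$, with centres in $[0,1]$) of radius $\theta\rho^{n-1}$, where $\theta=1$, $\rho=\tfrac12$, so of radius $2^{1-n}$. Let $k_0\in\mathbb Z$ be given by $\theta\rho^{k_0+1}<\operatorname{diam}[0,1]\le\theta\rho^{k_0}$ and, with $\delta=9$, let the interaction length $l$ be $\max\{0,-k_0\}$ if $\frac{4}{1-\rho}<\delta$, and otherwise the least natural number with $l\ge -k_0$ and $\frac{4\rho^l}{1-\rho}<\delta$ (here $k_0=l=0$). Let $\mathcal J$ be the set of unordered pairs $\{x,y\}$ with $x\neq y$ for which there is $n\ge1$ with $x\in\mathcal T_n$, $y\in\mathcal T_n\cup\mathcal T_{n+1}$, such that $|x-y|\le(2+\rho^{-(l+1)})\theta\rho^{n-1}$ if $y\in\mathcal T_n$, and $|x-y|\le(1+\rho)\theta\rho^{n-1}$ if $y\in\mathcal T_{n+1}$. Let $H=\bigoplus_{\{x,y\}\in\mathcal J}\mathbb C^2$ (Hilbert space sum), let $\pi$ be the direct sum of the representations $\pi_{x,y}(f)(\alpha,\beta)=(f(x)\alpha,f(y)\beta)$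 of $C([0,1])=C([0,1],\mathbb C)$, and let $D$ be the direct sum of the operators $D_{x,y}(\alpha,\beta)=\left(\frac{\beta}{|x-y|},\frac{\alpha}{|x-y|}\right)$. Then $(C([0,1]),H,D)$ is a spectral triple (that is, $D$ is self-adjoint, the set of $f$ with $\|[D,\pi(f)]\|<\infty$ is dense in $C([0,1])$, and $(I+D^2)^{-1}$ is compact), $D$ has a bounded inverse, and: (a) The induced metric is the usual one: for all $s,t\in[0,1]$, $\sup\{|f(s)-f(t)| : f\in C([0,1]),\ \|[D,\pi(f)]\|\le1\}=|s-t|$. (b) $\operatorname{tr}\big((I+D^2)^{-s/2}\big)<\infty$ for every real $s>1$, but $\operatorname{tr}\big((I+D^2)^{-1/2}\big)=\infty$. (c) For $\Lambda>0$ let $N(\Lambda)$ be the number of eigenvalues of $D$, counted with multiplicity, of absolute value at most $\Lambda$. It is finite, and $$10<\liminf_{\Lambda\to\infty}\frac{N(\Lambda)}{\Lambda}\le13<17\le\limsup_{\Lambda\to\infty}\frac{N(\Lambda)}{\Lambda}<20;$$ in particular $N(\Lambda)/\Lambda$ has no limit as $\Lambda\to\infty$. (d) For $\Lambda>0$ let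 $P_\Lambda$ be the orthogonal projection onto the span of the eigenvectors of $D$ with non-zero eigenvalues of absolute value at most $\Lambda$. For every $f\in C([0,1])$, $$\lim_{\Lambda\to\infty}\frac1{\log\Lambda}\operatorname{tr}\big(|D|^{-1}P_\Lambda\pi(f)\big)=\frac{10}{\log2}\int_0^1f(x)\,dx.$$ (e) For every $f\in C([0,1])$ the operator $\pi(f)|D|^{-1}$ lies in the Dixmier ideal $\mathcal L^{1,\infty}$ of compact operators $T$ with $\sum_{k<N}\mu_k(T)=O(\log N)$, where $\mu_k(T)$ is the distance of $T$ to the operators of rank at most $k$; and for every free (non-principal) ultrafilter $\omega$ on $\mathbb N$ its Dixmier trace is $$\operatorname{tr}_\omega\big(\pi(f)|D|^{-1}\big)=\frac{10}{\log2}\int_0^1f(x)\,dx.$$ Here, for a positive $T\in\mathcal L^{1,\infty}$ and $a_N=\frac1{\log N}\sum_{k<N}\mu_k(T)$, one puts $\operatorname{tr}_\omega(T)=\lim_{n\to\omega}\frac1{\log n}\int_1^n a_{\lceil u\rceil}\frac{du}{u}$, and $\operatorname{tr}_\omega$ is extended linearly to $\mathcal L^{1,\infty}$ by means of the positive and negative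 parts of the real and imaginary parts of $T$. -/

import Mathlib

open Filter Topology
open scoped ENNReal

noncomputable section

namespace TwoPointSum

/-! ### Unbounded operators on a Hilbert space -/

section Operators

variable {H : Type*} [NormedAddCommGroup H] [InnerProductSpace ℂ H]

/-- The eigenspace `{x ∈ dom D | D x = μ x}` of an unbounded operator. -/
def eigenspace (D : H →ₗ.[ℂ] H) (μ : ℂ) : Submodule ℂ H :=
  D.graph.comap (LinearMap.prod LinearMap.id (μ • LinearMap.id))

/-- The linear span of all eigenvectors of `D` with eigenvalue in `S`. -/
def spectralSubspace (D : H →ₗ.[ℂ] H) (S : Set ℝ) : Submodule ℂ H :=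
  ⨆ μ ∈ S, eigenspace D (μ : ℂ)

/-- The number `N(Λ)` of eigenvalues of `D` of absolute value at most `Λ`, counted with
multiplicity, that is, the dimension of the span of the corresponding eigenvectors. -/
def eigenvalueCount (D : H →ₗ.[ℂ] H) (Λ : ℝ) : ℕ :=
  Module.finrank ℂ (spectralSubspace D {μ | |μ| ≤ Λ})

/-- `R` is the (everywhere defined, bounded) inverse of `D`. -/
def IsBoundedInverse (D : H →ₗ.[ℂ] H) (R : H →L[ℂ] H) : Prop :=
  ∀ x y : H, (x, y) ∈ D.graph ↔ x = R y

/-- `R = (I + D²)⁻¹`: one has `(I + D²) x = z`, with `x` in the domain of `D²`, exactly when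
`x = R z`. -/
def IsOneAddSqInverse (D : H →ₗ.[ℂ] H) (R : H →L[ℂ] H) : Prop :=
  ∀ x z : H, (∃ y w : H, (x, y) ∈ D.graph ∧ (y, w) ∈ D.graph ∧ x + w = z) ↔ x = R z

open Classical in
/-- The bounded operator `D⁻¹` (with value `0` if `D` has no bounded inverse). -/
def boundedInverse (D : H →ₗ.[ℂ] H) : H →L[ℂ] H :=
  if h : ∃ R, IsBoundedInverse D R then h.choose else 0

open Classical in
/-- The bounded operator `(I + D²)⁻¹` (with value `0` if it does not exist). -/
def oneAddSqInverse (D : H →ₗ.[ℂ] H) : H →L[ℂ] H :=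
  if h : ∃ R, IsOneAddSqInverse D R then h.choose else 0

/-- The commutator `[D, T]` with a bounded operator `T` is defined on the domain of `D` and has
operator norm at most `C`. -/
def CommutatorNormLE (D : H →ₗ.[ℂ] H) (T : H →L[ℂ] H) (C : ℝ) : Prop :=
  ∀ x y : H, (x, y) ∈ D.graph → ∃ z : H, (T x, z) ∈ D.graph ∧ ‖z - T y‖ ≤ C * ‖x‖

variable [CompleteSpace H]

/-- `|D|⁻¹`, realised as the absolute value of the bounded operator `D⁻¹`. -/
def absInverse (D : H →ₗ.[ℂ] H) : H →L[ℂ] H := CFC.abs (boundedInverse D)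

/-- The orthogonal projection `P_Λ` onto the closed span of the eigenvectors of `D` whose
eigenvalue is non-zero and of absolute value at most `Λ`. -/
def spectralProjection (D : H →ₗ.[ℂ] H) (Λ : ℝ) : H →L[ℂ] H :=
  (spectralSubspace D {μ | μ ≠ 0 ∧ |μ| ≤ Λ}).topologicalClosure.starProjection

/-! ### Traces -/

/-- An (index set of an) orthonormal basis of `H`. -/
def basisSet (H : Type*) [NormedAddCommGroup H] [InnerProductSpace ℂ H] [CompleteSpace H] :
    Set H :=
  (exists_hilbertBasis ℂ H).choose

/-- An orthonormal basis of `H`. -/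
def someBasis (H : Type*) [NormedAddCommGroup H] [InnerProductSpace ℂ H] [CompleteSpace H] :
    HilbertBasis (basisSet H) ℂ H :=
  (exists_hilbertBasis ℂ H).choose_spec.choose

/-- The trace in `[0, ∞]` of a positive bounded operator. -/
def posTrace (T : H →L[ℂ] H) : ℝ≥0∞ :=
  ∑' i, ENNReal.ofReal (inner ℂ (someBasis H i) (T (someBasis H i))).re

/-- The trace of a trace class operator. -/
def opTrace (T : H →L[ℂ] H) : ℂ :=
  ∑' i, inner ℂ (someBasis H i) (T (someBasis H i))

/-- `p`-summability: `tr ((I + D²)^(-p/2)) < ∞`. -/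
def IsSummableAt (D : H →ₗ.[ℂ] H) (p : ℝ) : Prop :=
  posTrace ((oneAddSqInverse D) ^ (p / 2)) < ⊤

/-- The `n`-th singular value (`n ≥ 0`) of a bounded operator: its distance to the operators of
rank at most `n`. -/
def singularValue (T : H →L[ℂ] H) (n : ℕ) : ℝ :=
  sInf {r : ℝ | ∃ F : H →L[ℂ] H, FiniteDimensional ℂ (LinearMap.range (F : H →ₗ[ℂ] H)) ∧
    Module.finrank ℂ (LinearMap.range (F : H →ₗ[ℂ] H)) ≤ n ∧ r = ‖T - F‖}

/-- The sequence `(1 / log N) ∑_{n < N} μ_n(T)`. -/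
def logPartialSum (T : H →L[ℂ] H) (N : ℕ) : ℝ :=
  (∑ n ∈ Finset.range N, singularValue T n) / Real.log N

/-- The Dixmier ideal `L^{1,∞}`: compact operators with `∑_{n < N} μ_n(T) = O(log N)`. -/
def MemDixmierIdeal (T : H →L[ℂ] H) : Prop :=
  IsCompactOperator T ∧ ∃ C : ℝ, ∀ N : ℕ, 2 ≤ N → logPartialSum T N ≤ C

/-- The logarithmic Cesàro mean `(1 / log n) ∫_1^n a(u) du / u` of a sequence `a`, viewed as the
step function with value `a k` on `(k - 1, k]`. -/
def logCesaro (a : ℕ → ℝ) (n : ℕ) : ℝ :=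
  (∑ k ∈ Finset.Icc 2 n, a k * (Real.log k - Real.log ((k : ℝ) - 1))) / Real.log n

/-- The Dixmier trace of a positive operator of the Dixmier ideal: the limit along the ultrafilter
`ω` of the logarithmic Cesàro means of `(1 / log N) ∑_{n < N} μ_n(T)`. -/
def dixmierTracePos (ω : Ultrafilter ℕ) (T : H →L[ℂ] H) : ℝ :=
  limUnder (ω : Filter ℕ) (logCesaro (logPartialSum T))

/-- The linear extension of the Dixmier trace to the Dixmier ideal, through the decomposition
`T = A⁺ - A⁻ + i (B⁺ - B⁻)`, where `A` and `B` are the real and imaginary parts of `T`. -/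
def dixmierTrace (ω : Ultrafilter ℕ) (T : H →L[ℂ] H) : ℂ :=
  ((dixmierTracePos ω (realPart T : H →L[ℂ] H)⁺ : ℝ) : ℂ)
    - ((dixmierTracePos ω (realPart T : H →L[ℂ] H)⁻ : ℝ) : ℂ)
    + Complex.I * (((dixmierTracePos ω (imaginaryPart T : H →L[ℂ] H)⁺ : ℝ) : ℂ)
      - ((dixmierTracePos ω (imaginaryPart T : H →L[ℂ] H)⁻ : ℝ) : ℂ))

/-! ### Spectral triples -/

variable {A : Type*} [CStarAlgebra A]

/-- `(A, H, D)`, with the representation `π` of `A` on `H`, is a spectral triple: `D` is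
self-adjoint, the elements with bounded commutator are dense, and `(I + D²)⁻¹` is compact. -/
def IsSpectralTriple (π : A →⋆ₐ[ℂ] (H →L[ℂ] H)) (D : H →ₗ.[ℂ] H) : Prop :=
  IsSelfAdjoint D ∧ Dense {a : A | ∃ C : ℝ, CommutatorNormLE D (π a) C} ∧
    ∃ R : H →L[ℂ] H, IsOneAddSqInverse D R ∧ IsCompactOperator R

/-- The (extended) distance between two functionals, in particular between two states, that is
induced by a spectral triple. -/
def inducedDist (π : A →⋆ₐ[ℂ] (H →L[ℂ] H)) (D : H →ₗ.[ℂ] H) (φ ψ : A →L[ℂ] ℂ) : ℝ≥0∞ :=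
  ⨆ (a : A) (_ : CommutatorNormLE D (π a) 1), ENNReal.ofReal ‖φ a - ψ a‖

end Operators

/-! ### Hilbert direct sums -/

section DirectSum

variable {ι : Type*} {E : ι → Type*} [∀ i, NormedAddCommGroup (E i)]
  [∀ i, InnerProductSpace ℂ (E i)]

/-- The direct sum of bounded operators `B i` as an unbounded operator on the Hilbert sum, with
domain all `ξ` such that `∑ ‖B i (ξ i)‖² < ∞`. It is the closure of the algebraic direct sum,
which is defined on the finitely supported `ξ`. -/
def directSumOperator (B : ∀ i, E i →L[ℂ] E i) : lp E 2 →ₗ.[ℂ] lp E 2 where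
  domain :=
    { carrier := {ξ | Memℓp (fun i => B i (ξ i)) 2}
      add_mem' := by
        intro ξ η hξ hη
        have h := Memℓp.add hξ hη
        refine (congrArg (fun g => Memℓp g 2) ?_).mp h
        funext i
        simp
      zero_mem' := by
        have h : Memℓp (0 : ∀ i, E i) 2 := zero_memℓp
        refine (congrArg (fun g => Memℓp g 2) ?_).mp h
        funext i
        simp
      smul_mem' := by
        intro c ξ hξ
        have h := Memℓp.const_smul hξ c
        refine (congrArg (fun g => Memℓp g 2) ?_).mp h
        funext i
        simp }
  toFun :=
    { toFun := fun ξ => ⟨fun i => B i (ξ.1 i), ξ.2⟩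
      map_add' := by intro ξ η; ext i; simp; rfl
      map_smul' := by intro c ξ; ext i; simp }

variable [∀ i, CompleteSpace (E i)] {A : Type*} [CStarAlgebra A]

/-- The direct sum of representations of a C*-algebra: `π(a) ξ = (π_i(a) ξ_i)_i`. -/
def directSumRep (π : ∀ i, A →⋆ₐ[ℂ] (E i →L[ℂ] E i)) : A →⋆ₐ[ℂ] (lp E 2 →L[ℂ] lp E 2) where
  toFun a := lp.mapCLM 2 (fun i => π i a) (norm_nonneg a)
    (fun i => NonUnitalStarAlgHom.norm_apply_le (π i) a)
  map_one' := by ext; simp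
  map_mul' a b := by ext; simp
  map_zero' := by ext; simp
  map_add' a b := by ext; simp
  commutes' c := by ext; simp [Algebra.algebraMap_eq_smul_one]
  map_star' a := by
    rw [ContinuousLinearMap.star_eq_adjoint, ContinuousLinearMap.eq_adjoint_iff]
    intro ξ η
    simp only [lp.inner_eq_tsum]
    refine tsum_congr fun i => ?_
    simp [map_star, ContinuousLinearMap.star_eq_adjoint, ContinuousLinearMap.adjoint_inner_left]

end DirectSum

/-! ### Two-point triples and their sums over a set of pairs of points -/

section Pairs

variable {X : Type*} [MetricSpace X]

/-- The two-point representation `π_{x,y}(f) (α, β) = (f(x) α, f(y) β)` on `ℂ²`. -/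
def twoPointRep [CompactSpace X] (x y : X) :
    C(X, ℂ) →⋆ₐ[ℂ] (EuclideanSpace ℂ (Fin 2) →L[ℂ] EuclideanSpace ℂ (Fin 2)) where
  toFun f := Matrix.toEuclideanCLM (n := Fin 2) (𝕜 := ℂ) !![f x, 0; 0, f y]
  map_one' := by
    rw [← map_one (Matrix.toEuclideanCLM (n := Fin 2) (𝕜 := ℂ))]
    congr 1; ext i j; fin_cases i <;> fin_cases j <;> simp
  map_mul' f g := by
    rw [← map_mul]
    congr 1; ext i j; fin_cases i <;> fin_cases j <;> simp
  map_zero' := by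
    rw [← map_zero (Matrix.toEuclideanCLM (n := Fin 2) (𝕜 := ℂ))]
    congr 1; ext i j; fin_cases i <;> fin_cases j <;> simp
  map_add' f g := by
    rw [← map_add]
    congr 1; ext i j; fin_cases i <;> fin_cases j <;> simp
  commutes' c := by
    rw [← AlgEquivClass.commutes (Matrix.toEuclideanCLM (n := Fin 2) (𝕜 := ℂ)) c]
    congr 1; ext i j; fin_cases i <;> fin_cases j <;> simp [Matrix.algebraMap_matrix_apply]
  map_star' f := by
    rw [← map_star]
    congr 1; ext i j; fin_cases i <;> fin_cases j <;> simp [Matrix.star_apply]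

/-- The two-point Dirac operator `D_{x,y} (α, β) = (β / d(x,y), α / d(x,y))` on `ℂ²`, for
`x ≠ y`. -/
def twoPointDirac (x y : X) : EuclideanSpace ℂ (Fin 2) →L[ℂ] EuclideanSpace ℂ (Fin 2) :=
  Matrix.toEuclideanCLM (n := Fin 2) (𝕜 := ℂ)
    !![0, (((dist x y)⁻¹ : ℝ) : ℂ); (((dist x y)⁻¹ : ℝ) : ℂ), 0]

/-- The Hilbert sum of one copy of `ℂ²` for every unordered pair in `J`. -/
abbrev PairSpace (J : Set (Sym2 X)) : Type _ :=
  lp (fun _ : J => EuclideanSpace ℂ (Fin 2)) 2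

/-- The sum of the two-point representations over the pairs in `J`. The two points of an unordered
pair are listed in some order; the choice does not matter up to unitary equivalence. -/
def pairRep [CompactSpace X] (J : Set (Sym2 X)) :
    C(X, ℂ) →⋆ₐ[ℂ] (PairSpace J →L[ℂ] PairSpace J) :=
  directSumRep fun p : J => twoPointRep (Quot.out p.1).1 (Quot.out p.1).2

/-- The sum of the two-point Dirac operators over the pairs in `J`. -/
def pairDirac (J : Set (Sym2 X)) : PairSpace J →ₗ.[ℂ] PairSpace J :=
  directSumOperator fun p : J => twoPointDirac (Quot.out p.1).1 (Quot.out p.1).2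

/-! ### The index set of pairs -/

/-- The closed balls of radius `r` centred at the points of `S` cover `X`. -/
def IsBallCover (r : ℝ) (S : Finset X) : Prop :=
  ∀ t : X, ∃ s ∈ S, t ∈ Metric.closedBall s r

/-- `S` is a set of centres of a minimal covering of `X` by closed balls of radius `r`. -/
def IsMinimalBallCover (r : ℝ) (S : Finset X) : Prop :=
  IsBallCover r S ∧ ∀ S' : Finset X, IsBallCover r S' → S.card ≤ S'.card

/-- The defining conditions of the interaction length `l`, where `k₀` is the integer with
`θ ρ^(k₀+1) < diam X ≤ θ ρ^k₀`. -/
def IsInteractionLength (X : Type*) [MetricSpace X] (δ θ ρ : ℝ) (l : ℕ) : Prop :=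
  ∃ k₀ : ℤ, θ * ρ ^ (k₀ + 1) < Metric.diam (Set.univ : Set X) ∧
    Metric.diam (Set.univ : Set X) ≤ θ * ρ ^ k₀ ∧
    (4 / (1 - ρ) < δ → (l : ℤ) = max 0 (-k₀)) ∧
    (δ ≤ 4 / (1 - ρ) → IsLeast {m : ℕ | -k₀ ≤ (m : ℤ) ∧ 4 * ρ ^ m / (1 - ρ) < δ} l)

/-- The interaction length: the unique `l` with the defining conditions. -/
def interactionLength (X : Type*) [MetricSpace X] (δ θ ρ : ℝ) : ℕ :=
  sInf {l : ℕ | IsInteractionLength X δ θ ρ l}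

/-- The set of unordered pairs `{x, y}` over which the two-point triples are summed, for given
finite sets `𝒯 n`, `n ≥ 1`. -/
def pairIndex (δ θ ρ : ℝ) (𝒯 : ℕ → Finset X) : Set (Sym2 X) :=
  {p | ∃ n : ℕ, 1 ≤ n ∧ ∃ x y : X, p = s(x, y) ∧ x ∈ 𝒯 n ∧ (y ∈ 𝒯 n ∨ y ∈ 𝒯 (n + 1)) ∧ x ≠ y ∧
    (y ∈ 𝒯 n →
      dist x y ≤ (2 + (ρ ^ (interactionLength X δ θ ρ + 1))⁻¹) * (θ * ρ ^ (n - 1))) ∧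
    (y ∈ 𝒯 (n + 1) → dist x y ≤ (1 + ρ) * (θ * ρ ^ (n - 1)))}

end Pairs

end TwoPointSum

end

open TwoPointSum

/-! Up to a swap inside each block, every operator here is diagonal in the canonical basis of `⊕
ℂ²`. The block of a pair at distance `d` carries the eigenvalues `±1/d`, and `|D|⁻¹` multiplies it
by `d`. Each claim thus becomes one about the lengths and positions of the pairs.

The pairs can be listed. A covering of the interval by `N` balls of radius `1/(2N)` is rigid
(`IsMinimalBallCover.mem_iff`), so for `m ≥ 1` the set `𝒯 (m + 1)` consists of the odd multiples of
`2^(-m)`. Only the single centre in `𝒯 1` is arbitrary, and it accounts for at most one pair `p₀`.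
All other pairs are `{u/2^q, (u+w)/2^q}` with `w` in `{1, 2, 3, 4}`: `w = 2, 4` join points of one
level, `w = 1, 3` points of consecutive levels (`isDyadicIndex_pairIndex`). For each `w` two of the
four residues of `u` mod 4 occur, and the pair determines `(q, u, w)`. So about `2^(q-1)`
equidistributed pairs have parameters `(w, q)`.

Eigenvalue count: the pairs of length at least `1/Λ` are those with `2^q ≤ wΛ`. For `2^j ≤ Λ <
2^(j+1)` this gives `N(Λ) = c 2^j + O(j)`, with `c = 18` if `3Λ < 4·2^j` and `c = 22` otherwise
(`IsDyadicIndex.card_bounds`). Hence `N(Λ)/Λ` oscillates, roughly between 11 and 18.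

Traces: the weights `d(x,y)(f(x)+f(y))` at fixed `(w, q)` form Riemann sums tending to `w ∫ f`.
About `log Λ / log 2` levels contribute for each `w`, and `1+2+3+4 = 10`
(`IsDyadicIndex.tendsto_sum_pairWeight`). With `f = 1` this also gives divergence at exponent one;
above it a geometric series converges. The singular values of a diagonal operator are its rearranged
moduli, so the logarithmic partial sums of `π(f)|D|⁻¹` converge to `(10/log 2) ∫ |f|`. The Dixmier
trace of a positive such operator is therefore independent of `ω`, and splitting `f` into four
nonnegative parts settles the general case.

Metric: a commutator bound of 1 is a Lipschitz bound along the pairs. Those with `w = 2` join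
neighbours of one level, and along a line chaining loses nothing; density of the levels finishes the
argument (`IsDyadicIndex.norm_sub_le_dist`). -/

noncomputable section

namespace TwoPointSum

/-! ### Diagonal operators and their traces -/

section Diagonal

variable {ι : Type*}

/-- The Hilbert sum of copies of `ℂ²` indexed by `ι`. -/
abbrev BlockSpace (ι : Type*) : Type _ := lp (fun _ : ι => EuclideanSpace ℂ (Fin 2)) 2

theorem BlockSpace.op_ext {S T : BlockSpace ι →L[ℂ] BlockSpace ι}
    (h : ∀ ξ i j, S ξ i j = T ξ i j) : S = T := by
  ext ξ i j
  exact h ξ i j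

theorem norm_toEuclideanCLM_diagonal_le (v : Fin 2 → ℂ) {C : ℝ} (h : ∀ j, ‖v j‖ ≤ C)
    (x : EuclideanSpace ℂ (Fin 2)) :
    ‖Matrix.toEuclideanCLM (n := Fin 2) (𝕜 := ℂ) (Matrix.diagonal v) x‖ ≤ C * ‖x‖ := by
  have hC : 0 ≤ C := (norm_nonneg _).trans (h 0)
  rw [EuclideanSpace.norm_eq, EuclideanSpace.norm_eq, ← Real.sqrt_sq hC, ← Real.sqrt_mul (sq_nonneg C)]
  refine Real.sqrt_le_sqrt ?_
  rw [Finset.mul_sum]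
  refine Finset.sum_le_sum fun j _ => ?_
  have : (Matrix.toEuclideanCLM (n := Fin 2) (𝕜 := ℂ) (Matrix.diagonal v) x) j = v j * x j := by
    simp [Matrix.ofLp_toEuclideanCLM, Matrix.mulVec_diagonal]
  rw [this, norm_mul, mul_pow]
  gcongr
  exact h j

/-- The diagonal operator with bounded coefficients `a i j` with respect to the canonical basis. -/
def diagOp (a : ι → Fin 2 → ℂ) {C : ℝ} (h : ∀ i j, ‖a i j‖ ≤ C) :
    BlockSpace ι →L[ℂ] BlockSpace ι :=
  lp.mapCLM 2 (fun i => Matrix.toEuclideanCLM (n := Fin 2) (𝕜 := ℂ) (Matrix.diagonal (a i)))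
    -- For empty `ι` the hypothesis does not force `0 ≤ C`, so the bound supplied is `|C|`.
    (abs_nonneg C) (fun i => ContinuousLinearMap.opNorm_le_bound _ (abs_nonneg C) fun x =>
      norm_toEuclideanCLM_diagonal_le (a i) (fun j => (h i j).trans (le_abs_self C)) x)

variable {a b : ι → Fin 2 → ℂ} {C C' : ℝ} (h : ∀ i j, ‖a i j‖ ≤ C) (h' : ∀ i j, ‖b i j‖ ≤ C')

theorem diagOp_apply (ξ : BlockSpace ι) (i : ι) (j : Fin 2) :
    diagOp a h ξ i j = a i j * ξ i j := by
  simp [diagOp, Matrix.ofLp_toEuclideanCLM, Matrix.mulVec_diagonal]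

theorem norm_diagOp_le (hC : 0 ≤ C) : ‖diagOp a h‖ ≤ C :=
  (lp.norm_mapCLM_le _ _ _ _).trans (abs_of_nonneg hC).le

theorem BlockSpace.inner_eq (ξ η : BlockSpace ι) :
    inner ℂ ξ η = ∑' i, ∑ j, star (ξ i j) * η i j := by
  rw [lp.inner_eq_tsum]
  refine tsum_congr fun i => ?_
  simp [PiLp.inner_apply, mul_comm]

theorem star_diagOp :
    star (diagOp a h) = diagOp (fun i j => star (a i j)) (fun i j => by simpa using h i j) := by
  rw [ContinuousLinearMap.star_eq_adjoint]
  refine (ContinuousLinearMap.eq_adjoint_iff _ _).2 (fun ξ η => ?_) |>.symm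
  simp only [BlockSpace.inner_eq, diagOp_apply]
  refine tsum_congr fun i => Finset.sum_congr rfl fun j _ => ?_
  simp [mul_assoc, mul_left_comm]

/-- The operator is `S* S`, where `S` is the diagonal operator of the square roots. -/
theorem diagOp_nonneg (r : ι → Fin 2 → ℝ) (hr : ∀ i j, 0 ≤ r i j)
    (h : ∀ i j, ‖((r i j : ℝ) : ℂ)‖ ≤ C) : 0 ≤ diagOp (fun i j => (r i j : ℂ)) h := by
  have hb : ∀ i j, ‖((Real.sqrt (r i j) : ℝ) : ℂ)‖ ≤ Real.sqrt C := fun i j => by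
    have := h i j
    rw [Complex.norm_real, Real.norm_of_nonneg (hr i j)] at this
    rw [Complex.norm_real, Real.norm_of_nonneg (Real.sqrt_nonneg _)]
    exact Real.sqrt_le_sqrt this
  have : diagOp (fun i j => (r i j : ℂ)) h
      = star (diagOp (fun i j => ((Real.sqrt (r i j) : ℝ) : ℂ)) hb)
        * diagOp (fun i j => ((Real.sqrt (r i j) : ℝ) : ℂ)) hb := by
    rw [star_diagOp]
    refine BlockSpace.op_ext fun ξ i j => ?_
    simp only [mul_apply_eq_comp, diagOp_apply]
    rw [← mul_assoc]
    congr 1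
    simp only [RCLike.star_def, Complex.conj_ofReal]
    rw [← Complex.ofReal_mul, Real.mul_self_sqrt (hr i j)]
  rw [this]
  exact star_mul_self_nonneg _

/-- The canonical orthonormal basis vectors. -/
def stdVec (i : ι) (j : Fin 2) : BlockSpace ι := by
  classical exact lp.single 2 i (EuclideanSpace.single j (1 : ℂ))

open Classical in
theorem stdVec_apply (i k : ι) (j l : Fin 2) :
    stdVec i j k l = if k = i ∧ l = j then 1 else 0 := by
  simp only [stdVec, lp.single_apply]
  by_cases hk : k = i
  · subst hk
    simp [eq_comm]
  · simp [hk]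

theorem inner_stdVec (i : ι) (j : Fin 2) (ξ : BlockSpace ι) :
    inner ℂ (stdVec i j) ξ = ξ i j := by
  simp [stdVec, lp.inner_single_left, EuclideanSpace.inner_single_left]

theorem inner_stdVec_right (i : ι) (j : Fin 2) (ξ : BlockSpace ι) :
    inner ℂ ξ (stdVec i j) = star (ξ i j) := by
  rw [← inner_conj_symm, inner_stdVec]; rfl

theorem norm_stdVec (i : ι) (j : Fin 2) : ‖(stdVec i j : BlockSpace ι)‖ = 1 := by
  simp [stdVec, lp.norm_single]

/-- Parseval for a canonical basis vector in the basis `B`. This is what allows `posTrace`, defined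
by an unspecified basis, to be computed in the canonical one. -/
theorem tsum_ofReal_normSq_repr (s : Set (BlockSpace ι)) (B : HilbertBasis s ℂ (BlockSpace ι))
    (i : ι) (j : Fin 2) : ∑' k, ENNReal.ofReal (‖(B k) i j‖ ^ 2) = 1 := by
  have h1 := B.hasSum_inner_mul_inner (stdVec i j) (stdVec i j)
  rw [inner_self_eq_norm_sq_to_K, norm_stdVec] at h1
  have h2 : HasSum (fun k => ‖(B k) i j‖ ^ 2) 1 := by
    rw [← Complex.hasSum_ofReal]
    have h3 : ((1 : ℝ) : ℂ) ^ 2 = ((1 : ℝ) : ℂ) := by norm_num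
    refine (h3 ▸ h1 : HasSum _ ((1 : ℝ) : ℂ)).congr_fun fun k => ?_
    rw [inner_stdVec, inner_stdVec_right, RCLike.star_def, Complex.mul_conj,
      Complex.normSq_eq_norm_sq]
  rw [← ENNReal.ofReal_tsum_of_nonneg (fun _ => by positivity) h2.summable, h2.tsum_eq,
    ENNReal.ofReal_one]

/-- The trace of a positive diagonal operator is the sum of its coefficients. -/
theorem posTrace_diagOp (r : ι → Fin 2 → ℝ) (hr : ∀ i j, 0 ≤ r i j)
    (h : ∀ i j, ‖((r i j : ℝ) : ℂ)‖ ≤ C) :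
    posTrace (diagOp (fun i j => (r i j : ℂ)) h) = ∑' i, ∑ j, ENNReal.ofReal (r i j) := by
  have key : ∀ ξ : BlockSpace ι,
      ENNReal.ofReal (inner ℂ ξ (diagOp (fun i j => (r i j : ℂ)) h ξ)).re
        = ∑' i, ∑ j, ENNReal.ofReal (r i j) * ENNReal.ofReal (‖ξ i j‖ ^ 2) := by
    intro ξ
    have h1 := lp.hasSum_inner (𝕜 := ℂ) ξ (diagOp (fun i j => (r i j : ℂ)) h ξ)
    have h2 : HasSum (fun i => ∑ j, r i j * ‖ξ i j‖ ^ 2)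
        (inner ℂ ξ (diagOp (fun i j => (r i j : ℂ)) h ξ)).re := by
      refine (Complex.hasSum_re h1).congr_fun ?_ 
      intro i
      rw [PiLp.inner_apply, Complex.re_sum]
      refine Finset.sum_congr rfl fun j _ => ?_
      rw [diagOp_apply]
      simp only [RCLike.inner_apply]
      rw [mul_assoc, Complex.mul_conj, Complex.normSq_eq_norm_sq, ← Complex.ofReal_mul,
        Complex.ofReal_re]
    rw [← h2.tsum_eq, ENNReal.ofReal_tsum_of_nonneg
      (fun i => Finset.sum_nonneg fun j _ => mul_nonneg (hr i j) (by positivity)) h2.summable]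
    refine tsum_congr fun i => ?_
    rw [ENNReal.ofReal_sum_of_nonneg fun j _ => mul_nonneg (hr i j) (by positivity)]
    exact Finset.sum_congr rfl fun j _ => ENNReal.ofReal_mul (hr i j)
  unfold posTrace
  simp only [key]
  -- The terms lie in `[0, ∞]`, so the sums over the two bases may be exchanged freely.
  rw [ENNReal.tsum_comm]
  refine tsum_congr fun i => ?_
  rw [Summable.tsum_finsetSum fun _ _ => ENNReal.summable]
  refine Finset.sum_congr rfl fun j _ => ?_
  rw [ENNReal.tsum_mul_left, tsum_ofReal_normSq_repr, mul_one]

/-- The trace of a diagonal operator with finitely many non-zero coefficients. -/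
theorem opTrace_diagOp_of_finite (F : Finset ι) (hF : ∀ i ∉ F, ∀ j, a i j = 0) :
    opTrace (diagOp a h) = ∑ i ∈ F, ∑ j, a i j := by
  have key : ∀ ξ : BlockSpace ι, inner ℂ ξ (diagOp a h ξ)
      = ∑ i ∈ F, ∑ j, a i j * (inner ℂ (stdVec i j) ξ * inner ℂ ξ (stdVec i j)) := by
    intro ξ
    rw [BlockSpace.inner_eq, tsum_eq_sum (s := F)]
    · refine Finset.sum_congr rfl fun i _ => Finset.sum_congr rfl fun j _ => ?_
      rw [diagOp_apply, inner_stdVec, inner_stdVec_right]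
      ring
    · intro i hi
      refine Finset.sum_eq_zero fun j _ => ?_
      rw [diagOp_apply, hF i hi]; simp
  unfold opTrace
  simp only [key]
  have hs : ∀ i j, HasSum (fun k => a i j * (inner ℂ (stdVec i j) (someBasis (BlockSpace ι) k)
      * inner ℂ (someBasis (BlockSpace ι) k) (stdVec i j))) (a i j) := fun i j => by
    have := ((someBasis (BlockSpace ι)).hasSum_inner_mul_inner (stdVec i j) (stdVec i j)).mul_left
      (a i j)
    rwa [inner_self_eq_norm_sq_to_K, norm_stdVec, RCLike.ofReal_one, one_pow, mul_one] at this
  exact (hasSum_sum fun i _ => hasSum_sum fun j _ => hs i j).tsum_eq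

end Diagonal

/-! ### The Dirac operator: graph, self-adjointness, inverse -/

section Dirac

variable {ι X : Type*} [MetricSpace X]

/-- The Hilbert sum of the two-point Dirac operators of a family of pairs. -/
abbrev blockDirac (x y : ι → X) : BlockSpace ι →ₗ.[ℂ] BlockSpace ι :=
  directSumOperator fun i => twoPointDirac (x i) (y i)

theorem twoPointDirac_apply (x y : X) (v : EuclideanSpace ℂ (Fin 2)) (j : Fin 2) :
    twoPointDirac x y v j = (((dist x y)⁻¹ : ℝ) : ℂ) * v (j + 1) := by
  fin_cases j <;> simp [twoPointDirac, Matrix.ofLp_toEuclideanCLM, Matrix.mulVec, dotProduct]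

theorem fin_two_add_add (j : Fin 2) : j + 1 + 1 = j := by fin_cases j <;> rfl

/-- The operator that swaps the two coordinates of every block. -/
def flipOp (ι : Type*) : BlockSpace ι →L[ℂ] BlockSpace ι :=
  lp.mapCLM 2 (fun _ => Matrix.toEuclideanCLM (n := Fin 2) (𝕜 := ℂ) !![0, 1; 1, 0])
    zero_le_one (fun i => ContinuousLinearMap.opNorm_le_bound _ zero_le_one fun x => by
      rw [one_mul, EuclideanSpace.norm_eq, EuclideanSpace.norm_eq]
      refine Real.sqrt_le_sqrt (le_of_eq ?_)
      simp [Matrix.ofLp_toEuclideanCLM, Matrix.mulVec, dotProduct, add_comm])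

theorem flipOp_apply (ξ : BlockSpace ι) (i : ι) (j : Fin 2) : flipOp ι ξ i j = ξ i (j + 1) := by
  fin_cases j <;> simp [flipOp, Matrix.ofLp_toEuclideanCLM, Matrix.mulVec, dotProduct]

theorem star_flipOp : star (flipOp ι) = flipOp ι := by
  rw [ContinuousLinearMap.star_eq_adjoint]
  refine (ContinuousLinearMap.eq_adjoint_iff _ _).2 (fun ξ η => ?_) |>.symm
  simp only [BlockSpace.inner_eq, flipOp_apply, Fin.sum_univ_two]
  refine tsum_congr fun i => ?_
  rw [add_comm]; rfl

variable {x y : ι → X}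

/-- No domain condition is left over: the coordinate formula and the square summability of `η`
already put `ξ` in the domain. Facts about `D` are therefore proved on its graph. -/
theorem mem_graph_blockDirac {ξ η : BlockSpace ι} :
    (ξ, η) ∈ (blockDirac x y).graph ↔
      ∀ i j, η i j = (((dist (x i) (y i))⁻¹ : ℝ) : ℂ) * ξ i (j + 1) := by
  rw [LinearPMap.mem_graph_iff]
  constructor
  · rintro ⟨z, hz, hη⟩ i j
    simp only at hz hη
    rw [← hη, ← hz, ← twoPointDirac_apply]
    rfl
  · intro h
    have h' : (fun i => twoPointDirac (x i) (y i) (ξ i)) = (η : ∀ i, EuclideanSpace ℂ (Fin 2)) := by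
      funext i; ext j
      rw [h, twoPointDirac_apply]
    have hm : ξ ∈ (blockDirac x y).domain := by
      change Memℓp (fun i => twoPointDirac (x i) (y i) (ξ i)) 2
      rw [h']; exact lp.memℓp η
    refine ⟨⟨ξ, hm⟩, rfl, ?_⟩
    refine lp.ext ?_
    exact h'

theorem IsBoundedInverse.eq {H : Type*} [NormedAddCommGroup H] [InnerProductSpace ℂ H]
    {D : H →ₗ.[ℂ] H} {R S : H →L[ℂ] H} (hR : IsBoundedInverse D R) (hS : IsBoundedInverse D S) :
    R = S := by
  ext z
  exact (hS _ _).1 ((hR (R z) z).2 rfl)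

theorem IsOneAddSqInverse.eq {H : Type*} [NormedAddCommGroup H] [InnerProductSpace ℂ H]
    {D : H →ₗ.[ℂ] H} {R S : H →L[ℂ] H} (hR : IsOneAddSqInverse D R) (hS : IsOneAddSqInverse D S) :
    R = S := by
  ext z
  exact (hS _ _).1 ((hR (R z) z).2 rfl)

theorem IsBoundedInverse.boundedInverse_eq {H : Type*} [NormedAddCommGroup H]
    [InnerProductSpace ℂ H] {D : H →ₗ.[ℂ] H} {R : H →L[ℂ] H} (hR : IsBoundedInverse D R) :
    boundedInverse D = R := by
  have h : ∃ R, IsBoundedInverse D R := ⟨R, hR⟩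
  rw [boundedInverse, dif_pos h]
  exact h.choose_spec.eq hR

theorem IsOneAddSqInverse.oneAddSqInverse_eq {H : Type*} [NormedAddCommGroup H]
    [InnerProductSpace ℂ H] {D : H →ₗ.[ℂ] H} {R : H →L[ℂ] H} (hR : IsOneAddSqInverse D R) :
    oneAddSqInverse D = R := by
  have h : ∃ R, IsOneAddSqInverse D R := ⟨R, hR⟩
  rw [oneAddSqInverse, dif_pos h]
  exact h.choose_spec.eq hR

/-- Symmetry gives `D ≤ D*`. Conversely, pairing `D* η` with the basis vectors shows that it has the
coordinates prescribed by the formula for `D`. As `D* η` is square summable, `η` lies in the maximal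
domain, which is that of `D`. -/
theorem isSelfAdjoint_blockDirac : IsSelfAdjoint (blockDirac x y) := by
  set D := blockDirac x y
  have hstd : ∀ i j, stdVec i j ∈ D.domain := by
    intro i j
    have : (stdVec i j, (((dist (x i) (y i))⁻¹ : ℝ) : ℂ) • stdVec i (j + 1)) ∈ D.graph := by
      rw [mem_graph_blockDirac]
      classical
      intro k l
      simp only [lp.coeFn_smul, Pi.smul_apply, PiLp.smul_apply, smul_eq_mul, stdVec_apply]
      by_cases hk : k = i
      · subst hk
        congr 1
        fin_cases l <;> fin_cases j <;> simp
      · simp [hk]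
    exact LinearPMap.mem_domain_of_mem_graph this
  have hdense : Dense (D.domain : Set (BlockSpace ι)) := by
    rw [Submodule.dense_iff_topologicalClosure_eq_top,
      Submodule.topologicalClosure_eq_top_iff, Submodule.eq_bot_iff]
    intro ξ hξ
    ext i j
    have := (Submodule.mem_orthogonal _ _).1 hξ _ (hstd i j)
    rw [inner_stdVec] at this
    simpa using this
  have hsymm : D.IsFormalAdjoint D := by
    intro a b
    have ha := mem_graph_blockDirac.1 (LinearPMap.mem_graph D a)
    have hb := mem_graph_blockDirac.1 (LinearPMap.mem_graph D b)
    rw [BlockSpace.inner_eq, BlockSpace.inner_eq]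
    refine tsum_congr fun i => ?_
    rw [Fin.sum_univ_two, Fin.sum_univ_two, ha, ha, hb, hb]
    simp only [star_mul', RCLike.star_def, Complex.conj_ofReal]
    simp only [Fin.isValue, zero_add, show (1 : Fin 2) + 1 = 0 from rfl]
    ring
  rw [LinearPMap.isSelfAdjoint_def]
  refine le_antisymm ?_ (hsymm.le_adjoint hdense)
  have hfa := LinearPMap.adjoint_isFormalAdjoint hdense
  have hsub : D.adjoint.domain ≤ D.domain := by
    intro η hη
    suffices h : ∀ i j, ((D.adjoint ⟨η, hη⟩ : BlockSpace ι) i j)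
        = (((dist (x i) (y i))⁻¹ : ℝ) : ℂ) * η i (j + 1) from
      LinearPMap.mem_domain_of_mem_graph (mem_graph_blockDirac.2 h)
    intro i j
    have h1 := hfa ⟨η, hη⟩ ⟨stdVec i j, hstd i j⟩
    have h2 := mem_graph_blockDirac.1 (LinearPMap.mem_graph D ⟨stdVec i j, hstd i j⟩)
    have h3 : D ⟨stdVec i j, hstd i j⟩ = (((dist (x i) (y i))⁻¹ : ℝ) : ℂ) • stdVec i (j + 1) := by
      classical
      ext k l
      rw [h2]
      simp only [lp.coeFn_smul, Pi.smul_apply, PiLp.smul_apply, smul_eq_mul, stdVec_apply]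
      by_cases hk : k = i
      · subst hk
        congr 1
        fin_cases l <;> fin_cases j <;> simp
      · simp [hk]
    rw [h3, inner_smul_right, inner_stdVec_right, inner_stdVec_right] at h1
    have h4 := congrArg star h1
    simpa using h4
  refine LinearPMap.le_of_eqLocus_ge ?_
  intro η hη
  refine ⟨hη, hsub hη, ?_⟩
  have := (hsymm.le_adjoint hdense).2 (x := ⟨η, hsub hη⟩) (y := ⟨η, hη⟩) rfl
  exact this.symm

variable {C : ℝ} (h0 : ∀ i, x i ≠ y i) (hC : ∀ i, dist (x i) (y i) ≤ C)

include hC in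
theorem norm_ofReal_dist_le (i : ι) (_ : Fin 2) : ‖((dist (x i) (y i) : ℝ) : ℂ)‖ ≤ C := by
  rw [Complex.norm_real, Real.norm_of_nonneg dist_nonneg]; exact hC i

/-- The inverse distances as a diagonal operator; this is `|D|⁻¹`. -/
def distOp : BlockSpace ι →L[ℂ] BlockSpace ι :=
  diagOp (fun i _ => ((dist (x i) (y i) : ℝ) : ℂ)) (norm_ofReal_dist_le hC)

theorem distOp_apply (ξ : BlockSpace ι) (i : ι) (j : Fin 2) :
    distOp hC ξ i j = ((dist (x i) (y i) : ℝ) : ℂ) * ξ i j := diagOp_apply _ _ _ _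

include h0

theorem isBoundedInverse_blockDirac : IsBoundedInverse (blockDirac x y) (distOp hC * flipOp ι) := by
  intro ξ η
  have hd : ∀ i, ((dist (x i) (y i) : ℝ) : ℂ) ≠ 0 := fun i => by
    exact_mod_cast dist_ne_zero.2 (h0 i)
  rw [mem_graph_blockDirac]
  constructor
  · intro h
    ext i j
    rw [mul_apply_eq_comp, distOp_apply, flipOp_apply, h, fin_two_add_add, Complex.ofReal_inv,
      mul_inv_cancel_left₀ (hd i)]
  · rintro rfl i j
    rw [mul_apply_eq_comp, distOp_apply, flipOp_apply, fin_two_add_add, Complex.ofReal_inv,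
      inv_mul_cancel_left₀ (hd i)]

/-- `D⁻¹` is the swap followed by multiplication by `d`, so `(D⁻¹)* D⁻¹` is multiplication by `d²`,
whose positive square root is multiplication by `d`. -/
theorem absInverse_blockDirac : absInverse (blockDirac x y) = distOp hC := by
  rw [absInverse, (isBoundedInverse_blockDirac h0 hC).boundedInverse_eq, CFC.abs]
  refine CFC.sqrt_unique ?_ (diagOp_nonneg _ (fun i _ => dist_nonneg) _)
  rw [star_mul, star_flipOp, distOp, star_diagOp]
  refine BlockSpace.op_ext fun ξ i j => ?_
  simp [diagOp_apply, flipOp_apply, fin_two_add_add]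

end Dirac

/-! ### Powers of the resolvent and summability -/

section Resolvent

variable {ι X : Type*} [MetricSpace X] {x y : ι → X}

theorem inv_one_add_inv_sq_nonneg (t : ℝ) : 0 ≤ (1 + (t⁻¹) ^ 2)⁻¹ := by positivity

theorem inv_one_add_inv_sq_le_one (t : ℝ) : (1 + (t⁻¹) ^ 2)⁻¹ ≤ 1 :=
  inv_le_one_of_one_le₀ (by nlinarith [sq_nonneg t⁻¹])

/-- The eigenvalues of `(I + D²)^(-s)`. -/
def resolventCoeff (x y : ι → X) (s : ℝ) (i : ι) (_ : Fin 2) : ℝ :=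
  ((1 + ((dist (x i) (y i))⁻¹) ^ 2)⁻¹) ^ s

theorem resolventCoeff_nonneg (s : ℝ) (i : ι) (j : Fin 2) : 0 ≤ resolventCoeff x y s i j :=
  Real.rpow_nonneg (inv_one_add_inv_sq_nonneg _) _

theorem norm_resolventCoeff_le {s : ℝ} (hs : 0 ≤ s) (i : ι) (j : Fin 2) :
    ‖((resolventCoeff x y s i j : ℝ) : ℂ)‖ ≤ 1 := by
  rw [Complex.norm_real, Real.norm_of_nonneg (resolventCoeff_nonneg s i j)]
  exact Real.rpow_le_one (inv_one_add_inv_sq_nonneg _) (inv_one_add_inv_sq_le_one _) hs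

theorem isOneAddSqInverse_blockDirac (h0 : ∀ i, x i ≠ y i) :
    IsOneAddSqInverse (blockDirac x y)
      (diagOp (fun i j => ((resolventCoeff x y 1 i j : ℝ) : ℂ))
        (norm_resolventCoeff_le zero_le_one)) := by
  intro ξ ζ
  have hd : ∀ i, dist (x i) (y i) ≠ 0 := fun i => dist_ne_zero.2 (h0 i)
  constructor
  · rintro ⟨η, ω, h1, h2, rfl⟩
    rw [mem_graph_blockDirac] at h1 h2
    ext i j
    rw [diagOp_apply, resolventCoeff, Real.rpow_one, lp.coeFn_add, Pi.add_apply, PiLp.add_apply, h2,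
      h1, fin_two_add_add]
    have : (1 + (((dist (x i) (y i) : ℝ) : ℂ)⁻¹) ^ 2 : ℂ) ≠ 0 := by
      have : (1 + ((dist (x i) (y i))⁻¹) ^ 2 : ℝ) ≠ 0 := by positivity
      exact_mod_cast this
    push_cast
    refine (inv_mul_eq_iff_eq_mul₀ this).2 ?_ |>.symm
    ring
  · rintro rfl
    set T := diagOp (fun i j => ((resolventCoeff x y 1 i j : ℝ) : ℂ))
        (norm_resolventCoeff_le zero_le_one) with hT
    -- These are the coefficients `t/(1+t²)`, `t = 1/d`, of `D (I + D²)⁻¹` apart from the swap.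
    -- Their boundedness shows that `T ζ` lies in the domain of `D`.
    have hb : ∀ i (j : Fin 2), ‖(((dist (x i) (y i))⁻¹ * (1 + ((dist (x i) (y i))⁻¹) ^ 2)⁻¹ : ℝ) : ℂ)‖
        ≤ 1 := by
      intro i _
      rw [Complex.norm_real, Real.norm_of_nonneg (by positivity), ← div_eq_mul_inv,
        div_le_one (by positivity)]
      nlinarith [sq_nonneg ((dist (x i) (y i))⁻¹ - 1)]
    have hη : (T ζ, (diagOp _ hb * flipOp ι) ζ) ∈ (blockDirac x y).graph := by
      rw [mem_graph_blockDirac]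
      intro i j
      rw [hT, mul_apply_eq_comp, diagOp_apply, diagOp_apply, flipOp_apply, resolventCoeff,
        Real.rpow_one]
      push_cast; ring
    -- The second witness is `D² T ζ`, which equals `ζ - T ζ`.
    refine ⟨(diagOp _ hb * flipOp ι) ζ, ζ - T ζ, hη, ?_, by abel⟩
    rw [mem_graph_blockDirac]
    intro i j
    have : (1 + (((dist (x i) (y i) : ℝ) : ℂ)⁻¹) ^ 2 : ℂ) ≠ 0 := by
      have : (1 + ((dist (x i) (y i))⁻¹) ^ 2 : ℝ) ≠ 0 := by positivity
      exact_mod_cast this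
    rw [mul_apply_eq_comp, diagOp_apply, flipOp_apply, lp.coeFn_sub, Pi.sub_apply, PiLp.sub_apply,
      hT, diagOp_apply, resolventCoeff, Real.rpow_one, fin_two_add_add]
    push_cast
    generalize hc : (((dist (x i) (y i) : ℝ) : ℂ))⁻¹ = c at this ⊢
    calc ζ i j - (1 + c ^ 2)⁻¹ * ζ i j = (1 + c ^ 2)⁻¹ * ((1 + c ^ 2) * ζ i j) - (1 + c ^ 2)⁻¹ * ζ i j := by
          rw [inv_mul_cancel_left₀ this]
      _ = c * (c * (1 + c ^ 2)⁻¹ * ζ i j) := by ring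

/-- Real powers of the image of a self-adjoint element under a representation, described through
the characters of the algebra. -/
theorem exists_map_eq_rpow {A H : Type*} [CStarAlgebra A] [NormedAddCommGroup H]
    [InnerProductSpace ℂ H] [CompleteSpace H] (Φ : A →⋆ₐ[ℂ] (H →L[ℂ] H)) (u : A)
    (hu : IsSelfAdjoint u) (hΦ : 0 ≤ Φ u) {s : ℝ} (hs : 0 ≤ s) :
    ∃ v : A, (Φ u) ^ s = Φ v ∧
      ∀ (ev : A →⋆ₐ[ℂ] ℂ) (t : ℝ), ev u = (t : ℂ) → ev v = ((t ^ s : ℝ) : ℂ) := by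
  have hcont : Continuous fun t : ℝ => t ^ s := Real.continuous_rpow_const hs
  -- The power is taken in `A`. A star homomorphism intertwines the functional calculi, and this is
  -- used both for `Φ` and for the characters.
  refine ⟨cfc (fun t : ℝ => t ^ s) u, ?_, fun ev t ht => ?_⟩
  · rw [CFC.rpow_eq_cfc_real hΦ]
    exact (StarAlgHom.map_cfc (R := ℝ) (S := ℂ) Φ (fun t : ℝ => t ^ s) u hcont.continuousOn
      (AddMonoidHomClass.continuous_of_bound Φ 1 fun a => by
        rw [one_mul]; exact NonUnitalStarAlgHom.norm_apply_le Φ a) hu (hu.map Φ)).symm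
  · rw [StarAlgHom.map_cfc (R := ℝ) (S := ℂ) ev (fun t : ℝ => t ^ s) u hcont.continuousOn
      (map_continuous ev) hu (hu.map ev), ht]
    change cfc (fun t : ℝ => t ^ s) (algebraMap ℝ ℂ t) = _
    rw [cfc_algebraMap]; rfl

theorem exists_isSummableAt_iff {A H : Type*} [CStarAlgebra A] [NormedAddCommGroup H]
    [InnerProductSpace ℂ H] [CompleteSpace H] (Φ : A →⋆ₐ[ℂ] (H →L[ℂ] H)) (u : A)
    (hu : IsSelfAdjoint u) (hΦ : 0 ≤ Φ u) {D : H →ₗ.[ℂ] H} (hD : IsOneAddSqInverse D (Φ u))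
    {s : ℝ} (hs : 0 ≤ s) :
    ∃ v : A, (IsSummableAt D s ↔ posTrace (Φ v) < ⊤) ∧
      ∀ (ev : A →⋆ₐ[ℂ] ℂ) (t : ℝ), ev u = (t : ℂ) → ev v = ((t ^ (s / 2) : ℝ) : ℂ) := by
  obtain ⟨v, hv, hev⟩ := exists_map_eq_rpow Φ u hu hΦ (s := s / 2) (by positivity)
  exact ⟨v, by rw [IsSummableAt, hD.oneAddSqInverse_eq, hv], hev⟩

/-- The power of `(I + D²)⁻¹` comes from the functional calculus, which does not display its
coordinates. So the resolvent is written as the image of the identity function under the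
representation `f ↦ (f(p i))` of `C([0,1])`, where `p i = (1 + d⁻²)⁻¹`. The evaluations at `p i` are
characters and return the eigenvalues `p i ^ (s/2)`. The factor 2 is the dimension of a block. -/
theorem isSummableAt_blockDirac_iff (h0 : ∀ i, x i ≠ y i) {s : ℝ} (hs : 0 ≤ s) :
    IsSummableAt (blockDirac x y) s ↔
      ∑' i, 2 * ENNReal.ofReal (((1 + ((dist (x i) (y i))⁻¹) ^ 2)⁻¹) ^ (s / 2)) < ⊤ := by
  let p : ι → unitInterval := fun i => ⟨(1 + ((dist (x i) (y i))⁻¹) ^ 2)⁻¹,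
    inv_one_add_inv_sq_nonneg _, inv_one_add_inv_sq_le_one _⟩
  let Φ : C(unitInterval, ℂ) →⋆ₐ[ℂ] (BlockSpace ι →L[ℂ] BlockSpace ι) :=
    directSumRep fun i => twoPointRep (p i) (p i)
  have hΦ : ∀ f ξ i j, Φ f ξ i j = f (p i) * ξ i j := by
    intro f ξ i j
    fin_cases j <;>
      simp [Φ, directSumRep, twoPointRep, Matrix.ofLp_toEuclideanCLM, Matrix.mulVec, dotProduct]
  let u : C(unitInterval, ℂ) := ⟨fun t => ((t : ℝ) : ℂ), by fun_prop⟩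
  have hu : IsSelfAdjoint u := by
    ext t; simp [u]
  have h1 : Φ u = diagOp (fun i j => ((resolventCoeff x y 1 i j : ℝ) : ℂ))
      (norm_resolventCoeff_le zero_le_one) := by
    refine BlockSpace.op_ext fun ξ i j => ?_
    rw [hΦ, diagOp_apply, resolventCoeff, Real.rpow_one]; rfl
  obtain ⟨v, hv, hev⟩ := exists_isSummableAt_iff Φ u hu
    (h1 ▸ diagOp_nonneg _ (resolventCoeff_nonneg 1) _) (h1 ▸ isOneAddSqInverse_blockDirac h0) hs
  have h2 : Φ v = diagOp (fun i j => ((resolventCoeff x y (s / 2) i j : ℝ) : ℂ))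
      (norm_resolventCoeff_le (by positivity)) := by
    refine BlockSpace.op_ext fun ξ i j => ?_
    rw [hΦ, diagOp_apply, resolventCoeff]
    congr 1
    exact hev (ContinuousMap.evalStarAlgHom ℂ ℂ (p i)) _ rfl
  rw [hv, h2, posTrace_diagOp _ (resolventCoeff_nonneg _)]
  refine iff_of_eq (congrArg (· < ⊤) (tsum_congr fun i => ?_))
  rw [Fin.sum_univ_two, two_mul]
  rfl

end Resolvent

/-! ### Compactness of diagonal operators -/

section Compact

variable {ι : Type*} {a : ι → Fin 2 → ℂ} {C : ℝ} (h : ∀ i j, ‖a i j‖ ≤ C)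

/-- A diagonal operator whose coefficients vanish off a finite set `s` has rank at most `|s|`. -/
theorem finrank_range_diagOp_le (s : Finset (ι × Fin 2)) (hs : ∀ q ∉ s, a q.1 q.2 = 0) :
    FiniteDimensional ℂ (LinearMap.range (diagOp a h : BlockSpace ι →ₗ[ℂ] BlockSpace ι)) ∧
      Module.finrank ℂ (LinearMap.range (diagOp a h : BlockSpace ι →ₗ[ℂ] BlockSpace ι))
        ≤ s.card := by
  classical
  set e : ι × Fin 2 → BlockSpace ι := fun q => stdVec q.1 q.2 with he
  have hle : LinearMap.range (diagOp a h : BlockSpace ι →ₗ[ℂ] BlockSpace ι) ≤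
      Submodule.span ℂ ((s.image e : Finset (BlockSpace ι)) : Set (BlockSpace ι)) := by
    rintro _ ⟨ξ, rfl⟩
    have : diagOp a h ξ = ∑ q ∈ s, (a q.1 q.2 * ξ q.1 q.2) • stdVec q.1 q.2 := by
      ext i j
      rw [diagOp_apply, lp.coeFn_sum, Finset.sum_apply, WithLp.ofLp_sum, Finset.sum_apply]
      simp only [lp.coeFn_smul, Pi.smul_apply, PiLp.smul_apply, smul_eq_mul, stdVec_apply]
      by_cases hi : (i, j) ∈ s
      · rw [Finset.sum_eq_single (i, j)]
        · simp
        · rintro ⟨k, l⟩ - hne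
          have : ¬ (i = k ∧ j = l) := fun hh => hne (by rw [hh.1, hh.2])
          simp [this]
        · intro hh; exact absurd hi hh
      · rw [hs (i, j) hi, zero_mul, Finset.sum_eq_zero]
        rintro ⟨k, l⟩ hk
        have : ¬ (i = k ∧ j = l) := fun hh => hi (by rw [hh.1, hh.2]; exact hk)
        simp [this]
    change diagOp a h ξ ∈ _
    rw [this]
    exact Submodule.sum_mem _ fun q hq => Submodule.smul_mem _ _
      (Submodule.subset_span (Finset.mem_coe.2 (Finset.mem_image_of_mem e hq)))
  have hfin : FiniteDimensional ℂ
      (Submodule.span ℂ ((s.image e : Finset (BlockSpace ι)) : Set (BlockSpace ι))) :=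
    FiniteDimensional.span_of_finite ℂ (Finset.finite_toSet _)
  exact ⟨Submodule.finiteDimensional_of_le hle, (Submodule.finrank_mono hle).trans
    ((finrank_span_finset_le_card _).trans Finset.card_image_le)⟩

theorem isCompactOperator_of_finite_dim {H : Type*} [NormedAddCommGroup H] [NormedSpace ℂ H]
    (T : H →L[ℂ] H) (hT : FiniteDimensional ℂ (LinearMap.range (T : H →ₗ[ℂ] H))) :
    IsCompactOperator T := by
  have : ProperSpace (LinearMap.range (T : H →ₗ[ℂ] H)) := FiniteDimensional.proper ℂ _
  let S : H →L[ℂ] LinearMap.range (T : H →ₗ[ℂ] H) := T.codRestrict _ (fun x => ⟨x, rfl⟩)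
  exact (isCompactOperator_of_locallyCompactSpace_dom S).clm_comp (Submodule.subtypeL _)

/-- The operator is the norm limit of its truncations to the finitely many blocks having a
coefficient of modulus at least `1/(n+1)`. -/
theorem isCompactOperator_diagOp (hfin : ∀ ε > 0, {i | ∃ j, ε ≤ ‖a i j‖}.Finite) :
    IsCompactOperator (diagOp a h) := by
  classical
  have hmem : ∀ n : ℕ, ∃ T : BlockSpace ι →L[ℂ] BlockSpace ι, IsCompactOperator T ∧
      ‖T - diagOp a h‖ ≤ 1 / ((n : ℝ) + 1) := by
    intro n
    have hε : (0 : ℝ) < 1 / ((n : ℝ) + 1) := by positivity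
    let F := (hfin _ hε).toFinset
    let b : ι → Fin 2 → ℂ := fun i j => if i ∈ F then a i j else 0
    have hb : ∀ i j, ‖b i j‖ ≤ C := by
      intro i j
      by_cases hi : i ∈ F
      · simpa [b, hi] using h i j
      · simpa [b, hi] using (norm_nonneg _).trans (h i j)
    refine ⟨diagOp b hb, isCompactOperator_of_finite_dim _
      (finrank_range_diagOp_le hb (F ×ˢ Finset.univ) fun q hq => ?_).1, ?_⟩
    · have : q.1 ∉ F := fun hh => hq (Finset.mem_product.2 ⟨hh, Finset.mem_univ _⟩)
      simp [b, this]
    have hc : ∀ i j, ‖b i j - a i j‖ ≤ 1 / ((n : ℝ) + 1) := by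
      intro i j
      by_cases hi : i ∈ F
      · simp only [b, hi, if_true, sub_self, norm_zero]; exact hε.le
      · have : ¬ ∃ j, 1 / ((n : ℝ) + 1) ≤ ‖a i j‖ := by simpa [F] using hi
        push Not at this
        simpa [b, hi] using (this j).le
    have : diagOp b hb - diagOp a h = diagOp (fun i j => b i j - a i j) hc := by
      refine BlockSpace.op_ext fun ξ i j => ?_
      rw [sub_apply, lp.coeFn_sub, Pi.sub_apply, PiLp.sub_apply]
      simp only [diagOp_apply]
      ring
    rw [this]
    exact norm_diagOp_le _ hε.le
  choose T hT hT' using hmem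
  refine isCompactOperator_of_tendsto (l := atTop) (F := T) ?_ (Eventually.of_forall hT)
  rw [tendsto_iff_norm_sub_tendsto_zero]
  exact squeeze_zero (fun _ => norm_nonneg _) hT' tendsto_one_div_add_atTop_nhds_zero_nat

end Compact

/-! ### Spectral subspaces of the Dirac operator -/

section Spectral

variable {ι X : Type*} [MetricSpace X] {x y : ι → X}

/-- The vectors supported on the blocks in `F`. -/
def supportedOn (F : Set ι) : Submodule ℂ (BlockSpace ι) where
  carrier := {ξ | ∀ i ∉ F, ξ i = 0}
  add_mem' := by
    intro ξ η hξ hη i hi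
    rw [lp.coeFn_add, Pi.add_apply, hξ i hi, hη i hi, add_zero]
  zero_mem' := fun i _ => rfl
  smul_mem' := by
    intro c ξ hξ i hi
    rw [lp.coeFn_smul, Pi.smul_apply, hξ i hi, smul_zero]

/-- Using the eigenvalue equation twice gives `(μ² - d⁻²) ξ i = 0`, and `μ² < d⁻²` on blocks with `Λ
< 1/d`. -/
theorem eigenspace_blockDirac_le {Λ μ : ℝ} (hμ : |μ| ≤ Λ) :
    eigenspace (blockDirac x y) (μ : ℂ) ≤ supportedOn {i | (dist (x i) (y i))⁻¹ ≤ Λ} := by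
  intro ξ hξ i hi
  have h : (ξ, (μ : ℂ) • ξ) ∈ (blockDirac x y).graph := hξ
  rw [mem_graph_blockDirac] at h
  simp only [lp.coeFn_smul, Pi.smul_apply, PiLp.smul_apply, smul_eq_mul] at h
  have hi' : Λ < (dist (x i) (y i))⁻¹ := by simpa using hi
  ext j
  have h1 := h i j
  have h2 := h i (j + 1)
  rw [fin_two_add_add] at h2
  have h3 : ((μ ^ 2 - (dist (x i) (y i))⁻¹ ^ 2 : ℝ) : ℂ) * ξ i j = 0 := by
    push_cast at h1 h2 ⊢
    linear_combination (μ : ℂ) * h1 + ((dist (x i) (y i) : ℝ) : ℂ)⁻¹ * h2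
  rcases mul_eq_zero.1 h3 with h4 | h4
  · have h5 : μ ^ 2 - (dist (x i) (y i))⁻¹ ^ 2 = 0 := by exact_mod_cast h4
    have h6 := abs_nonneg μ
    have h7 := sq_abs μ
    nlinarith
  · exact h4

/-- The vectors `ξ ± swap ξ` are zero or eigenvectors for `±1/d`, and `ξ` is their average. -/
theorem single_mem_spectralSubspace {S : Set ℝ} (i : ι) (h1 : (dist (x i) (y i))⁻¹ ∈ S)
    (h2 : -(dist (x i) (y i))⁻¹ ∈ S) (ξ : BlockSpace ι) (hξ : ξ ∈ supportedOn {i}) :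
    ξ ∈ spectralSubspace (blockDirac x y) S := by
  have key : ∀ σ : ℝ, σ ^ 2 = 1 → (ξ + (σ : ℂ) • flipOp ι ξ) ∈
      eigenspace (blockDirac x y) ((σ * (dist (x i) (y i))⁻¹ : ℝ) : ℂ) := by
    intro σ hσ
    change (ξ + (σ : ℂ) • flipOp ι ξ, ((σ * (dist (x i) (y i))⁻¹ : ℝ) : ℂ) • (ξ + (σ : ℂ) • flipOp ι ξ)) ∈
      (blockDirac x y).graph
    rw [mem_graph_blockDirac]
    intro k l
    simp only [lp.coeFn_smul, lp.coeFn_add, Pi.add_apply, Pi.smul_apply, PiLp.add_apply,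
      PiLp.smul_apply, smul_eq_mul, flipOp_apply, fin_two_add_add]
    by_cases hk : k = i
    · subst hk
      have hσ' : (σ : ℂ) ^ 2 = 1 := by exact_mod_cast hσ
      push_cast
      linear_combination ((dist (x k) (y k) : ℝ) : ℂ)⁻¹ * ξ k (l + 1) * hσ'
    · have : ξ k = 0 := hξ k hk
      simp [this]
  have e1 := key 1 (by norm_num)
  have e2 := key (-1) (by norm_num)
  rw [one_mul] at e1
  rw [neg_one_mul] at e2
  have m1 : _ ∈ spectralSubspace (blockDirac x y) S :=
    Submodule.mem_iSup_of_mem _ (Submodule.mem_iSup_of_mem h1 e1)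
  have m2 : _ ∈ spectralSubspace (blockDirac x y) S :=
    Submodule.mem_iSup_of_mem _ (Submodule.mem_iSup_of_mem h2 e2)
  have m3 := Submodule.smul_mem _ ((1 / 2 : ℂ)) (Submodule.add_mem _ m1 m2)
  convert m3 using 1
  push_cast
  module

/-- A general `S` serves both the counting function, which admits the eigenvalue 0, and `P_Λ`, which
does not. -/
theorem spectralSubspace_blockDirac {Λ : ℝ} {S : Set ℝ} (hS : ∀ μ ∈ S, |μ| ≤ Λ)
    (hS' : ∀ i, (dist (x i) (y i))⁻¹ ≤ Λ →
      (dist (x i) (y i))⁻¹ ∈ S ∧ -(dist (x i) (y i))⁻¹ ∈ S)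
    (hfin : {i | (dist (x i) (y i))⁻¹ ≤ Λ}.Finite) :
    spectralSubspace (blockDirac x y) S = supportedOn {i | (dist (x i) (y i))⁻¹ ≤ Λ} := by
  classical
  refine le_antisymm (iSup₂_le fun μ hμ => eigenspace_blockDirac_le (hS μ hμ)) fun ξ hξ => ?_
  have hsum : ξ = ∑ i ∈ hfin.toFinset, lp.single 2 i (ξ i) := by
    ext1
    funext k
    rw [lp.coeFn_sum, Finset.sum_apply]
    simp only [lp.coeFn_single, Finset.sum_pi_single, Set.Finite.mem_toFinset]
    split_ifs with hk
    · rfl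
    · exact hξ k hk
  rw [hsum]
  refine Submodule.sum_mem _ fun i hi => ?_
  have hi' := hS' i (by simpa using hi)
  refine single_mem_spectralSubspace i hi'.1 hi'.2 _ fun k hk => ?_
  rw [lp.coeFn_single, Pi.single_eq_of_ne hk]

theorem finrank_supportedOn (F : Finset ι) :
    FiniteDimensional ℂ (supportedOn (F : Set ι)) ∧
      Module.finrank ℂ (supportedOn (F : Set ι)) = 2 * F.card := by
  classical
  let φ : supportedOn (F : Set ι) →ₗ[ℂ] (F → EuclideanSpace ℂ (Fin 2)) :=
    { toFun := fun ξ i => ξ.1 i.1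
      map_add' := fun ξ η => rfl
      map_smul' := fun c ξ => rfl }
  have hinj : Function.Injective φ := by
    intro ξ η h
    apply Subtype.ext
    ext1
    funext k
    by_cases hk : k ∈ F
    · exact congrFun h ⟨k, hk⟩
    · rw [ξ.2 k hk, η.2 k hk]
  have hsurj : Function.Surjective φ := by
    intro v
    let w : BlockSpace ι := ∑ i : F, lp.single 2 i.1 (v i)
    have hw : ∀ k, w k = ∑ i : F, Pi.single (M := fun _ => EuclideanSpace ℂ (Fin 2)) i.1 (v i) k := by
      intro k
      rw [lp.coeFn_sum, Finset.sum_apply]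
      rfl
    refine ⟨⟨w, fun k hk => ?_⟩, ?_⟩
    · rw [hw]
      refine Finset.sum_eq_zero fun i _ => Pi.single_eq_of_ne ?_ _
      rintro rfl
      exact hk i.2
    · funext k
      change w k = v k
      rw [hw, Finset.sum_eq_single k, Pi.single_eq_same]
      · intro b _ hb
        exact Pi.single_eq_of_ne (fun h => hb (Subtype.ext h.symm)) _
      · simp
  let e := LinearEquiv.ofBijective φ ⟨hinj, hsurj⟩
  refine ⟨e.symm.finiteDimensional, ?_⟩
  rw [e.finrank_eq, Module.finrank_pi_fintype]
  simp [mul_comm]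

variable {Λ : ℝ} (hfin : {i | (dist (x i) (y i))⁻¹ ≤ Λ}.Finite)

include hfin

theorem spectralSubspace_abs_le :
    spectralSubspace (blockDirac x y) {μ | |μ| ≤ Λ}
      = supportedOn (hfin.toFinset : Set ι) := by
  rw [spectralSubspace_blockDirac (S := {μ | |μ| ≤ Λ}) (fun μ hμ => hμ) ?_ hfin, Set.Finite.coe_toFinset]
  intro i hi
  have : |(dist (x i) (y i))⁻¹| ≤ Λ := by rwa [abs_of_nonneg (by positivity)]
  exact ⟨this, by rwa [Set.mem_ofPred_eq, abs_neg]⟩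

theorem finiteDimensional_spectralSubspace :
    FiniteDimensional ℂ (spectralSubspace (blockDirac x y) {μ | |μ| ≤ Λ}) := by
  rw [spectralSubspace_abs_le hfin]
  exact (finrank_supportedOn _).1

theorem eigenvalueCount_blockDirac :
    eigenvalueCount (blockDirac x y) Λ = 2 * hfin.toFinset.card := by
  rw [eigenvalueCount, spectralSubspace_abs_le hfin]
  exact (finrank_supportedOn _).2

omit hfin in
theorem norm_indicator_le (F : Finset ι) (i : ι) (_ : Fin 2) :
    ‖Set.indicator (F : Set ι) (fun _ => (1 : ℂ)) i‖ ≤ 1 := by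
  by_cases hi : i ∈ F <;> simp [hi]

theorem spectralProjection_blockDirac (h0 : ∀ i, x i ≠ y i) :
    spectralProjection (blockDirac x y) Λ
      = diagOp (fun i _ => Set.indicator (hfin.toFinset : Set ι) (fun _ => (1 : ℂ)) i)
          (norm_indicator_le _) := by
  have hK : spectralSubspace (blockDirac x y) {μ | μ ≠ 0 ∧ |μ| ≤ Λ}
      = supportedOn (hfin.toFinset : Set ι) := by
    rw [spectralSubspace_blockDirac (S := {μ | μ ≠ 0 ∧ |μ| ≤ Λ}) (fun μ hμ => hμ.2) ?_ hfin, Set.Finite.coe_toFinset]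
    intro i hi
    have : |(dist (x i) (y i))⁻¹| ≤ Λ := by rwa [abs_of_nonneg (by positivity)]
    have hne : (dist (x i) (y i))⁻¹ ≠ 0 := inv_ne_zero (dist_ne_zero.2 (h0 i))
    exact ⟨⟨hne, this⟩, ⟨neg_ne_zero.2 hne, by rwa [abs_neg]⟩⟩
  have hclosed : (spectralSubspace (blockDirac x y) {μ | μ ≠ 0 ∧ |μ| ≤ Λ}).topologicalClosure
      = supportedOn (hfin.toFinset : Set ι) := by
    have : FiniteDimensional ℂ (supportedOn (hfin.toFinset : Set ι)) := (finrank_supportedOn _).1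
    rw [hK]
    exact (Submodule.closed_of_finiteDimensional _).submodule_topologicalClosure_eq
  ext1 ξ
  rw [spectralProjection]
  refine Submodule.eq_starProjection_of_mem_of_inner_eq_zero
    (K := (spectralSubspace (blockDirac x y) {μ | μ ≠ 0 ∧ |μ| ≤ Λ}).topologicalClosure) ?_ ?_
  · rw [hclosed]
    intro i hi
    ext j
    rw [diagOp_apply, Set.indicator_of_notMem hi, zero_mul]; rfl
  · rw [hclosed]
    intro η hη
    rw [BlockSpace.inner_eq]
    refine (tsum_congr fun i => ?_).trans tsum_zero
    refine Finset.sum_eq_zero fun j _ => ?_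
    by_cases hi : i ∈ (hfin.toFinset : Set ι)
    · rw [lp.coeFn_sub, Pi.sub_apply, PiLp.sub_apply, diagOp_apply, Set.indicator_of_mem hi]
      simp
    · rw [hη i hi]; simp

end Spectral

/-! ### The representation, commutators and the spectral triple -/

section Representation

variable {ι X : Type*} [MetricSpace X] [CompactSpace X]

/-- The Hilbert sum of the two-point representations of a family of pairs. -/
abbrev blockRep (x y : ι → X) : C(X, ℂ) →⋆ₐ[ℂ] (BlockSpace ι →L[ℂ] BlockSpace ι) :=
  directSumRep fun i => twoPointRep (x i) (y i)

variable {x y : ι → X}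

theorem blockRep_apply (f : C(X, ℂ)) (ξ : BlockSpace ι) (i : ι) (j : Fin 2) :
    blockRep x y f ξ i j = f (![x i, y i] j) * ξ i j := by
  fin_cases j <;>
    simp [directSumRep, twoPointRep, Matrix.ofLp_toEuclideanCLM, Matrix.mulVec, dotProduct]

theorem opTrace_blockRep {C : ℝ} (h0 : ∀ i, x i ≠ y i) (hC : ∀ i, dist (x i) (y i) ≤ C) {Λ : ℝ}
    (hfin : {i | (dist (x i) (y i))⁻¹ ≤ Λ}.Finite) (f : C(X, ℂ)) :
    opTrace (absInverse (blockDirac x y) * spectralProjection (blockDirac x y) Λ * blockRep x y f)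
      = ∑ i ∈ hfin.toFinset, ((dist (x i) (y i) : ℝ) : ℂ) * (f (x i) + f (y i)) := by
  let a : ι → Fin 2 → ℂ := fun i j => ((dist (x i) (y i) : ℝ) : ℂ) *
    (Set.indicator (hfin.toFinset : Set ι) (fun _ => (1 : ℂ)) i * f (![x i, y i] j))
  have ha : ∀ i j, ‖a i j‖ ≤ C * (1 * ‖f‖) := fun i j => by
    have hC0 : 0 ≤ C := dist_nonneg.trans (hC i)
    simp only [a, norm_mul]
    refine mul_le_mul ?_ ?_ (by positivity) hC0
    · rw [Complex.norm_real, Real.norm_of_nonneg dist_nonneg]; exact hC i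
    · exact mul_le_mul (norm_indicator_le _ i j) (f.norm_coe_le_norm _) (norm_nonneg _) zero_le_one
  have : absInverse (blockDirac x y) * spectralProjection (blockDirac x y) Λ * blockRep x y f
      = diagOp a ha := by
    rw [absInverse_blockDirac h0 hC, spectralProjection_blockDirac hfin h0]
    refine BlockSpace.op_ext fun ξ i j => ?_
    rw [mul_apply_eq_comp, mul_apply_eq_comp, distOp_apply, diagOp_apply, blockRep_apply,
      diagOp_apply]
    simp only [a]; ring
  rw [this, opTrace_diagOp_of_finite ha hfin.toFinset]
  · refine Finset.sum_congr rfl fun i hi => ?_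
    rw [Fin.sum_univ_two]
    simp only [a, Set.indicator_of_mem (Finset.mem_coe.2 hi)]
    simp [mul_add]
  · intro i hi j
    simp only [a]
    rw [Set.indicator_of_notMem (by simpa using hi)]
    simp

theorem norm_flipOp_le : ‖flipOp ι‖ ≤ 1 := lp.norm_mapCLM_le _ _ _ _

theorem norm_coord_le (ξ : BlockSpace ι) (i : ι) (j : Fin 2) : ‖ξ i j‖ ≤ ‖ξ‖ := by
  rw [← inner_stdVec]
  refine (norm_inner_le_norm _ _).trans ?_
  rw [norm_stdVec, one_mul]

/-- On the block of `{x, y}` the commutator is antidiagonal with entries `±(f(x) - f(y))/d`. Testing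
on one basis vector per block gives one direction, the supremum over the blocks the other. -/
theorem commutatorNormLE_blockRep_iff (h0 : ∀ i, x i ≠ y i) (f : C(X, ℂ)) {C : ℝ} (hC : 0 ≤ C) :
    CommutatorNormLE (blockDirac x y) (blockRep x y f) C ↔
      ∀ i, ‖f (x i) - f (y i)‖ ≤ C * dist (x i) (y i) := by
  have hd : ∀ i, 0 < dist (x i) (y i) := fun i => dist_pos.2 (h0 i)
  constructor
  · intro h i
    classical
    obtain ⟨z, hz, hn⟩ := h (stdVec i 0) ((((dist (x i) (y i))⁻¹ : ℝ) : ℂ) • stdVec i 1) (by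
      rw [mem_graph_blockDirac]
      intro k l
      simp only [lp.coeFn_smul, Pi.smul_apply, PiLp.smul_apply, smul_eq_mul, stdVec_apply]
      by_cases hk : k = i
      · subst hk
        congr 1
        fin_cases l <;> simp
      · simp [hk])
    rw [mem_graph_blockDirac] at hz
    have h1 := norm_coord_le (z - blockRep x y f
      ((((dist (x i) (y i))⁻¹ : ℝ) : ℂ) • stdVec i 1)) i 1
    rw [lp.coeFn_sub, Pi.sub_apply, PiLp.sub_apply, hz, blockRep_apply, blockRep_apply] at h1
    simp only [lp.coeFn_smul, Pi.smul_apply, PiLp.smul_apply, smul_eq_mul, stdVec_apply] at h1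
    rw [norm_stdVec, mul_one] at hn
    have h2 : ‖((((dist (x i) (y i))⁻¹ : ℝ) : ℂ) * (f (x i) - f (y i)))‖ ≤ C := by
      refine le_trans (le_of_eq (congrArg norm ?_)) (h1.trans hn)
      simp [mul_sub, mul_comm]
    rw [norm_mul, Complex.norm_real, Real.norm_of_nonneg (by positivity),
      inv_mul_le_iff₀ (hd i), mul_comm] at h2
    exact h2
  · intro h ξ η hη
    rw [mem_graph_blockDirac] at hη
    have hb : ∀ i (j : Fin 2), ‖(((dist (x i) (y i))⁻¹ : ℝ) : ℂ) *
        (f (![x i, y i] (j + 1)) - f (![x i, y i] j))‖ ≤ C := by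
      intro i j
      rw [norm_mul, Complex.norm_real, Real.norm_of_nonneg (by positivity),
        inv_mul_le_iff₀ (hd i), mul_comm]
      fin_cases j
      · simpa [norm_sub_rev] using h i
      · simpa using h i
    -- The witness is `π(f) D ξ + [D, π(f)] ξ`. Exhibiting it also shows that `π(f)` preserves the
    -- domain of `D`.
    refine ⟨blockRep x y f η + diagOp _ hb (flipOp ι ξ), ?_, ?_⟩
    · rw [mem_graph_blockDirac]
      intro i j
      rw [lp.coeFn_add, Pi.add_apply, PiLp.add_apply, blockRep_apply, blockRep_apply, hη,
        diagOp_apply, flipOp_apply]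
      ring
    · rw [add_sub_cancel_left]
      calc ‖diagOp _ hb (flipOp ι ξ)‖ ≤ C * ‖flipOp ι ξ‖ :=
            (ContinuousLinearMap.le_opNorm _ _).trans
              (mul_le_mul_of_nonneg_right (norm_diagOp_le hb hC) (norm_nonneg _))
        _ ≤ C * (1 * ‖ξ‖) := by
            gcongr
            exact (ContinuousLinearMap.le_opNorm _ _).trans
              (mul_le_mul_of_nonneg_right norm_flipOp_le (norm_nonneg _))
        _ = C * ‖ξ‖ := by rw [one_mul]

theorem isSpectralTriple_block (h0 : ∀ i, x i ≠ y i)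
    (hfin : ∀ ε > 0, {i | ε ≤ dist (x i) (y i)}.Finite)
    (hdense : Dense {f : C(X, ℂ) | ∃ K, LipschitzWith K f}) :
    IsSpectralTriple (blockRep x y) (blockDirac x y) := by
  refine ⟨isSelfAdjoint_blockDirac, hdense.mono ?_, _, isOneAddSqInverse_blockDirac h0, ?_⟩
  · rintro f ⟨K, hK⟩
    refine ⟨K, (commutatorNormLE_blockRep_iff h0 f K.2).2 fun i => ?_⟩
    rw [← dist_eq_norm]
    exact hK.dist_le_mul _ _
  · refine isCompactOperator_diagOp _ fun ε hε => ?_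
    -- Since `(1 + d⁻²)⁻¹ ≤ d²`, a coefficient of at least `ε` forces `d ≥ √ε`.
    refine (hfin (Real.sqrt ε) (Real.sqrt_pos.2 hε)).subset ?_
    rintro i ⟨j, hj⟩
    have hd : 0 < dist (x i) (y i) := dist_pos.2 (h0 i)
    rw [Complex.norm_real, Real.norm_of_nonneg (resolventCoeff_nonneg _ _ _), resolventCoeff,
      Real.rpow_one] at hj
    refine Real.sqrt_le_iff.2 ⟨hd.le, hj.trans ?_⟩
    rw [inv_pow]
    refine inv_le_of_inv_le₀ (by positivity) ?_
    linarith

end Representation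

/-! ### Singular values of diagonal operators -/

section SingularValues

variable {H : Type*} [NormedAddCommGroup H] [InnerProductSpace ℂ H]

theorem singularValue_nonneg (T : H →L[ℂ] H) (n : ℕ) : 0 ≤ singularValue T n := by
  refine Real.sInf_nonneg ?_
  rintro r ⟨F, -, -, rfl⟩
  exact norm_nonneg _

theorem singularValue_le_norm_sub (T F : H →L[ℂ] H) {n : ℕ}
    (h1 : FiniteDimensional ℂ (LinearMap.range (F : H →ₗ[ℂ] H)))
    (h2 : Module.finrank ℂ (LinearMap.range (F : H →ₗ[ℂ] H)) ≤ n) :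
    singularValue T n ≤ ‖T - F‖ := by
  refine csInf_le ⟨0, ?_⟩ ⟨F, h1, h2, rfl⟩
  rintro r ⟨F, -, -, rfl⟩
  exact norm_nonneg _

theorem le_singularValue (T : H →L[ℂ] H) {n : ℕ} {c : ℝ}
    (h : ∀ F : H →L[ℂ] H, FiniteDimensional ℂ (LinearMap.range (F : H →ₗ[ℂ] H)) →
      Module.finrank ℂ (LinearMap.range (F : H →ₗ[ℂ] H)) ≤ n → c ≤ ‖T - F‖) :
    c ≤ singularValue T n := by
  refine le_csInf ⟨‖T - 0‖, 0, ?_, ?_, rfl⟩ ?_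
  · rw [ContinuousLinearMap.toLinearMap_zero, LinearMap.range_zero]; infer_instance
  · rw [ContinuousLinearMap.toLinearMap_zero, LinearMap.range_zero]; simp
  · rintro r ⟨F, h1, h2, rfl⟩
    exact h F h1 h2

variable {ι : Type*} {a : ι → Fin 2 → ℂ} {C : ℝ} (h : ∀ i j, ‖a i j‖ ≤ C)

theorem singularValue_diagOp_le {s : Finset (ι × Fin 2)} {M : ℝ} (hM : 0 ≤ M)
    (hs : ∀ q ∉ s, ‖a q.1 q.2‖ ≤ M) : singularValue (diagOp a h) s.card ≤ M := by
  classical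
  let b : ι → Fin 2 → ℂ := fun i j => if (i, j) ∈ s then a i j else 0
  have hb : ∀ i j, ‖b i j‖ ≤ C := by
    intro i j
    by_cases hi : (i, j) ∈ s
    · simpa [b, hi] using h i j
    · simpa [b, hi] using (norm_nonneg _).trans (h i j)
  have hr := finrank_range_diagOp_le hb s fun q hq => by simp [b, hq]
  refine (singularValue_le_norm_sub _ (diagOp b hb) hr.1 hr.2).trans ?_
  have hc : ∀ i j, ‖a i j - b i j‖ ≤ M := by
    intro i j
    by_cases hi : (i, j) ∈ s
    · simpa [b, hi] using hM
    · simpa [b, hi] using hs (i, j) hi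
  have : diagOp a h - diagOp b hb = diagOp (fun i j => a i j - b i j) hc := by
    refine BlockSpace.op_ext fun ξ i j => ?_
    rw [sub_apply, lp.coeFn_sub, Pi.sub_apply, PiLp.sub_apply]
    simp only [diagOp_apply]
    ring
  rw [this]
  exact norm_diagOp_le _ hM

/-- An operator of rank below `|s|` kills a nonzero vector in the span of the basis vectors indexed
by `s`. On that span the diagonal operator stretches norms by at least `c`. -/
theorem le_singularValue_diagOp {s : Finset (ι × Fin 2)} {n : ℕ} (hn : n < s.card) {c : ℝ}
    (hs : ∀ q ∈ s, c ≤ ‖a q.1 q.2‖) : c ≤ singularValue (diagOp a h) n := by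
  classical
  rcases le_or_gt c 0 with hc | hc
  · exact hc.trans (singularValue_nonneg _ _)
  refine le_singularValue _ fun F hF1 hF2 => ?_
  let V : (s → ℂ) →ₗ[ℂ] BlockSpace ι :=
    Fintype.linearCombination ℂ (fun q : s => stdVec q.1.1 q.1.2)
  have hV : ∀ v i j, V v i j = if hq : (i, j) ∈ s then v ⟨(i, j), hq⟩ else 0 := by
    intro v i j
    simp only [V, Fintype.linearCombination_apply]
    rw [lp.coeFn_sum, Finset.sum_apply, WithLp.ofLp_sum, Finset.sum_apply]
    simp only [lp.coeFn_smul, Pi.smul_apply, PiLp.smul_apply, smul_eq_mul, stdVec_apply]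
    split_ifs with hq
    · rw [Finset.sum_eq_single ⟨(i, j), hq⟩]
      · simp
      · rintro ⟨⟨k, l⟩, hk⟩ - hne
        have : ¬ (i = k ∧ j = l) := fun hh => hne (by simp [hh.1, hh.2])
        simp [this]
      · simp
    · refine Finset.sum_eq_zero ?_
      rintro ⟨⟨k, l⟩, hk⟩ -
      have : ¬ (i = k ∧ j = l) := fun hh => hq (by rw [hh.1, hh.2]; exact hk)
      simp [this]
  let G : (s → ℂ) →ₗ[ℂ] LinearMap.range (F : BlockSpace ι →ₗ[ℂ] BlockSpace ι) :=
    (F : BlockSpace ι →ₗ[ℂ] BlockSpace ι).rangeRestrict ∘ₗ V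
  have hker : LinearMap.ker G ≠ ⊥ := LinearMap.ker_ne_bot_of_finrank_lt (by
    rw [Module.finrank_fintype_fun_eq_card, Fintype.card_coe]; omega)
  obtain ⟨v, hv, hv0⟩ := (Submodule.ne_bot_iff _).1 hker
  have hFv : F (V v) = 0 := by
    have := congrArg Subtype.val (LinearMap.mem_ker.1 hv)
    exact this
  have hVv : V v ≠ 0 := by
    intro h0
    refine hv0 (funext fun q => ?_)
    have := hV v q.1.1 q.1.2
    rw [h0, dif_pos q.2] at this
    exact this.symm
  -- These coefficients define a contraction taking `T v` back to `c v`, which gives `c ‖v‖ ≤ ‖T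
  -- v‖`.
  let b : ι → Fin 2 → ℂ := fun i j => if (i, j) ∈ s then (c : ℂ) / a i j else 0
  have ha0 : ∀ i j, (i, j) ∈ s → 0 < ‖a i j‖ := fun i j hq => hc.trans_le (hs (i, j) hq)
  have hb : ∀ i j, ‖b i j‖ ≤ 1 := by
    intro i j
    by_cases hi : (i, j) ∈ s
    · simp only [b, hi, if_true, norm_div, Complex.norm_real, Real.norm_of_nonneg hc.le]
      exact (div_le_one (ha0 i j hi)).2 (hs (i, j) hi)
    · simp [b, hi]
  have hcv : (c : ℂ) • V v = diagOp b hb (diagOp a h (V v)) := by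
    ext i j
    rw [diagOp_apply, diagOp_apply, lp.coeFn_smul, Pi.smul_apply, PiLp.smul_apply, smul_eq_mul]
    by_cases hi : (i, j) ∈ s
    · have : a i j ≠ 0 := norm_pos_iff.1 (ha0 i j hi)
      simp only [b, hi, if_true]
      field_simp
    · rw [hV, dif_neg hi]; simp
  have h1 : c * ‖V v‖ ≤ ‖diagOp a h (V v)‖ := by
    have : ‖(c : ℂ) • V v‖ = c * ‖V v‖ := by
      rw [norm_smul, Complex.norm_real, Real.norm_of_nonneg hc.le]
    rw [← this, hcv]
    refine (ContinuousLinearMap.le_opNorm _ _).trans ?_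
    exact mul_le_of_le_one_left (norm_nonneg _) (norm_diagOp_le hb zero_le_one)
  have h2 : ‖diagOp a h (V v)‖ ≤ ‖diagOp a h - F‖ * ‖V v‖ := by
    have : diagOp a h (V v) = (diagOp a h - F) (V v) := by rw [sub_apply, hFv, sub_zero]
    rw [this]
    exact ContinuousLinearMap.le_opNorm _ _
  exact le_of_mul_le_mul_right (h1.trans h2) (norm_pos_iff.2 hVv)

/-- Induction by removing a coefficient of least modulus: it is at most the singular value of index
`|s| - 1`. -/
theorem sum_norm_le_sum_singularValue (s : Finset (ι × Fin 2)) :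
    ∑ q ∈ s, ‖a q.1 q.2‖ ≤ ∑ n ∈ Finset.range s.card, singularValue (diagOp a h) n := by
  classical
  induction hk : s.card generalizing s with
  | zero => rw [Finset.card_eq_zero.1 hk]; simp
  | succ k ih =>
    have hne : s.Nonempty := Finset.card_pos.1 (by omega)
    obtain ⟨q, hq, hmin⟩ := s.exists_min_image (fun q => ‖a q.1 q.2‖) hne
    rw [← Finset.sum_erase_add _ _ hq, Finset.sum_range_succ]
    refine add_le_add (ih _ (by rw [Finset.card_erase_of_mem hq]; omega)) ?_
    exact le_singularValue_diagOp h (by omega) hmin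

/-- The slack `c` means that `s` need not consist of the largest coefficients. The hypothesis
survives the removal of a coefficient of least modulus, so induction applies. -/
theorem sum_singularValue_card_le (s : Finset (ι × Fin 2)) {c : ℝ} (hc : 0 ≤ c)
    (hs : ∀ q ∉ s, ∀ q' ∈ s, ‖a q.1 q.2‖ ≤ ‖a q'.1 q'.2‖ + c) :
    ∑ n ∈ Finset.range s.card, singularValue (diagOp a h) n
      ≤ ∑ q ∈ s, (‖a q.1 q.2‖ + c) := by
  classical
  induction hk : s.card generalizing s with
  | zero => rw [Finset.card_eq_zero.1 hk]; simp
  | succ k ih =>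
    have hne : s.Nonempty := Finset.card_pos.1 (by omega)
    obtain ⟨q, hq, hmin⟩ := s.exists_min_image (fun q => ‖a q.1 q.2‖) hne
    have hcard : (s.erase q).card = k := by rw [Finset.card_erase_of_mem hq]; omega
    rw [← Finset.sum_erase_add _ _ hq, Finset.sum_range_succ]
    refine add_le_add (ih _ (fun p hp p' hp' => ?_) hcard) ?_
    · have hp'' := Finset.mem_of_mem_erase hp'
      by_cases hpq : p = q
      · subst hpq
        exact (hmin p' hp'').trans (le_add_of_nonneg_right hc)
      · exact hs p (fun hh => hp (Finset.mem_erase.2 ⟨hpq, hh⟩)) p' hp''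
    · rw [← hcard]
      refine singularValue_diagOp_le h (add_nonneg (norm_nonneg _) hc) fun p hp => ?_
      by_cases hpq : p = q
      · subst hpq
        exact le_add_of_nonneg_right hc
      · exact hs p (fun hh => hp (Finset.mem_erase.2 ⟨hpq, hh⟩)) q hq

/-- It will be applied with `c = B/Λ` and `N = KΛ`: the error `N c` is then constant and disappears
after division by `log N`. -/
theorem sum_singularValue_le (s : Finset (ι × Fin 2)) {c : ℝ} (hc : 0 ≤ c)
    (hs : ∀ q ∉ s, ‖a q.1 q.2‖ ≤ c) {N : ℕ} (hN : s.card ≤ N) :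
    ∑ n ∈ Finset.range N, singularValue (diagOp a h) n ≤ ∑ q ∈ s, ‖a q.1 q.2‖ + N * c := by
  have hanti : ∀ n, s.card ≤ n → singularValue (diagOp a h) n ≤ c := by
    intro n hn
    refine le_trans ?_ (singularValue_diagOp_le h hc hs)
    refine csInf_le_csInf ⟨0, ?_⟩ ⟨‖diagOp a h - 0‖, 0, ?_, ?_, rfl⟩ ?_
    · rintro r ⟨F, -, -, rfl⟩
      exact norm_nonneg _
    · rw [ContinuousLinearMap.toLinearMap_zero, LinearMap.range_zero]; infer_instance
    · rw [ContinuousLinearMap.toLinearMap_zero, LinearMap.range_zero]; simp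
    · rintro r ⟨F, h1, h2, rfl⟩
      exact ⟨F, h1, h2.trans hn, rfl⟩
  rw [← Finset.sum_range_add_sum_Ico _ hN]
  have h1 := sum_singularValue_card_le h s hc
    fun q hq q' _ => (hs q hq).trans (le_add_of_nonneg_left (norm_nonneg _))
  have h2 : ∑ n ∈ Finset.Ico s.card N, singularValue (diagOp a h) n
      ≤ ∑ n ∈ Finset.Ico s.card N, c :=
    Finset.sum_le_sum fun n hn => hanti n (Finset.mem_Ico.1 hn).1
  rw [Finset.sum_const, Nat.card_Ico, nsmul_eq_mul, Nat.cast_sub hN] at h2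
  rw [Finset.sum_add_distrib, Finset.sum_const, nsmul_eq_mul] at h1
  linarith

end SingularValues

/-! ### Logarithmic means and Dixmier traces -/

section Limits

theorem tendsto_log_div_const_div_log {K : ℝ} (hK : 0 < K) :
    Tendsto (fun N : ℕ => Real.log ((N : ℝ) / K) / Real.log N) atTop (𝓝 1) := by
  have hlog : Tendsto (fun N : ℕ => Real.log (N : ℝ)) atTop atTop :=
    Real.tendsto_log_atTop.comp tendsto_natCast_atTop_atTop
  have h1 : Tendsto (fun N : ℕ => 1 - Real.log K / Real.log N) atTop (𝓝 (1 - 0)) :=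
    tendsto_const_nhds.sub (hlog.const_div_atTop _)
  rw [sub_zero] at h1
  refine h1.congr' ?_
  filter_upwards [eventually_ge_atTop 2] with N hN
  have hN' : (1 : ℝ) < N := by exact_mod_cast hN
  have : Real.log (N : ℝ) ≠ 0 := (Real.log_pos hN').ne'
  rw [Real.log_div (by positivity) hK.ne']
  field_simp

/-- The logarithmic partial sums of the singular values of a diagonal operator are governed by the
sums of its coefficients over an exhausting family of finite sets of blocks. -/
theorem tendsto_logPartialSum_diagOp {ι : Type*} {a : ι → Fin 2 → ℂ} {C : ℝ}
    (h : ∀ i j, ‖a i j‖ ≤ C) (F : ℝ → Finset ι) {K B L : ℝ} (hK : 0 < K) (hB : 0 ≤ B)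
    (hcard : ∀ᶠ Λ in atTop, (2 * (F Λ).card : ℝ) ≤ K * Λ)
    (hoff : ∀ Λ > 0, ∀ i ∉ F Λ, ∀ j, ‖a i j‖ ≤ B / Λ)
    (hsum : Tendsto (fun Λ : ℝ => (∑ i ∈ F Λ, ∑ j, ‖a i j‖) / Real.log Λ) atTop (𝓝 L)) :
    Tendsto (logPartialSum (diagOp a h)) atTop (𝓝 L) := by
  -- The cutoff is `Λ = N/K`. It leaves at most `N` coefficients inside, those outside contribute at
  -- most `N · B/Λ = BK`, and `log Λ ~ log N`.
  have hΛ : Tendsto (fun N : ℕ => (N : ℝ) / K) atTop atTop :=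
    tendsto_natCast_atTop_atTop.atTop_div_const hK
  have hlog : Tendsto (fun N : ℕ => Real.log (N : ℝ)) atTop atTop :=
    Real.tendsto_log_atTop.comp tendsto_natCast_atTop_atTop
  have hmain : Tendsto (fun N : ℕ => (∑ i ∈ F (N / K), ∑ j, ‖a i j‖) / Real.log N) atTop (𝓝 L) := by
    have := (hsum.comp hΛ).mul (tendsto_log_div_const_div_log hK)
    rw [mul_one] at this
    refine this.congr' ?_
    filter_upwards [hΛ.eventually (eventually_gt_atTop 1)] with N hN
    have : Real.log ((N : ℝ) / K) ≠ 0 := (Real.log_pos hN).ne'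
    simp only [Function.comp_apply]
    field_simp
  have hupper : Tendsto (fun N : ℕ => (∑ i ∈ F (N / K), ∑ j, ‖a i j‖) / Real.log N
      + (B * K) / Real.log N) atTop (𝓝 (L + 0)) := hmain.add (hlog.const_div_atTop _)
  rw [add_zero] at hupper
  have hs : ∀ Λ, ∑ i ∈ F Λ, ∑ j, ‖a i j‖ = ∑ q ∈ F Λ ×ˢ Finset.univ, ‖a q.1 q.2‖ := fun Λ =>
    (Finset.sum_product (F Λ) Finset.univ fun q => ‖a q.1 q.2‖).symm
  have hev : ∀ᶠ N : ℕ in atTop, (F (N / K) ×ˢ (Finset.univ : Finset (Fin 2))).card ≤ N := by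
    filter_upwards [hΛ.eventually hcard] with N hN
    rw [mul_div_cancel₀ _ hK.ne'] at hN
    rw [Finset.card_product, Finset.card_univ, Fintype.card_fin, mul_comm]
    exact_mod_cast hN
  refine tendsto_of_tendsto_of_tendsto_of_le_of_le' hmain hupper ?_ ?_
  · filter_upwards [hev, eventually_ge_atTop 2] with N hN hN2
    have hN' : (1 : ℝ) < N := by exact_mod_cast hN2
    refine div_le_div_of_nonneg_right ?_ (Real.log_pos hN').le
    rw [hs]
    refine (sum_norm_le_sum_singularValue h _).trans ?_
    exact Finset.sum_le_sum_of_subset_of_nonneg (Finset.range_subset_range.2 hN)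
      fun n _ _ => singularValue_nonneg _ _
  · filter_upwards [hev, eventually_ge_atTop 2] with N hN hN2
    have hN' : (1 : ℝ) < N := by exact_mod_cast hN2
    rw [← add_div]
    refine div_le_div_of_nonneg_right ?_ (Real.log_pos hN').le
    have h0 : (0 : ℝ) < N / K := by positivity
    have := sum_singularValue_le h (F (N / K) ×ˢ Finset.univ) (c := B / (N / K)) (by positivity)
      (fun q hq => hoff _ h0 _ (fun hh => hq (Finset.mem_product.2 ⟨hh, Finset.mem_univ _⟩)) _) hN
    rw [hs]
    refine this.trans (le_of_eq ?_)
    field_simp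

/-- The weights `log k - log (k-1)` are nonnegative and sum to `log n`, which diverges. So `(a k -
L)` times the weight sums to `o(log n)`. -/
theorem tendsto_logCesaro {a : ℕ → ℝ} {L : ℝ} (ha : Tendsto a atTop (𝓝 L)) :
    Tendsto (logCesaro a) atTop (𝓝 L) := by
  set w : ℕ → ℝ := fun k => Real.log ((k + 2 : ℕ) : ℝ) - Real.log ((k + 1 : ℕ) : ℝ) with hw
  have hw0 : ∀ k, 0 ≤ w k := fun k => sub_nonneg.2 (Real.log_le_log (by positivity) (by
    push_cast; linarith))
  have hwsum : ∀ n, ∑ k ∈ Finset.range n, w k = Real.log ((n + 1 : ℕ) : ℝ) := by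
    intro n
    have := Finset.sum_range_sub (fun k : ℕ => Real.log ((k + 1 : ℕ) : ℝ)) n
    simpa [hw, add_assoc, one_add_one_eq_two] using this
  have hlog : Tendsto (fun n : ℕ => Real.log ((n + 1 : ℕ) : ℝ)) atTop atTop :=
    Real.tendsto_log_atTop.comp (tendsto_natCast_atTop_atTop.comp (tendsto_add_atTop_nat 1))
  have h1 : (fun k => (a (k + 2) - L) * w k) =o[atTop] w := by
    have : Tendsto (fun k => a (k + 2) - L) atTop (𝓝 0) := by
      have := (ha.comp (tendsto_add_atTop_nat 2)).sub_const L
      simpa using this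
    simpa using ((Asymptotics.isLittleO_one_iff ℝ).2 this).mul_isBigO (Asymptotics.isBigO_refl w atTop)
  have h2 := h1.sum_range hw0 (by simpa only [hwsum] using hlog)
  simp only [hwsum] at h2
  have h3 := h2.tendsto_div_nhds_zero
  have h4 : Tendsto (fun n : ℕ => logCesaro a (n + 1)) atTop (𝓝 L) := by
    have h5 := h3.add_const L
    rw [zero_add] at h5
    refine h5.congr' ?_
    filter_upwards [eventually_ge_atTop 1] with n hn
    have hpos : 0 < Real.log ((n + 1 : ℕ) : ℝ) := Real.log_pos (by
      have : (1 : ℝ) ≤ n := by exact_mod_cast hn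
      push_cast; linarith)
    have h6 : ∑ k ∈ Finset.Icc 2 (n + 1), a k * (Real.log k - Real.log ((k : ℝ) - 1))
        = ∑ k ∈ Finset.range n, a (k + 2) * w k := by
      rw [← Finset.Ico_add_one_right_eq_Icc, Finset.sum_Ico_eq_sum_range]
      refine Finset.sum_congr (by congr 1) fun k _ => ?_
      rw [add_comm 2 k, hw]
      congr 3
      push_cast; ring
    rw [logCesaro, h6, div_add' _ _ _ hpos.ne']
    congr 1
    rw [← hwsum, Finset.mul_sum, ← Finset.sum_add_distrib]
    exact Finset.sum_congr rfl fun k _ => by ring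
  exact (tendsto_add_atTop_iff_nat 1).1 h4

/-- A non-principal ultrafilter on `ℕ` is finer than `atTop`, so it inherits the ordinary limit. -/
theorem dixmierTracePos_eq {H : Type*} [NormedAddCommGroup H] [InnerProductSpace ℂ H]
    {T : H →L[ℂ] H} {L : ℝ} (hT : Tendsto (logPartialSum T) atTop (𝓝 L)) {ω : Ultrafilter ℕ}
    (hω : ∀ n : ℕ, ω ≠ pure n) : dixmierTracePos ω T = L := by
  have hle : (ω : Filter ℕ) ≤ atTop := by
    rw [← Nat.cofinite_eq_atTop]
    rcases Ultrafilter.le_cofinite_or_eq_pure ω with h | ⟨n, hn⟩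
    · exact h
    · exact absurd hn (hω n)
  exact ((tendsto_logCesaro hT).mono_left hle).limUnder_eq

/-- A decomposition of a self-adjoint element into positive parts with product zero is unique, which
identifies the positive and negative parts in `dixmierTrace`. -/
theorem dixmierTrace_eq {H : Type*} [NormedAddCommGroup H] [InnerProductSpace ℂ H]
    [CompleteSpace H] (ω : Ultrafilter ℕ) {P N R S : H →L[ℂ] H} (hP : 0 ≤ P) (hN : 0 ≤ N)
    (hR : 0 ≤ R) (hS : 0 ≤ S) (hPN : P * N = 0) (hRS : R * S = 0) :
    dixmierTrace ω ((P - N) + Complex.I • (R - S)) =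
      ((dixmierTracePos ω P : ℝ) : ℂ) - ((dixmierTracePos ω N : ℝ) : ℂ)
        + Complex.I * (((dixmierTracePos ω R : ℝ) : ℂ) - ((dixmierTracePos ω S : ℝ) : ℂ)) := by
  have hA : IsSelfAdjoint (P - N) := (IsSelfAdjoint.of_nonneg hP).sub (.of_nonneg hN)
  have hB : IsSelfAdjoint (R - S) := (IsSelfAdjoint.of_nonneg hR).sub (.of_nonneg hS)
  have hre : (realPart ((P - N) + Complex.I • (R - S)) : H →L[ℂ] H) = P - N := by
    rw [map_add, AddSubgroup.coe_add, hA.coe_realPart, realPart_I_smul, hB.imaginaryPart]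
    simp
  have him : (imaginaryPart ((P - N) + Complex.I • (R - S)) : H →L[ℂ] H) = R - S := by
    rw [map_add, AddSubgroup.coe_add, hA.imaginaryPart, imaginaryPart_I_smul, hB.coe_realPart]
    simp
  have h1 := CFC.posPart_negPart_unique (a := P - N) rfl hPN hP hN
  have h2 := CFC.posPart_negPart_unique (a := R - S) rfl hRS hR hS
  rw [dixmierTrace, hre, him, h1.1, h1.2, h2.1, h2.2]

end Limits

/-! ### Rigidity of minimal covers, and the interaction length -/

section Covers

/-- The set of centres of a minimal covering of the unit interval by `N` intervals of length
`1 / N` is unique. -/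
theorem IsMinimalBallCover.mem_iff {N : ℕ} (hN : 1 ≤ N) {r : ℝ} (hr : r = 1 / (2 * N))
    {S : Finset unitInterval} (hS : IsMinimalBallCover r S) (t : unitInterval) :
    t ∈ S ↔ ∃ k < N, (t : ℝ) = (2 * k + 1) / (2 * N) := by
  classical
  have hN0 : (0 : ℝ) < N := by exact_mod_cast hN
  have hcI : ∀ k, k < N → ((2 * k + 1) / (2 * N) : ℝ) ∈ unitInterval := by
    intro k hk
    refine ⟨by positivity, (div_le_one (by positivity)).2 ?_⟩
    have : (k : ℝ) + 1 ≤ N := by exact_mod_cast hk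
    linarith
  let ctr : ℕ → unitInterval := fun k => Set.projIcc 0 1 zero_le_one ((2 * k + 1) / (2 * N))
  have hctr : ∀ k, k < N → (ctr k : ℝ) = (2 * k + 1) / (2 * N) := fun k hk => by
    simp only [ctr]
    rw [Set.projIcc_of_mem _ (hcI k hk)]
  let S0 : Finset unitInterval := (Finset.range N).image ctr
  have hcover : IsBallCover r S0 := by
    intro s
    obtain ⟨k, hk, h1, h2⟩ : ∃ k < N, (k : ℝ) ≤ s * N ∧ (s : ℝ) * N ≤ k + 1 := by
      rcases eq_or_lt_of_le s.2.2 with h | h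
      · refine ⟨N - 1, by omega, ?_, ?_⟩ <;> rw [h, one_mul] <;> push_cast [hN] <;> linarith
      · have h0 : (0 : ℝ) ≤ s * N := mul_nonneg s.2.1 hN0.le
        refine ⟨⌊(s : ℝ) * N⌋₊, ?_, Nat.floor_le h0, (Nat.lt_floor_add_one _).le⟩
        exact (Nat.floor_lt h0).2 (by nlinarith)
    refine ⟨ctr k, Finset.mem_image_of_mem _ (Finset.mem_range.2 hk), ?_⟩
    rw [Metric.mem_closedBall, Subtype.dist_eq, Real.dist_eq, hctr k hk, hr, abs_le]
    have e1 : ((2 * k + 1) / (2 * N) : ℝ) = (k + 1 / 2) / N := by field_simp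
    have e2 : (1 / (2 * N) : ℝ) = (1 / 2) / N := by field_simp
    have e3 : (s : ℝ) = s * N / N := by field_simp
    rw [e1, e2, e3, ← sub_div, neg_div', div_le_div_iff_of_pos_right hN0,
      div_le_div_iff_of_pos_right hN0]
    constructor <;> linarith
  have hcard : S.card ≤ N := (hS.2 S0 hcover).trans
    (Finset.card_image_le.trans (Finset.card_range N).le)
  have hmem : ∀ k < N, ctr k ∈ S := by
    intro k hk
    have hk' : (k : ℝ) + 1 ≤ N := by exact_mod_cast hk
    -- `S` is finite, hence closed, so it suffices to find points of `S` arbitrarily close to `ctr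
    -- k`.
    have hcl : ctr k ∈ closure (S : Set unitInterval) := by
      rw [Metric.mem_closure_iff]
      intro ε0 hε0
      obtain ⟨ε, hε, hεε, hεN⟩ : ∃ ε > 0, ε < ε0 ∧ ε * N < 1 := by
        refine ⟨min (ε0 / 2) (1 / (2 * N)), by positivity, ?_, ?_⟩
        · exact (min_le_left _ _).trans_lt (by linarith)
        · have := min_le_right (ε0 / 2) (1 / (2 * N) : ℝ)
          calc min (ε0 / 2) (1 / (2 * N) : ℝ) * N ≤ 1 / (2 * N) * N := by gcongr
            _ = 1 / 2 := by field_simp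
            _ < 1 := by norm_num
      -- `N + 1` points, only two of which fit into a common ball
      let z : ℕ → ℝ := fun i => if i ≤ k then i * (1 + ε) / N else 1 - (N - i) * (1 + ε) / N
      have hzN : ∀ i, z i * N = if i ≤ k then i * (1 + ε) else N - (N - i) * (1 + ε) := by
        intro i
        simp only [z]
        split_ifs <;> field_simp
      have hzI : ∀ i ≤ N, z i ∈ unitInterval := by
        intro i hi
        have hi' : (i : ℝ) ≤ N := by exact_mod_cast hi
        have hi0 : (0 : ℝ) ≤ i := Nat.cast_nonneg i
        have h1 := hzN i
        have h2 : 0 ≤ z i * N ∧ z i * N ≤ N := by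
          rw [h1]
          split_ifs with hik
          · have : (i : ℝ) ≤ k := by exact_mod_cast hik
            constructor
            · positivity
            · nlinarith
          · have : (k : ℝ) + 1 ≤ i := by exact_mod_cast (by omega : k + 1 ≤ i)
            have hk0 : (0 : ℝ) ≤ k := Nat.cast_nonneg k
            constructor <;> nlinarith
        exact ⟨nonneg_of_mul_nonneg_left h2.1 hN0, by
          by_contra! h; nlinarith [h2.2]⟩
      have hsep : ∀ i j, i < j → j ≤ N → ¬ (i = k ∧ j = k + 1) → 1 < (z j - z i) * N := by
        intro i j hij hj hne
        have hij' : (i : ℝ) + 1 ≤ j := by exact_mod_cast hij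
        have hj' : (j : ℝ) ≤ N := by exact_mod_cast hj
        have hi0 : (0 : ℝ) ≤ i := Nat.cast_nonneg i
        rw [sub_mul, hzN, hzN]
        by_cases h1 : j ≤ k
        · rw [if_pos h1, if_pos (by omega : i ≤ k)]; nlinarith
        · by_cases h2 : i ≤ k
          · rw [if_neg h1, if_pos h2]
            have h3 : (i : ℝ) + 2 ≤ j := by exact_mod_cast (by omega : i + 2 ≤ j)
            nlinarith
          · rw [if_neg h1, if_neg h2]; nlinarith
      have hball : ∀ i, ∃ c ∈ S, i ≤ N → |z i - (c : ℝ)| ≤ r := by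
        intro i
        by_cases hi : i ≤ N
        · obtain ⟨c, hc, hm⟩ := hS.1 ⟨z i, hzI i hi⟩
          refine ⟨c, hc, fun _ => ?_⟩
          rwa [Metric.mem_closedBall, Subtype.dist_eq, Real.dist_eq] at hm
        · obtain ⟨c, hc, -⟩ := hS.1 0
          exact ⟨c, hc, fun h => absurd h hi⟩
      choose c hcS hcb using hball
      -- There are at most `N` centres for `N + 1` points, so two points share a ball. All gaps are
      -- stretched to `(1+ε)/N` except the one around `ctr k`, so these two are `z k` and `z (k+1)`,
      -- and their common centre is within `ε` of `ctr k`.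
      obtain ⟨i, hi, j, hj, hij, heq⟩ := Finset.exists_ne_map_eq_of_card_lt_of_maps_to
        (s := Finset.range (N + 1)) (t := S) (by rw [Finset.card_range]; omega)
        (f := c) (fun i _ => hcS i)
      have key : ∀ i j, i < j → j ≤ N → c i = c j → i = k ∧ j = k + 1 := by
        intro i j hij hj he
        by_contra hne
        have h1 := hsep i j hij hj hne
        have h2 := abs_le.1 (hcb i (by omega))
        have h3 := abs_le.1 (hcb j hj)
        rw [he] at h2
        have h4 : z j - z i ≤ 2 * r := by linarith [h2.1, h3.2]
        have h5 : (z j - z i) * N ≤ 2 * r * N := by gcongr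
        have h6 : 2 * r * N = 1 := by rw [hr]; field_simp
        linarith
      have hcc : c k = c (k + 1) := by
        rw [Finset.mem_range] at hi hj
        rcases lt_or_gt_of_ne hij with h | h
        · obtain ⟨rfl, rfl⟩ := key i j h (by omega) heq
          exact heq
        · obtain ⟨rfl, rfl⟩ := key j i h (by omega) heq.symm
          exact heq.symm
      refine ⟨c k, hcS k, ?_⟩
      refine lt_of_le_of_lt ?_ hεε
      rw [Subtype.dist_eq, Real.dist_eq, hctr k hk, abs_le]
      have h1 := abs_le.1 (hcb k (by omega))
      have h2 := abs_le.1 (hcb (k + 1) (by omega))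
      rw [← hcc] at h2
      have h3 := hzN k
      have h4 := hzN (k + 1)
      rw [if_pos le_rfl] at h3
      rw [if_neg (by omega)] at h4
      push_cast at h4
      have hrN : r * N = 1 / 2 := by rw [hr]; field_simp
      have hcN : ((2 * k + 1) / (2 * N) : ℝ) * N = k + 1 / 2 := by field_simp
      have hk0 : (0 : ℝ) ≤ k := Nat.cast_nonneg k
      constructor
      · refine le_of_mul_le_mul_right ?_ hN0
        have : ((c k : unitInterval) : ℝ) * N ≤ (z k + r) * N := by
          gcongr; linarith [h1.1]
        nlinarith
      · refine le_of_mul_le_mul_right ?_ hN0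
        have : (z (k + 1) - r) * N ≤ ((c k : unitInterval) : ℝ) * N := by
          gcongr; linarith [h2.2]
        nlinarith
    rwa [(Finset.finite_toSet S).isClosed.closure_eq] at hcl
  have hinj : Set.InjOn ctr (Finset.range N : Set ℕ) := by
    intro i hi j hj h
    have h1 : (ctr i : ℝ) = ctr j := congrArg Subtype.val h
    rw [hctr i (by simpa using hi), hctr j (by simpa using hj)] at h1
    rw [div_left_inj' (by positivity)] at h1
    have : (i : ℝ) = j := by linarith
    exact_mod_cast this
  have hSS : S0 = S := by
    refine Finset.eq_of_subset_of_card_le ?_ ?_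
    · intro s hs
      obtain ⟨k, hk, rfl⟩ := Finset.mem_image.1 hs
      exact hmem k (Finset.mem_range.1 hk)
    · rw [Finset.card_image_of_injOn hinj, Finset.card_range]; exact hcard
  rw [← hSS]
  constructor
  · intro h
    obtain ⟨k, hk, rfl⟩ := Finset.mem_image.1 h
    exact ⟨k, Finset.mem_range.1 hk, hctr k (Finset.mem_range.1 hk)⟩
  · rintro ⟨k, hk, h⟩
    refine Finset.mem_image.2 ⟨k, Finset.mem_range.2 hk, Subtype.ext ?_⟩
    rw [hctr k hk, h]

/-- The diameter 1 gives `k₀ = 0`, and `4/(1 - 1/2) = 8 < 9` selects the first clause. -/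
theorem interactionLength_unitInterval : interactionLength unitInterval 9 1 (1 / 2) = 0 := by
  have hdiam : Metric.diam (Set.univ : Set unitInterval) = 1 := by
    refine le_antisymm ?_ ?_
    · refine Metric.diam_le_of_forall_dist_le zero_le_one fun s _ t _ => ?_
      rw [Subtype.dist_eq, Real.dist_eq, abs_le]
      constructor <;> linarith [s.2.1, s.2.2, t.2.1, t.2.2]
    · have := Metric.dist_le_diam_of_mem (s := (Set.univ : Set unitInterval))
        (Metric.isBounded_of_compactSpace) (Set.mem_univ 0) (Set.mem_univ 1)
      simpa [Subtype.dist_eq] using this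
  refine Nat.sInf_eq_zero.2 (Or.inl ?_)
  refine ⟨0, ?_, ?_, fun _ => by simp, fun h => ?_⟩
  · rw [hdiam]; norm_num
  · rw [hdiam]; norm_num
  · norm_num at h

end Covers

/-! ### Dyadic pairs and uniqueness of their parameters -/

section Dyadic

/-- The dyadic point `u / 2^q`, clipped to the unit interval. -/
def dyadic (q u : ℕ) : unitInterval := Set.projIcc 0 1 zero_le_one ((u : ℝ) / 2 ^ q)

theorem coe_dyadic {q u : ℕ} (h : u ≤ 2 ^ q) : (dyadic q u : ℝ) = (u : ℝ) / 2 ^ q := by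
  have : (u : ℝ) ≤ 2 ^ q := by exact_mod_cast h
  rw [dyadic, Set.projIcc_of_mem _ ⟨by positivity, (div_le_one (by positivity)).2 this⟩]

theorem dist_dyadic {q u w : ℕ} (h : u + w ≤ 2 ^ q) :
    dist (dyadic q u) (dyadic q (u + w)) = (w : ℝ) / 2 ^ q := by
  rw [Subtype.dist_eq, Real.dist_eq, coe_dyadic h, coe_dyadic (by omega), abs_sub_comm, ← sub_div,
    abs_of_nonneg]
  · push_cast; ring
  · push_cast; rw [add_sub_cancel_left]; positivity

theorem dyadic_ne {q u w : ℕ} (hw : 0 < w) (h : u + w ≤ 2 ^ q) :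
    dyadic q u ≠ dyadic q (u + w) := by
  rw [← dist_pos, dist_dyadic h]
  positivity

/-- The residues of the left end point `u` for which `{u / 2^q, (u + w) / 2^q}` is an interacting
pair. -/
def IsGood (w u : ℕ) : Prop :=
  (w = 1 ∧ (u % 4 = 1 ∨ u % 4 = 2)) ∨ (w = 2 ∧ u % 2 = 1) ∨
    (w = 3 ∧ (u % 4 = 2 ∨ u % 4 = 3)) ∨ (w = 4 ∧ u % 2 = 1)

instance (w u : ℕ) : Decidable (IsGood w u) := by unfold IsGood; infer_instance

/-- The pair `{u / 2^q, (u + w) / 2^q}`. -/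
def dyadicPair (q u w : ℕ) : Sym2 unitInterval := s(dyadic q u, dyadic q (u + w))

/-- A good pair has at least one odd numerator, so `q` is the least exponent clearing both
denominators. With `q < q'` both `u'` and `u' + w'` would be even. -/
theorem eq_of_dyadic_eq_aux {q u w q' u' w' : ℕ} (hq : q ≤ q')
    (hg' : IsGood w' u') (h1 : u * 2 ^ q' = u' * 2 ^ q)
    (h2 : (u + w) * 2 ^ q' = (u' + w') * 2 ^ q) : q = q' ∧ u = u' ∧ w = w' := by
  obtain ⟨e, rfl⟩ := Nat.exists_eq_add_of_le hq
  have hpos : 0 < 2 ^ q := by positivity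
  have h1' : u * 2 ^ e = u' := by
    refine Nat.eq_of_mul_eq_mul_right hpos ?_
    rw [← h1, pow_add]; ring
  have h2' : (u + w) * 2 ^ e = u' + w' := by
    refine Nat.eq_of_mul_eq_mul_right hpos ?_
    rw [← h2, pow_add]; ring
  rcases e with _ | e
  · simp only [pow_zero, mul_one] at h1' h2'
    exact ⟨rfl, h1', by omega⟩
  · exfalso
    have e1 : u' = 2 * (u * 2 ^ e) := by rw [← h1', pow_succ]; ring
    have e2 : u' + w' = 2 * ((u + w) * 2 ^ e) := by rw [← h2', pow_succ]; ring
    unfold IsGood at hg'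
    omega

theorem eq_of_dyadicPair_eq {q u w q' u' w' : ℕ} (hg : IsGood w u) (hg' : IsGood w' u')
    (hu : u + w < 2 ^ q) (hu' : u' + w' < 2 ^ q') (h : dyadicPair q u w = dyadicPair q' u' w') :
    q = q' ∧ u = u' ∧ w = w' := by
  have hw : 0 < w := by unfold IsGood at hg; omega
  have hw' : 0 < w' := by unfold IsGood at hg'; omega
  have key : ∀ a b : ℕ, a ≤ 2 ^ q → b ≤ 2 ^ q' → dyadic q a = dyadic q' b →
      a * 2 ^ q' = b * 2 ^ q := by
    intro a b ha hb hab
    have : (dyadic q a : ℝ) = dyadic q' b := congrArg Subtype.val hab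
    rw [coe_dyadic ha, coe_dyadic hb, div_eq_div_iff (by positivity) (by positivity)] at this
    exact_mod_cast this
  rcases Sym2.eq_iff.1 h with ⟨h1, h2⟩ | ⟨h1, h2⟩
  · have e1 := key _ _ (by omega) (by omega) h1
    have e2 := key _ _ (by omega) (by omega) h2
    rcases le_total q q' with hq | hq
    · exact eq_of_dyadic_eq_aux hq hg' e1 e2
    · obtain ⟨a, b, c⟩ := eq_of_dyadic_eq_aux hq hg e1.symm e2.symm
      exact ⟨a.symm, b.symm, c.symm⟩
  · exfalso
    have e1 := key _ _ (by omega) (by omega) h1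
    have e2 := key _ _ (by omega) (by omega) h2
    have p1 : 0 < w * 2 ^ q' := by positivity
    have p2 : 0 < w' * 2 ^ q := by positivity
    rw [add_mul] at e1 e2
    omega

end Dyadic

/-! ### The centres of the minimal covers -/

section Index

variable {𝒯 : ℕ → Finset unitInterval}
  (h𝒯 : ∀ n : ℕ, 1 ≤ n → IsMinimalBallCover (1 * (1 / 2 : ℝ) ^ (n - 1)) (𝒯 n))

include h𝒯

/-- The radius `2^(-m)` is `1/(2N)` with `N = 2^(m-1)`, so the cover is rigid. For `m = 0` the
radius is 1 and the centre is arbitrary. -/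
theorem mem_centres_iff {m : ℕ} (hm : 1 ≤ m) (t : unitInterval) :
    t ∈ 𝒯 (m + 1) ↔ ∃ u : ℕ, u % 2 = 1 ∧ u < 2 ^ m ∧ (t : ℝ) = (u : ℝ) / 2 ^ m := by
  obtain ⟨m, rfl⟩ := Nat.exists_eq_add_of_le' hm
  have h := h𝒯 (m + 1 + 1) (by omega)
  rw [h.mem_iff (N := 2 ^ m) Nat.one_le_two_pow (by
    rw [Nat.add_sub_cancel]; push_cast; rw [one_div, inv_pow, pow_succ]; field_simp)]
  constructor
  · rintro ⟨k, hk, h⟩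
    refine ⟨2 * k + 1, by omega, by rw [pow_succ]; omega, ?_⟩
    rw [h, pow_succ]; push_cast; congr 1; ring
  · rintro ⟨u, hu, hlt, h⟩
    rw [pow_succ] at hlt
    refine ⟨u / 2, by omega, ?_⟩
    have : u = 2 * (u / 2) + 1 := by omega
    rw [h, pow_succ]
    nth_rewrite 1 [this]
    push_cast; congr 1; ring

theorem dyadic_mem_centres {m u : ℕ} (hm : 1 ≤ m) (hu : u % 2 = 1) (hlt : u < 2 ^ m) :
    dyadic m u ∈ 𝒯 (m + 1) :=
  (mem_centres_iff h𝒯 hm _).2 ⟨u, hu, hlt, coe_dyadic hlt.le⟩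

/-- Over the denominator `2^(m+1)` a point of the coarser level has an even numerator. Hence the two
distance conditions of `pairIndex` never apply to the same `y` when `m ≥ 1`. -/
theorem centres_disjoint {m : ℕ} (hm : 1 ≤ m) {t : unitInterval} (h1 : t ∈ 𝒯 (m + 1))
    (h2 : t ∈ 𝒯 (m + 1 + 1)) : False := by
  obtain ⟨u, hu, -, h⟩ := (mem_centres_iff h𝒯 hm t).1 h1
  obtain ⟨v, hv, -, h'⟩ := (mem_centres_iff h𝒯 (by omega) t).1 h2
  rw [h, div_eq_div_iff (by positivity) (by positivity), pow_succ] at h'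
  have h3 : ((u * 2 : ℕ) : ℝ) = (v : ℝ) := by
    have h2 : (2 : ℝ) ^ m ≠ 0 := by positivity
    push_cast
    exact mul_right_cancel₀ h2 (by linarith)
  have : u * 2 = v := by exact_mod_cast h3
  omega

theorem exists_centres_one : ∃ c, 𝒯 1 = {c} := by
  have h := h𝒯 1 le_rfl
  rw [← Finset.card_eq_one]
  refine le_antisymm ?_ ?_
  · refine (h.2 {0} fun t => ⟨0, Finset.mem_singleton_self _, ?_⟩).trans (by simp)
    rw [Metric.mem_closedBall, Subtype.dist_eq, Real.dist_eq]
    simpa [abs_of_nonneg t.2.1] using t.2.2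
  · obtain ⟨c, hc, -⟩ := h.1 0
    exact Finset.card_pos.2 ⟨c, hc⟩

end Index

/-! ### Classification of the interacting pairs -/

section Index

theorem coords_close_of_dist_le {q a b c : ℕ} (ha : a < 2 ^ q) (hb : b < 2 ^ q)
    (h : dist (dyadic q a) (dyadic q b) ≤ (c : ℝ) / 2 ^ q) : a ≤ b + c ∧ b ≤ a + c := by
  rw [Subtype.dist_eq, Real.dist_eq, coe_dyadic ha.le, coe_dyadic hb.le, ← sub_div, abs_div,
    abs_of_pos (show (0 : ℝ) < 2 ^ q by positivity), div_le_div_iff_of_pos_right (by positivity),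
    abs_le] at h
  constructor
  · have : (a : ℝ) ≤ b + c := by linarith [h.2]
    exact_mod_cast this
  · have : (b : ℝ) ≤ a + c := by linarith [h.1]
    exact_mod_cast this

theorem exists_eq_dyadicPair {q a b : ℕ} (hab : a ≠ b) (ha : a < 2 ^ q) (hb : b < 2 ^ q)
    (h1 : a < b → IsGood (b - a) a) (h2 : b < a → IsGood (a - b) b) :
    ∃ u w, IsGood w u ∧ u + w < 2 ^ q ∧ s(dyadic q a, dyadic q b) = dyadicPair q u w := by
  rcases lt_or_gt_of_ne hab with h | h
  · refine ⟨a, b - a, h1 h, by omega, ?_⟩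
    rw [dyadicPair, Nat.add_sub_cancel' h.le]
  · refine ⟨b, a - b, h2 h, by omega, ?_⟩
    rw [dyadicPair, Nat.add_sub_cancel' h.le, Sym2.eq_swap]

/-- `J` consists of the dyadic pairs and of at most one further pair `p₀`. -/
structure IsDyadicIndex (J : Set (Sym2 unitInterval)) (p₀ : Sym2 unitInterval) : Prop where
  dyadicPair_mem : ∀ q u w, IsGood w u → u + w < 2 ^ q → dyadicPair q u w ∈ J
  eq_or_eq : ∀ p ∈ J, (∃ q u w, IsGood w u ∧ u + w < 2 ^ q ∧ p = dyadicPair q u w) ∨ p = p₀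
  not_isDiag : ∀ p ∈ J, ¬ p.IsDiag

/-- Here `m = n - 1`; as the interaction length is 0, the constants are `2 + ρ⁻¹ = 4` and `1 + ρ =
3/2`. -/
theorem mem_pairIndex_iff (𝒯 : ℕ → Finset unitInterval) (p : Sym2 unitInterval) :
    p ∈ pairIndex 9 1 (1 / 2) 𝒯 ↔ ∃ m x y, p = s(x, y) ∧ x ∈ 𝒯 (m + 1) ∧
      (y ∈ 𝒯 (m + 1) ∨ y ∈ 𝒯 (m + 1 + 1)) ∧ x ≠ y ∧
      (y ∈ 𝒯 (m + 1) → dist x y ≤ 4 / 2 ^ m) ∧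
      (y ∈ 𝒯 (m + 1 + 1) → dist x y ≤ 3 / 2 ^ (m + 1)) := by
  have e1 : ∀ m : ℕ, (2 + ((1 / 2 : ℝ) ^ (0 + 1))⁻¹) * (1 * (1 / 2) ^ m) = 4 / 2 ^ m := by
    intro m; norm_num; rw [one_div, inv_pow, div_eq_mul_inv]
  have e2 : ∀ m : ℕ, (1 + 1 / 2 : ℝ) * (1 * (1 / 2) ^ m) = 3 / 2 ^ (m + 1) := by
    intro m; rw [one_div, inv_pow, pow_succ]; field_simp; norm_num
  simp only [pairIndex, interactionLength_unitInterval, Set.mem_ofPred_eq]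
  constructor
  · rintro ⟨n, hn, x, y, h⟩
    obtain ⟨m, rfl⟩ := Nat.exists_eq_add_of_le' hn
    rw [Nat.add_sub_cancel, e1, e2] at h
    exact ⟨m, x, y, h⟩
  · rintro ⟨m, x, y, h⟩
    refine ⟨m + 1, by omega, x, y, ?_⟩
    rw [Nat.add_sub_cancel, e1, e2]
    exact h

/-- Coordinates are measured in units of the finer of the two levels. Points of one level have odd
coordinates differing by 2 or 4. For consecutive levels one coordinate is odd and the other is 2 mod
4, so they differ by 1 or 3. This is the list in `IsGood`. -/
theorem isDyadicIndex_pairIndex {𝒯 : ℕ → Finset unitInterval}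
    (h𝒯 : ∀ n : ℕ, 1 ≤ n → IsMinimalBallCover (1 * (1 / 2 : ℝ) ^ (n - 1)) (𝒯 n)) :
    ∃ p₀, IsDyadicIndex (pairIndex 9 1 (1 / 2) 𝒯) p₀ := by
  obtain ⟨c, hc⟩ := exists_centres_one h𝒯
  -- `dyadic 1 1` is `1/2`, the only point of `𝒯 2`, so `n = 1` yields no pair other than this one.
  refine ⟨s(c, dyadic 1 1), ?_, ?_, ?_⟩
  · intro q u w hg hlt
    rw [mem_pairIndex_iff]
    have hne : dyadic q u ≠ dyadic q (u + w) := dyadic_ne (by unfold IsGood at hg; omega) hlt.le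
    have hd := dist_dyadic hlt.le
    obtain ⟨m, rfl⟩ : ∃ m, q = m + 1 := Nat.exists_eq_add_of_le' (by
      by_contra! h0
      obtain rfl : q = 0 := by omega
      unfold IsGood at hg; omega)
    by_cases hsame : u % 2 = 1 ∧ (u + w) % 2 = 1
    · have hx := dyadic_mem_centres h𝒯 (Nat.succ_le_succ (Nat.zero_le m)) hsame.1 (by omega)
      have hy := dyadic_mem_centres h𝒯 (Nat.succ_le_succ (Nat.zero_le m)) hsame.2 hlt
      refine ⟨m + 1, _, _, rfl, hx, Or.inl hy, hne, fun _ => ?_, fun h =>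
        (centres_disjoint h𝒯 (by omega) hy h).elim⟩
      rw [hd]
      gcongr
      have : w ≤ 4 := by unfold IsGood at hg; omega
      exact_mod_cast this
    · have hm : 1 ≤ m := by
        by_contra! h0
        obtain rfl : m = 0 := by omega
        unfold IsGood at hg; omega
      have hw3 : (w : ℝ) ≤ 3 := by
        have : w ≤ 3 := by unfold IsGood at hg; omega
        exact_mod_cast this
      have hhalf : ∀ v, v % 4 = 2 → v < 2 ^ (m + 1) → dyadic (m + 1) v ∈ 𝒯 (m + 1) := by
        intro v hv hlt
        refine (mem_centres_iff h𝒯 hm _).2 ⟨v / 2, by omega, by rw [pow_succ] at hlt; omega, ?_⟩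
        rw [coe_dyadic hlt.le, pow_succ]
        have : v = v / 2 * 2 := by omega
        nth_rewrite 1 [this]
        push_cast
        field_simp
      by_cases hu : u % 4 = 2
      · have hx := hhalf u hu (by omega)
        have hy := dyadic_mem_centres h𝒯 (Nat.succ_le_succ (Nat.zero_le m)) (u := u + w)
          (by unfold IsGood at hg; omega) hlt
        refine ⟨m, _, _, rfl, hx, Or.inr hy, hne, fun h => (centres_disjoint h𝒯 hm h hy).elim,
          fun _ => ?_⟩
        rw [hd]
        gcongr
      · have hx := hhalf (u + w) (by unfold IsGood at hg; omega) hlt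
        have hy := dyadic_mem_centres h𝒯 (Nat.succ_le_succ (Nat.zero_le m)) (u := u)
          (by unfold IsGood at hg; omega) (by omega)
        refine ⟨m, _, _, Sym2.eq_swap, hx, Or.inr hy, hne.symm,
          fun h => (centres_disjoint h𝒯 hm h hy).elim, fun _ => ?_⟩
        rw [dist_comm, hd]
        gcongr
  · intro p hp
    obtain ⟨m, x, y, rfl, hx, hy, hne, h1, h2⟩ := (mem_pairIndex_iff 𝒯 p).1 hp
    rcases Nat.eq_zero_or_pos m with rfl | hm
    · right
      rw [zero_add, hc, Finset.mem_singleton] at hx hy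
      subst hx
      rcases hy with hy | hy
      · exact absurd hy.symm hne
      · obtain ⟨u, hu, hlt, hyu⟩ := (mem_centres_iff h𝒯 le_rfl y).1 hy
        obtain rfl : u = 1 := by omega
        rw [show y = dyadic 1 1 from Subtype.ext (by rw [hyu, coe_dyadic (by norm_num)])]
    · left
      obtain ⟨a, ha, halt, hxa⟩ := (mem_centres_iff h𝒯 hm x).1 hx
      rcases hy with hy | hy
      · obtain ⟨b, hb, hblt, hyb⟩ := (mem_centres_iff h𝒯 hm y).1 hy
        obtain rfl : x = dyadic m a := Subtype.ext (by rw [hxa, coe_dyadic halt.le])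
        obtain rfl : y = dyadic m b := Subtype.ext (by rw [hyb, coe_dyadic hblt.le])
        have hab : a ≠ b := fun h => hne (by rw [h])
        have hcl := coords_close_of_dist_le (c := 4) halt hblt (by exact_mod_cast h1 hy)
        exact ⟨m, exists_eq_dyadicPair hab halt hblt (fun _ => by unfold IsGood; omega)
          (fun _ => by unfold IsGood; omega)⟩
      · obtain ⟨b, hb, hblt, hyb⟩ := (mem_centres_iff h𝒯 (by omega) y).1 hy
        have halt' : 2 * a < 2 ^ (m + 1) := by rw [pow_succ]; omega
        obtain rfl : x = dyadic (m + 1) (2 * a) := Subtype.ext (by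
          rw [hxa, coe_dyadic halt'.le, pow_succ]; push_cast; field_simp)
        obtain rfl : y = dyadic (m + 1) b := Subtype.ext (by rw [hyb, coe_dyadic hblt.le])
        have hcl := coords_close_of_dist_le (c := 3) halt' hblt (by exact_mod_cast h2 hy)
        exact ⟨m + 1, exists_eq_dyadicPair (by omega) halt' hblt
          (fun _ => by unfold IsGood; omega) (fun _ => by unfold IsGood; omega)⟩
  · intro p hp
    obtain ⟨m, x, y, rfl, -, -, hne, -⟩ := (mem_pairIndex_iff 𝒯 p).1 hp
    rwa [Sym2.mk_isDiag_iff]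

end Index

/-! ### Sums over the pairs of length at least `1/Λ` -/

section Sums

/-- The distance between the two points of an unordered pair. -/
def pairDist (p : Sym2 unitInterval) : ℝ := Sym2.lift ⟨dist, dist_comm⟩ p

theorem pairDist_eq_out (p : Sym2 unitInterval) :
    pairDist p = dist (Quot.out p).1 (Quot.out p).2 := by
  conv_lhs => rw [← Quot.out_eq p]
  rfl

theorem pairDist_dyadicPair {q u w : ℕ} (h : u + w ≤ 2 ^ q) :
    pairDist (dyadicPair q u w) = (w : ℝ) / 2 ^ q := dist_dyadic h

theorem pairDist_le_one (p : Sym2 unitInterval) : pairDist p ≤ 1 := by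
  rw [pairDist_eq_out, Subtype.dist_eq, Real.dist_eq, abs_le]
  constructor <;>
    linarith [(Quot.out p).1.2.1, (Quot.out p).1.2.2, (Quot.out p).2.2.1, (Quot.out p).2.2.2]

/-- The parameters `(w, q, u)` of the dyadic pairs with distance at least `1 / Λ`. -/
def levelSet (Λ : ℝ) : Finset (Σ (_ : ℕ) (_ : ℕ), ℕ) :=
  (Finset.Icc 1 4).sigma fun w => (Finset.range (Nat.log 2 ⌊(w : ℝ) * Λ⌋₊ + 1)).sigma fun q =>
    (Finset.range (2 ^ q - w)).filter (IsGood w)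

/-- The length condition reads `2^q ≤ wΛ`, that is, `q ≤ log₂ ⌊wΛ⌋`; `1 ≤ Λ` keeps the floor
nonzero. -/
theorem mem_levelSet {Λ : ℝ} (hΛ : 1 ≤ Λ) (t : Σ (_ : ℕ) (_ : ℕ), ℕ) :
    t ∈ levelSet Λ ↔ IsGood t.1 t.2.2 ∧ t.2.2 + t.1 < 2 ^ t.2.1 ∧
      (pairDist (dyadicPair t.2.1 t.2.2 t.1))⁻¹ ≤ Λ := by
  obtain ⟨w, q, u⟩ := t
  simp only [levelSet, Finset.mem_sigma, Finset.mem_Icc, Finset.mem_range, Finset.mem_filter]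
  have key : 1 ≤ w → u + w < 2 ^ q → (q < Nat.log 2 ⌊(w : ℝ) * Λ⌋₊ + 1 ↔
      (pairDist (dyadicPair q u w))⁻¹ ≤ Λ) := by
    intro hw hlt
    have hw' : (1 : ℝ) ≤ w := by exact_mod_cast hw
    have h1 : (1 : ℝ) ≤ w * Λ := by nlinarith
    have h0 : ⌊(w : ℝ) * Λ⌋₊ ≠ 0 := (Nat.floor_pos.2 h1).ne'
    rw [pairDist_dyadicPair hlt.le, inv_div, div_le_iff₀ (by positivity), Nat.lt_succ_iff,
      Nat.le_log_iff_pow_le (by norm_num) h0, Nat.le_floor_iff (by positivity), mul_comm Λ]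
    push_cast
    rfl
  constructor
  · rintro ⟨⟨h1, h2⟩, h3, h4, h5⟩
    have hlt : u + w < 2 ^ q := by omega
    exact ⟨h5, hlt, (key h1 hlt).1 h3⟩
  · rintro ⟨h1, h2, h3⟩
    have hw : 1 ≤ w ∧ w ≤ 4 := by unfold IsGood at h1; omega
    exact ⟨hw, (key hw.1 h2).2 h3, by omega, h1⟩

theorem injOn_dyadicPair_levelSet {Λ : ℝ} (hΛ : 1 ≤ Λ) :
    Set.InjOn (fun t : Σ (_ : ℕ) (_ : ℕ), ℕ => dyadicPair t.2.1 t.2.2 t.1) (levelSet Λ) := by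
  rintro ⟨w, q, u⟩ h ⟨w', q', u'⟩ h' he
  have h1 := (mem_levelSet hΛ _).1 (Finset.mem_coe.1 h)
  have h2 := (mem_levelSet hΛ _).1 (Finset.mem_coe.1 h')
  obtain ⟨rfl, rfl, rfl⟩ := eq_of_dyadicPair_eq h1.1 h2.1 h1.2.1 h2.2.1 he
  rfl

variable {J : Set (Sym2 unitInterval)} {p₀ : Sym2 unitInterval} (hJ : IsDyadicIndex J p₀)

include hJ

theorem IsDyadicIndex.finite {Λ : ℝ} (hΛ : 1 ≤ Λ) :
    {i : J | (pairDist i.1)⁻¹ ≤ Λ}.Finite := by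
  classical
  refine Set.Finite.of_finite_image (f := Subtype.val) ?_ Subtype.val_injective.injOn
  refine (Finset.finite_toSet (insert p₀ ((levelSet Λ).image
    fun t => dyadicPair t.2.1 t.2.2 t.1))).subset ?_
  rintro _ ⟨⟨p, hp⟩, hi, rfl⟩
  rw [Finset.mem_coe, Finset.mem_insert]
  rcases hJ.eq_or_eq p hp with ⟨q, u, w, h1, h2, rfl⟩ | h
  · exact Or.inr (Finset.mem_image.2 ⟨⟨w, q, u⟩, (mem_levelSet hΛ _).2 ⟨h1, h2, hi⟩, rfl⟩)
  · exact Or.inl h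

/-- Only the term of `p₀` can be lost in passing to dyadic parameters. A general `G` covers
counting, weights and powers of the length alike. -/
theorem IsDyadicIndex.norm_sum_sub_le {E : Type*} [NormedAddCommGroup E] {Λ : ℝ} (hΛ : 1 ≤ Λ)
    {F : Finset J} (hF : ∀ i, i ∈ F ↔ (pairDist i.1)⁻¹ ≤ Λ) (G : Sym2 unitInterval → E) :
    ‖∑ i ∈ F, G i.1 - ∑ t ∈ levelSet Λ, G (dyadicPair t.2.1 t.2.2 t.1)‖ ≤ ‖G p₀‖ := by
  classical
  set A := F.image Subtype.val with hA
  set B := (levelSet Λ).image fun t => dyadicPair t.2.1 t.2.2 t.1 with hB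
  have h1 : ∑ i ∈ F, G i.1 = ∑ p ∈ A, G p :=
    (Finset.sum_image Subtype.val_injective.injOn).symm
  have h2 : ∑ t ∈ levelSet Λ, G (dyadicPair t.2.1 t.2.2 t.1) = ∑ p ∈ B, G p :=
    (Finset.sum_image (injOn_dyadicPair_levelSet hΛ)).symm
  have hBA : B ⊆ A := by
    intro p hp
    obtain ⟨t, ht, rfl⟩ := Finset.mem_image.1 hp
    have h := (mem_levelSet hΛ t).1 ht
    exact Finset.mem_image.2 ⟨⟨_, hJ.dyadicPair_mem _ _ _ h.1 h.2.1⟩, (hF _).2 h.2.2, rfl⟩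
  have hAB : A \ B ⊆ {p₀} := by
    intro p hp
    obtain ⟨hpA, hpB⟩ := Finset.mem_sdiff.1 hp
    obtain ⟨i, hi, rfl⟩ := Finset.mem_image.1 hpA
    have hi' := (hF _).1 hi
    rcases hJ.eq_or_eq i.1 i.2 with ⟨q, u, w, h1, h2, h3⟩ | h
    · rw [h3] at hi' hpB
      have hm : (⟨w, q, u⟩ : Σ (_ : ℕ) (_ : ℕ), ℕ) ∈ levelSet Λ :=
        (mem_levelSet hΛ _).2 ⟨h1, h2, hi'⟩
      exact absurd (Finset.mem_image_of_mem
        (fun t : Σ (_ : ℕ) (_ : ℕ), ℕ => dyadicPair t.2.1 t.2.2 t.1) hm) hpB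
    · exact Finset.mem_singleton.2 h
  rw [h1, h2, ← Finset.sum_sdiff hBA, add_sub_cancel_right]
  rcases Finset.subset_singleton_iff.1 hAB with h | h
  · rw [h]; simp
  · rw [h]; simp

omit hJ in
theorem sum_levelSet {E : Type*} [AddCommMonoid E] (Λ : ℝ) (G : ℕ → ℕ → ℕ → E) :
    ∑ t ∈ levelSet Λ, G t.1 t.2.1 t.2.2 = ∑ w ∈ Finset.Icc (1 : ℕ) 4,
      ∑ q ∈ Finset.range (Nat.log 2 ⌊(w : ℝ) * Λ⌋₊ + 1),
        ∑ u ∈ (Finset.range (2 ^ q - w)).filter (IsGood w), G w q u := by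
  rw [levelSet, Finset.sum_sigma]
  refine Finset.sum_congr rfl fun w _ => ?_
  rw [Finset.sum_sigma]

end Sums

/-! ### Riemann sums -/

section Riemann

open MeasureTheory

theorem integral_unitInterval_eq (f : C(unitInterval, ℂ)) :
    ∫ x : unitInterval, f x = ∫ t in (0 : ℝ)..1, f (Set.projIcc 0 1 zero_le_one t) := by
  rw [intervalIntegral.integral_of_le zero_le_one, ← integral_Icc_eq_integral_Ioc,
    ← integral_subtype_comap measurableSet_Icc
      (fun t : ℝ => f (Set.projIcc 0 1 zero_le_one t))]
  refine integral_congr_ae (Eventually.of_forall fun t => ?_)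
  simp only [Set.projIcc_val]

/-- The sample points may lie outside their subintervals. Any point of a subinterval is within
`(C+1)/M n` of its sample point, and uniform continuity does the rest. -/
theorem tendsto_riemann_sum (f : C(unitInterval, ℂ)) {M : ℕ → ℕ} (hM : Tendsto M atTop atTop)
    {C : ℝ} (x : ℕ → ℕ → unitInterval)
    (hx : ∀ n k, k < M n → |(x n k : ℝ) - k / M n| ≤ C / M n) :
    Tendsto (fun n => ((M n : ℂ))⁻¹ * ∑ k ∈ Finset.range (M n), f (x n k)) atTop
      (𝓝 (∫ t : unitInterval, f t)) := by
  have hMr : Tendsto (fun n => (M n : ℝ)) atTop atTop := tendsto_natCast_atTop_atTop.comp hM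
  set F : ℝ → ℂ := fun t => f (Set.projIcc 0 1 zero_le_one t) with hF
  have hFc : Continuous F := f.continuous.comp continuous_projIcc
  rw [integral_unitInterval_eq, Metric.tendsto_nhds]
  intro ε hε
  obtain ⟨δ, hδ, hunif⟩ := Metric.uniformContinuous_iff.1
    (CompactSpace.uniformContinuous_of_continuous f.continuous) (ε / 2) (by positivity)
  have hsmall : ∀ᶠ n in atTop, (C + 1) / M n < δ :=
    (hMr.const_div_atTop (C + 1)).eventually (gt_mem_nhds hδ)
  filter_upwards [hsmall, hM.eventually (eventually_ge_atTop 1)] with n hn hn1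
  have hm : (0 : ℝ) < M n := by exact_mod_cast hn1
  have hsplit : ∫ t in (0 : ℝ)..1, F t
      = ∑ k ∈ Finset.range (M n), ∫ t in ((k : ℝ) / M n)..((k + 1 : ℕ) : ℝ) / M n, F t := by
    rw [intervalIntegral.sum_integral_adjacent_intervals (a := fun k : ℕ => (k : ℝ) / M n)
      fun k _ => hFc.intervalIntegrable _ _]
    simp [hm.ne']
  have hterm : ∀ k ∈ Finset.range (M n),
      ‖((M n : ℂ))⁻¹ * f (x n k) - ∫ t in ((k : ℝ) / M n)..((k + 1 : ℕ) : ℝ) / M n, F t‖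
        ≤ ε / 2 * (1 / M n) := by
    intro k hk
    have hk' := Finset.mem_range.1 hk
    have hkM : (k : ℝ) + 1 ≤ M n := by exact_mod_cast hk'
    have hlen : ((k + 1 : ℕ) : ℝ) / M n - (k : ℝ) / M n = 1 / M n := by
      rw [← sub_div]; push_cast; ring
    have hle : (k : ℝ) / M n ≤ ((k + 1 : ℕ) : ℝ) / M n := by
      rw [← sub_nonneg, hlen]; positivity
    have hconst : ((M n : ℂ))⁻¹ * f (x n k)
        = ∫ t in ((k : ℝ) / M n)..((k + 1 : ℕ) : ℝ) / M n, f (x n k) := by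
      rw [intervalIntegral.integral_const, hlen, Complex.real_smul]
      push_cast; rw [one_div]
    rw [hconst, ← intervalIntegral.integral_sub (by simp) (hFc.intervalIntegrable _ _)]
    refine (intervalIntegral.norm_integral_le_of_norm_le_const (C := ε / 2) ?_).trans ?_
    · intro t ht
      rw [Set.uIoc_of_le hle] at ht
      have ht0 : 0 ≤ t := (by positivity : (0 : ℝ) ≤ (k : ℝ) / M n).trans ht.1.le
      have ht1 : t ≤ 1 := ht.2.trans ((div_le_one hm).2 (by push_cast; exact hkM))
      rw [← dist_eq_norm]
      refine (hunif ?_).le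
      rw [Subtype.dist_eq, Real.dist_eq, Set.projIcc_of_mem _ ⟨ht0, ht1⟩]
      refine lt_of_le_of_lt ?_ hn
      have h1 := abs_le.1 (hx n k hk')
      have h2 : t ≤ (k : ℝ) / M n + 1 / M n := by linarith [ht.2]
      have h3 := ht.1
      rw [add_div, abs_le]
      have h4 : (0 : ℝ) ≤ 1 / M n := by positivity
      constructor <;> simp only <;> linarith [h1.1, h1.2]
    · rw [hlen, abs_of_nonneg (by positivity)]
  rw [dist_eq_norm, hsplit, Finset.mul_sum, ← Finset.sum_sub_distrib]
  refine (norm_sum_le_of_le _ hterm).trans_lt ?_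
  rw [Finset.sum_const, Finset.card_range, nsmul_eq_mul]
  have : (M n : ℝ) * (ε / 2 * (1 / M n)) = ε / 2 := by field_simp
  rw [this]
  linarith

end Riemann

/-! ### Asymptotics level by level -/

section Levels

theorem isGood_four_mul_add (w k r : ℕ) : IsGood w (4 * k + r) ↔ IsGood w r := by
  unfold IsGood
  omega

theorem sum_isGood_range_four_mul {E : Type*} [AddCommMonoid E] (w M : ℕ) (g : ℕ → E) :
    ∑ u ∈ (Finset.range (4 * M)).filter (IsGood w), g u
      = ∑ r ∈ (Finset.range 4).filter (IsGood w), ∑ k ∈ Finset.range M, g (4 * k + r) := by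
  rw [Finset.sum_comm, Finset.sum_filter]
  induction M with
  | zero => simp
  | succ M ih =>
    rw [Finset.sum_range_succ, ← ih, mul_add, mul_one, Finset.sum_range_add, Finset.sum_filter]
    simp only [isGood_four_mul_add]

theorem card_isGood_range_four {w : ℕ} (hw : w ∈ Finset.Icc 1 4) :
    ((Finset.range 4).filter (IsGood w)).card = 2 := by
  rw [Finset.mem_Icc] at hw
  obtain ⟨h1, h2⟩ := hw
  interval_cases w <;> decide

theorem card_isGood_range_sdiff_le (w n : ℕ) :
    ((Finset.range n).filter (IsGood w) \ (Finset.range (n - w)).filter (IsGood w)).card ≤ w := by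
  have : (Finset.range n).filter (IsGood w) \ (Finset.range (n - w)).filter (IsGood w)
      ⊆ Finset.Ico (n - w) n := by
    intro u hu
    simp only [Finset.mem_sdiff, Finset.mem_filter, Finset.mem_range, not_and] at hu
    rw [Finset.mem_Ico]
    refine ⟨?_, hu.1.1⟩
    by_contra! h
    exact hu.2 h hu.1.2
  refine (Finset.card_le_card this).trans ?_
  rw [Nat.card_Ico]; omega

theorem filter_isGood_range_sub_subset (w n : ℕ) :
    (Finset.range (n - w)).filter (IsGood w) ⊆ (Finset.range n).filter (IsGood w) :=
  Finset.filter_subset_filter _ (Finset.range_subset_range.2 (Nat.sub_le _ _))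

/-- The number of dyadic pairs with given parameters `w` and `q`. -/
def levelCount (w q : ℕ) : ℕ := ((Finset.range (2 ^ q - w)).filter (IsGood w)).card

/-- Half of the residues mod 4 are good, and the restriction `u < 2^q - w` drops at most `w ≤ 4`
pairs. For `q < 2` the range is not a union of full periods and is checked directly. -/
theorem levelCount_bounds {w : ℕ} (hw : w ∈ Finset.Icc 1 4) (q : ℕ) :
    (levelCount w q : ℝ) ≤ 2 ^ q / 2 ∧ (2 : ℝ) ^ q / 2 - 4 ≤ levelCount w q := by
  have hw' := Finset.mem_Icc.1 hw
  have hle : levelCount w q ≤ 2 ^ q - w :=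
    (Finset.card_filter_le _ _).trans (Finset.card_range _).le
  rcases Nat.lt_or_ge q 2 with hq | hq
  · have h0 : (0 : ℝ) ≤ levelCount w q := Nat.cast_nonneg _
    interval_cases q
    · have : levelCount w 0 = 0 := by simp at hle; omega
      rw [this]; norm_num
    · have : levelCount w 1 ≤ 1 := by simp at hle; omega
      have : (levelCount w 1 : ℝ) ≤ 1 := by exact_mod_cast this
      constructor <;> norm_num <;> linarith
  · obtain ⟨p, rfl⟩ := Nat.exists_eq_add_of_le' hq
    have h4 : 2 ^ (p + 2) = 4 * 2 ^ p := by rw [pow_add]; ring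
    have hfull : ((Finset.range (2 ^ (p + 2))).filter (IsGood w)).card = 2 * 2 ^ p := by
      rw [Finset.card_eq_sum_ones, h4, sum_isGood_range_four_mul]
      simp [card_isGood_range_four hw]
    have h1 : levelCount w (p + 2) ≤ 2 * 2 ^ p := by
      rw [← hfull]; exact Finset.card_le_card (filter_isGood_range_sub_subset _ _)
    have h2 : 2 * 2 ^ p ≤ levelCount w (p + 2) + 4 := by
      have := Finset.card_sdiff_add_card_eq_card (filter_isGood_range_sub_subset w (2 ^ (p + 2)))
      have h3 := card_isGood_range_sdiff_le w (2 ^ (p + 2))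
      rw [hfull] at this
      unfold levelCount
      omega
    have h1' : (levelCount w (p + 2) : ℝ) ≤ 2 * 2 ^ p := by exact_mod_cast h1
    have h2' : (2 * 2 ^ p : ℝ) ≤ levelCount w (p + 2) + 4 := by exact_mod_cast h2
    rw [pow_add]
    constructor <;> norm_num <;> linarith

theorem pow_log_floor_bounds {t : ℝ} (ht : 1 ≤ t) :
    (2 : ℝ) ^ Nat.log 2 ⌊t⌋₊ ≤ t ∧ t < 2 ^ (Nat.log 2 ⌊t⌋₊ + 1) := by
  have h0 : ⌊t⌋₊ ≠ 0 := (Nat.floor_pos.2 ht).ne'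
  constructor
  · refine le_trans ?_ (Nat.floor_le (by linarith : (0 : ℝ) ≤ t))
    exact_mod_cast Nat.pow_log_le_self 2 h0
  · refine (Nat.lt_floor_add_one t).trans_le ?_
    exact_mod_cast Nat.lt_pow_succ_log_self (by norm_num : 1 < 2) ⌊t⌋₊

theorem tendsto_log_floor_div_log {w : ℝ} (hw : 1 ≤ w) :
    Tendsto (fun Λ : ℝ => ((Nat.log 2 ⌊w * Λ⌋₊ + 1 : ℕ) : ℝ) / Real.log Λ) atTop
      (𝓝 (1 / Real.log 2)) := by
  have hl2 : 0 < Real.log 2 := Real.log_pos (by norm_num)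
  have hlow : Tendsto (fun Λ : ℝ => 1 / Real.log 2 + (Real.log w / Real.log 2) / Real.log Λ) atTop
      (𝓝 (1 / Real.log 2 + 0)) :=
    tendsto_const_nhds.add (Real.tendsto_log_atTop.const_div_atTop _)
  have hupp : Tendsto (fun Λ : ℝ => 1 / Real.log 2 + (Real.log w / Real.log 2 + 1) / Real.log Λ)
      atTop (𝓝 (1 / Real.log 2 + 0)) :=
    tendsto_const_nhds.add (Real.tendsto_log_atTop.const_div_atTop _)
  rw [add_zero] at hlow hupp
  have key : ∀ Λ : ℝ, 1 < Λ → Real.log w + Real.log Λ ≤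
      ((Nat.log 2 ⌊w * Λ⌋₊ + 1 : ℕ) : ℝ) * Real.log 2 ∧
      ((Nat.log 2 ⌊w * Λ⌋₊ + 1 : ℕ) : ℝ) * Real.log 2 ≤ Real.log w + Real.log Λ + Real.log 2 := by
    intro Λ hΛ
    have hpos : 0 < w * Λ := by positivity
    have hb := pow_log_floor_bounds (t := w * Λ) (by nlinarith)
    rw [← Real.log_mul (by positivity) (by positivity)]
    constructor
    · rw [← Real.log_pow]
      exact Real.log_le_log hpos hb.2.le
    · have h1 := Real.log_le_log (by positivity) hb.1
      rw [Real.log_pow] at h1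
      push_cast; linarith
  refine tendsto_of_tendsto_of_tendsto_of_le_of_le' hlow hupp ?_ ?_
  · filter_upwards [eventually_gt_atTop 1] with Λ hΛ
    have hlog := Real.log_pos hΛ
    have := (key Λ hΛ).1
    rw [le_div_iff₀ hlog, add_mul, div_mul_cancel₀ _ hlog.ne', one_div, inv_mul_eq_div, ← add_div,
      div_le_iff₀ hl2]
    linarith
  · filter_upwards [eventually_gt_atTop 1] with Λ hΛ
    have hlog := Real.log_pos hΛ
    have := (key Λ hΛ).2
    rw [div_le_iff₀ hlog, add_mul, div_mul_cancel₀ _ hlog.ne', one_div, inv_mul_eq_div,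
      ← add_assoc, ← add_div, ← sub_le_iff_le_add, le_div_iff₀ hl2]
    linarith

/-- The weight `d(x,y) (f(x) + f(y))` of a pair of points. -/
def pairWeight (f : C(unitInterval, ℂ)) (p : Sym2 unitInterval) : ℂ :=
  Sym2.lift ⟨fun x y => ((dist x y : ℝ) : ℂ) * (f x + f y), fun x y => by
    simp only [dist_comm x y, add_comm (f x)]⟩ p

theorem pairWeight_eq_out (f : C(unitInterval, ℂ)) (p : Sym2 unitInterval) :
    pairWeight f p = ((dist (Quot.out p).1 (Quot.out p).2 : ℝ) : ℂ)
      * (f (Quot.out p).1 + f (Quot.out p).2) := by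
  conv_lhs => rw [← Quot.out_eq p]
  rfl

theorem pairWeight_dyadicPair (f : C(unitInterval, ℂ)) {q u w : ℕ} (h : u + w ≤ 2 ^ q) :
    pairWeight f (dyadicPair q u w)
      = (w : ℂ) / 2 ^ q * (f (dyadic q u) + f (dyadic q (u + w))) := by
  change ((dist (dyadic q u) (dyadic q (u + w)) : ℝ) : ℂ) * _ = _
  rw [dist_dyadic h]
  push_cast
  rfl

/-- The range of `s` accommodates both ends `r` and `r + w` with `r < 4` and `w ≤ 4`. The clipping
in `dyadic` can only bring the point closer. -/
theorem abs_dyadic_sub_le {p k s : ℕ} (hk : k < 2 ^ p) (hs : s ≤ 8) :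
    |((dyadic (p + 2) (4 * k + s) : unitInterval) : ℝ) - (k : ℝ) / (2 ^ p : ℕ)|
      ≤ 2 / (2 ^ p : ℕ) := by
  have hP : (0 : ℝ) < 2 ^ p := by positivity
  have hk' : (k : ℝ) + 1 ≤ 2 ^ p := by exact_mod_cast hk
  have hs' : (s : ℝ) ≤ 8 := by exact_mod_cast hs
  have hs0 : (0 : ℝ) ≤ s := Nat.cast_nonneg s
  have hv : (((4 * k + s : ℕ) : ℝ) / 2 ^ (p + 2)) = (k + s / 4) / 2 ^ p := by
    rw [pow_add]; push_cast; field_simp; ring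
  have hk0 : (k : ℝ) / 2 ^ p ≤ 1 := (div_le_one hP).2 (by linarith)
  have h1 : (k : ℝ) / 2 ^ p ≤ (k + s / 4) / 2 ^ p := by gcongr; linarith
  have h2 : ((k : ℝ) + s / 4) / 2 ^ p ≤ (k : ℝ) / 2 ^ p + 2 / 2 ^ p := by
    rw [← add_div]; gcongr; linarith
  have h3 : (0 : ℝ) ≤ 2 / 2 ^ p := by positivity
  have h4 : (0 : ℝ) ≤ (k : ℝ) / 2 ^ p := by positivity
  rw [dyadic, Set.coe_projIcc, hv]
  push_cast
  rw [abs_le, max_eq_right (le_min zero_le_one (h4.trans h1))]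
  constructor
  · have : (k : ℝ) / 2 ^ p ≤ min 1 (((k : ℝ) + s / 4) / 2 ^ p) := le_min hk0 h1
    linarith
  · have := min_le_right 1 (((k : ℝ) + s / 4) / 2 ^ p)
    linarith

/-- The sum of the weights of the pairs with parameters `w` and `q`. -/
def levelSum (f : C(unitInterval, ℂ)) (w q : ℕ) : ℂ :=
  ∑ u ∈ (Finset.range (2 ^ q - w)).filter (IsGood w), pairWeight f (dyadicPair q u w)

/-- With `u = 4k + r` and `q = p + 2`, each end of the pairs with a given good `r` yields a Riemann
sum with `2^p` nodes and factor `w/4`. Two residues and two ends give `w ∫ f`. The at most four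
pairs reaching up to 1 or beyond have weights `O(2^(-q))`. -/
theorem tendsto_levelSum (f : C(unitInterval, ℂ)) {w : ℕ} (hw : w ∈ Finset.Icc 1 4) :
    Tendsto (levelSum f w) atTop (𝓝 ((w : ℂ) * ∫ x : unitInterval, f x)) := by
  have hw' := Finset.mem_Icc.1 hw
  set I := ∫ x : unitInterval, f x
  let g : ℕ → ℕ → ℂ := fun q u =>
    (w : ℂ) / 2 ^ q * (f (dyadic q u) + f (dyadic q (u + w)))
  have hMtop : Tendsto (fun p : ℕ => 2 ^ p) atTop atTop :=
    tendsto_pow_atTop_atTop_of_one_lt (by norm_num)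
  have hR : ∀ s ≤ 8, Tendsto (fun p : ℕ => (((2 ^ p : ℕ) : ℂ))⁻¹ *
      ∑ k ∈ Finset.range (2 ^ p), f (dyadic (p + 2) (4 * k + s))) atTop (𝓝 I) := fun s hs =>
    tendsto_riemann_sum f hMtop (fun p k => dyadic (p + 2) (4 * k + s))
      (fun p k hk => abs_dyadic_sub_le hk hs)
  have hfull : Tendsto (fun p : ℕ => ∑ u ∈ (Finset.range (2 ^ (p + 2))).filter (IsGood w),
      g (p + 2) u) atTop (𝓝 ((w : ℂ) * I)) := by
    have h1 : Tendsto (fun p : ℕ => ∑ r ∈ (Finset.range 4).filter (IsGood w), (w : ℂ) / 4 *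
        ((((2 ^ p : ℕ) : ℂ))⁻¹ * ∑ k ∈ Finset.range (2 ^ p), f (dyadic (p + 2) (4 * k + r))
          + (((2 ^ p : ℕ) : ℂ))⁻¹ *
            ∑ k ∈ Finset.range (2 ^ p), f (dyadic (p + 2) (4 * k + (r + w))))) atTop
        (𝓝 (∑ r ∈ (Finset.range 4).filter (IsGood w), (w : ℂ) / 4 * (I + I))) := by
      refine tendsto_finsetSum _ fun r hr => ?_
      have hr' : r < 4 := Finset.mem_range.1 (Finset.mem_filter.1 hr).1
      exact ((hR r (by omega)).add (hR (r + w) (by omega))).const_mul _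
    rw [Finset.sum_const, card_isGood_range_four hw] at h1
    have h2 : (2 : ℕ) • ((w : ℂ) / 4 * (I + I)) = w * I := by
      rw [nsmul_eq_mul]; push_cast; ring
    rw [h2] at h1
    refine h1.congr fun p => ?_
    have h4 : 2 ^ (p + 2) = 4 * 2 ^ p := by rw [pow_add]; ring
    rw [h4, sum_isGood_range_four_mul]
    refine Finset.sum_congr rfl fun r _ => ?_
    rw [← mul_add, ← Finset.sum_add_distrib, Finset.mul_sum, Finset.mul_sum]
    refine Finset.sum_congr rfl fun k _ => ?_
    simp only [g]
    rw [pow_add, add_assoc]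
    push_cast
    field_simp
    ring
  have hdiff : Tendsto (fun p : ℕ => ∑ u ∈ (Finset.range (2 ^ (p + 2))).filter (IsGood w),
      g (p + 2) u - levelSum f w (p + 2)) atTop (𝓝 0) := by
    have hb : Tendsto (fun p : ℕ => 4 * (4 * (2 * ‖f‖)) / ((2 ^ (p + 2) : ℕ) : ℝ)) atTop (𝓝 0) :=
      ((tendsto_natCast_atTop_atTop.comp hMtop).comp
        (tendsto_add_atTop_nat 2)).const_div_atTop _
    refine squeeze_zero_norm (fun p => ?_) hb
    have hls : levelSum f w (p + 2)
        = ∑ u ∈ (Finset.range (2 ^ (p + 2) - w)).filter (IsGood w), g (p + 2) u := by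
      refine Finset.sum_congr rfl fun u hu => ?_
      have := Finset.mem_range.1 (Finset.mem_filter.1 hu).1
      exact pairWeight_dyadicPair f (by omega)
    rw [hls, ← Finset.sum_sdiff (filter_isGood_range_sub_subset w (2 ^ (p + 2))),
      add_sub_cancel_right]
    have hg : ∀ u, ‖g (p + 2) u‖ ≤ 4 / ((2 ^ (p + 2) : ℕ) : ℝ) * (2 * ‖f‖) := by
      intro u
      simp only [g]
      rw [norm_mul, norm_div, norm_pow, Complex.norm_natCast, Complex.norm_ofNat]
      push_cast
      have hw4 : (w : ℝ) ≤ 4 := by exact_mod_cast hw'.2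
      gcongr
      refine (norm_add_le _ _).trans ?_
      linarith [f.norm_coe_le_norm (dyadic (p + 2) u), f.norm_coe_le_norm (dyadic (p + 2) (u + w))]
    refine (norm_sum_le_of_le _ fun u _ => hg u).trans ?_
    rw [Finset.sum_const, nsmul_eq_mul]
    have hc : (((Finset.range (2 ^ (p + 2))).filter (IsGood w) \
        (Finset.range (2 ^ (p + 2) - w)).filter (IsGood w)).card : ℝ) ≤ 4 := by
      exact_mod_cast (card_isGood_range_sdiff_le w (2 ^ (p + 2))).trans hw'.2
    refine (mul_le_mul_of_nonneg_right hc (by positivity)).trans (le_of_eq (by ring))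
  have := hfull.sub hdiff
  rw [sub_zero] at this
  refine (tendsto_add_atTop_iff_nat 2).1 (this.congr fun p => ?_)
  ring

/-- The Cesàro mean of the level sums has the limit of `levelSum`, and the number of levels is
asymptotic to `log Λ / log 2`. -/
theorem tendsto_sum_levelSum (f : C(unitInterval, ℂ)) {w : ℕ} (hw : w ∈ Finset.Icc 1 4) :
    Tendsto (fun Λ : ℝ => ((1 / Real.log Λ : ℝ) : ℂ) *
      ∑ q ∈ Finset.range (Nat.log 2 ⌊(w : ℝ) * Λ⌋₊ + 1), levelSum f w q) atTop
      (𝓝 (((1 / Real.log 2 : ℝ) : ℂ) * ((w : ℂ) * ∫ x : unitInterval, f x))) := by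
  have hw' : (1 : ℝ) ≤ w := by exact_mod_cast (Finset.mem_Icc.1 hw).1
  have h1 := (tendsto_levelSum f hw).cesaro_smul
  have hn : Tendsto (fun Λ : ℝ => Nat.log 2 ⌊(w : ℝ) * Λ⌋₊ + 1) atTop atTop := by
    have hr := (tendsto_log_floor_div_log hw').pos_mul_atTop
      (by have := Real.log_pos (show (1 : ℝ) < 2 by norm_num); positivity) Real.tendsto_log_atTop
    refine tendsto_natCast_atTop_iff (R := ℝ) |>.1 (hr.congr' ?_)
    filter_upwards [eventually_gt_atTop 1] with Λ hΛ
    rw [div_mul_cancel₀ _ (Real.log_pos hΛ).ne']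
  have h2 := (Complex.continuous_ofReal.tendsto _).comp (tendsto_log_floor_div_log hw')
  have h3 := h2.mul (h1.comp hn)
  refine h3.congr' ?_
  filter_upwards with Λ
  simp only [Function.comp_apply]
  rw [Complex.real_smul, ← mul_assoc]
  congr 1
  have : ((Nat.log 2 ⌊(w : ℝ) * Λ⌋₊ + 1 : ℕ) : ℂ) ≠ 0 := Nat.cast_ne_zero.2 (Nat.succ_ne_zero _)
  push_cast at this ⊢
  rw [div_mul_eq_mul_div, mul_inv_cancel₀ this]

variable {J : Set (Sym2 unitInterval)} {p₀ : Sym2 unitInterval} (hJ : IsDyadicIndex J p₀)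

include hJ

/-- Logarithmic asymptotics of the weighted sums over the pairs with distance at least `1 / Λ`. -/
theorem IsDyadicIndex.tendsto_sum_pairWeight (f : C(unitInterval, ℂ)) {F : ℝ → Finset J}
    (hF : ∀ Λ, 1 ≤ Λ → ∀ i, i ∈ F Λ ↔ (pairDist i.1)⁻¹ ≤ Λ) :
    Tendsto (fun Λ : ℝ => ((1 / Real.log Λ : ℝ) : ℂ) * ∑ i ∈ F Λ, pairWeight f i.1) atTop
      (𝓝 (((10 / Real.log 2 : ℝ) : ℂ) * ∫ x : unitInterval, f x)) := by
  have h1 : Tendsto (fun Λ : ℝ => ((1 / Real.log Λ : ℝ) : ℂ) *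
      ∑ t ∈ levelSet Λ, pairWeight f (dyadicPair t.2.1 t.2.2 t.1)) atTop
      (𝓝 (((10 / Real.log 2 : ℝ) : ℂ) * ∫ x : unitInterval, f x)) := by
    have h := tendsto_finsetSum (Finset.Icc 1 4) fun w hw => tendsto_sum_levelSum f hw
    have e : ∑ w ∈ Finset.Icc (1 : ℕ) 4, ((1 / Real.log 2 : ℝ) : ℂ) *
        ((w : ℂ) * ∫ x : unitInterval, f x)
        = ((10 / Real.log 2 : ℝ) : ℂ) * ∫ x : unitInterval, f x := by
      rw [← Finset.mul_sum, ← Finset.sum_mul]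
      have : ∑ w ∈ Finset.Icc (1 : ℕ) 4, (w : ℂ) = 10 := by
        rw [← Nat.cast_sum, show ∑ w ∈ Finset.Icc (1 : ℕ) 4, w = 10 from by decide]; norm_num
      rw [this]; push_cast; ring
    rw [e] at h
    refine h.congr fun Λ => ?_
    rw [sum_levelSet Λ fun w q u => pairWeight f (dyadicPair q u w), Finset.mul_sum]
    rfl
  have h2 : Tendsto (fun Λ : ℝ => ((1 / Real.log Λ : ℝ) : ℂ) * ∑ i ∈ F Λ, pairWeight f i.1
      - ((1 / Real.log Λ : ℝ) : ℂ) *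
        ∑ t ∈ levelSet Λ, pairWeight f (dyadicPair t.2.1 t.2.2 t.1)) atTop (𝓝 0) := by
    refine squeeze_zero_norm' ?_
      (Real.tendsto_log_atTop.const_div_atTop ‖pairWeight f p₀‖)
    filter_upwards [eventually_ge_atTop 1] with Λ hΛ
    rw [← mul_sub, norm_mul, Complex.norm_real, Real.norm_of_nonneg (by
      have := Real.log_nonneg hΛ; positivity), one_div_mul_eq_div]
    exact div_le_div_of_nonneg_right (hJ.norm_sum_sub_le hΛ (hF Λ hΛ) (pairWeight f))
      (Real.log_nonneg hΛ)
  have := h1.add h2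
  rw [add_zero] at this
  refine this.congr fun Λ => ?_
  ring

end Levels

/-! ### Counting the pairs of length at least `1/Λ` -/

section Counting

theorem log_floor_eq {t : ℝ} {j : ℕ} (h1 : (2 : ℝ) ^ j ≤ t) (h2 : t < 2 ^ (j + 1)) :
    Nat.log 2 ⌊t⌋₊ = j := by
  refine Nat.log_eq_of_pow_le_of_lt_pow ?_ ?_
  · exact Nat.le_floor (by exact_mod_cast h1)
  · have : (0 : ℝ) ≤ t := (by positivity : (0 : ℝ) ≤ 2 ^ j).trans h1
    exact (Nat.floor_lt this).2 (by exact_mod_cast h2)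

theorem sum_range_two_pow (n : ℕ) : ∑ q ∈ Finset.range n, (2 : ℝ) ^ q = 2 ^ n - 1 := by
  have := geom_sum_mul (2 : ℝ) n
  linarith

variable {J : Set (Sym2 unitInterval)} {p₀ : Sym2 unitInterval} (hJ : IsDyadicIndex J p₀)

include hJ

/-- Twice the number of pairs with parameter `w` and `q ≤ Q` is `2^(Q+1)` up to an error of at most
8 per level. The last levels for `w = 1, 2, 4` are `j`, `j+1`, `j+2`, while that for `w = 3` jumps
from `j+1` to `j+2` at `3Λ = 4·2^j`. So `c` is `2 + 4 + 8` plus 4 or 8. The summand 2 in the upper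
bound pays for `p₀`. -/
theorem IsDyadicIndex.card_bounds {Λ : ℝ} {j : ℕ} (h1 : (2 : ℝ) ^ j ≤ Λ) (h2 : Λ < 2 ^ (j + 1))
    {F : Finset J} (hF : ∀ i, i ∈ F ↔ (pairDist i.1)⁻¹ ≤ Λ) :
    ∃ c : ℝ, (c = 18 ∧ 3 * Λ < 4 * 2 ^ j ∨ c = 22 ∧ 4 * 2 ^ j ≤ 3 * Λ) ∧
      (2 * F.card : ℝ) ≤ c * 2 ^ j + 2 ∧ c * 2 ^ j - (32 * (j + 1) + 70) ≤ 2 * F.card := by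
  have hP : (1 : ℝ) ≤ 2 ^ j := one_le_pow₀ (by norm_num)
  have hΛ : 1 ≤ Λ := hP.trans h1
  rw [pow_succ] at h2
  have hsum := hJ.norm_sum_sub_le hΛ hF (fun _ => (1 : ℝ))
  rw [sum_levelSet Λ fun _ _ _ => (1 : ℝ)] at hsum
  simp only [Finset.sum_const, nsmul_eq_mul, mul_one, norm_one] at hsum
  have hlev : ∀ w ∈ Finset.Icc (1 : ℕ) 4, ∀ n : ℕ,
      2 * ∑ q ∈ Finset.range n, (levelCount w q : ℝ) ≤ 2 ^ n - 1 ∧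
      (2 : ℝ) ^ n - 1 - 8 * n ≤ 2 * ∑ q ∈ Finset.range n, (levelCount w q : ℝ) := by
    intro w hw n
    rw [← sum_range_two_pow, Finset.mul_sum]
    constructor
    · exact Finset.sum_le_sum fun q _ => by linarith [(levelCount_bounds hw q).1]
    · have : ∑ q ∈ Finset.range n, ((2 : ℝ) ^ q - 8) ≤
          ∑ q ∈ Finset.range n, 2 * (levelCount w q : ℝ) :=
        Finset.sum_le_sum fun q _ => by linarith [(levelCount_bounds hw q).2]
      rw [Finset.sum_sub_distrib, Finset.sum_const, Finset.card_range, nsmul_eq_mul] at this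
      linarith
  have hIcc : Finset.Icc 1 4 = ({1, 2, 3, 4} : Finset ℕ) := by decide
  have hexp : ∀ g : ℕ → ℝ, ∑ w ∈ Finset.Icc 1 4, g w = g 1 + g 2 + g 3 + g 4 := by
    intro g
    rw [hIcc]
    simp [add_assoc]
  rw [hexp] at hsum
  have q1 : Nat.log 2 ⌊((1 : ℕ) : ℝ) * Λ⌋₊ = j := log_floor_eq (by push_cast; linarith)
    (by push_cast; rw [pow_succ]; linarith)
  have q2 : Nat.log 2 ⌊((2 : ℕ) : ℝ) * Λ⌋₊ = j + 1 := log_floor_eq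
    (by push_cast; rw [pow_succ]; linarith) (by push_cast; rw [pow_succ, pow_succ]; linarith)
  have q4 : Nat.log 2 ⌊((4 : ℕ) : ℝ) * Λ⌋₊ = j + 2 := log_floor_eq
    (by push_cast; rw [pow_succ, pow_succ]; linarith)
    (by push_cast; rw [pow_succ, pow_succ, pow_succ]; linarith)
  rw [q1, q2, q4] at hsum
  have b1 := hlev 1 (by decide) (j + 1)
  have b2 := hlev 2 (by decide) (j + 1 + 1)
  have b4 := hlev 4 (by decide) (j + 2 + 1)
  have hs := abs_le.1 hsum
  change _ ≤ (F.card : ℝ) - (∑ q ∈ Finset.range (j + 1), (levelCount 1 q : ℝ)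
    + ∑ q ∈ Finset.range (j + 1 + 1), (levelCount 2 q : ℝ)
    + ∑ q ∈ Finset.range (Nat.log 2 ⌊((3 : ℕ) : ℝ) * Λ⌋₊ + 1), (levelCount 3 q : ℝ)
    + ∑ q ∈ Finset.range (j + 2 + 1), (levelCount 4 q : ℝ)) ∧ (F.card : ℝ) -
    (∑ q ∈ Finset.range (j + 1), (levelCount 1 q : ℝ)
    + ∑ q ∈ Finset.range (j + 1 + 1), (levelCount 2 q : ℝ)
    + ∑ q ∈ Finset.range (Nat.log 2 ⌊((3 : ℕ) : ℝ) * Λ⌋₊ + 1), (levelCount 3 q : ℝ)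
    + ∑ q ∈ Finset.range (j + 2 + 1), (levelCount 4 q : ℝ)) ≤ _ at hs
  rcases lt_or_ge (3 * Λ) (4 * 2 ^ j) with h3 | h3
  · refine ⟨18, Or.inl ⟨rfl, h3⟩, ?_⟩
    have q3 : Nat.log 2 ⌊((3 : ℕ) : ℝ) * Λ⌋₊ = j + 1 := log_floor_eq
      (by push_cast; rw [pow_succ]; linarith) (by push_cast; rw [pow_succ, pow_succ]; linarith)
    rw [q3] at hs
    have b3 := hlev 3 (by decide) (j + 1 + 1)
    simp only [pow_succ] at b1 b2 b3 b4
    push_cast at b1 b2 b3 b4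
    constructor <;> linarith [hs.1, hs.2, b1.1, b1.2, b2.1, b2.2, b3.1, b3.2, b4.1, b4.2]
  · refine ⟨22, Or.inr ⟨rfl, h3⟩, ?_⟩
    have q3 : Nat.log 2 ⌊((3 : ℕ) : ℝ) * Λ⌋₊ = j + 2 := log_floor_eq
      (by push_cast; rw [pow_succ, pow_succ]; linarith)
      (by push_cast; rw [pow_succ, pow_succ, pow_succ]; linarith)
    rw [q3] at hs
    have b3 := hlev 3 (by decide) (j + 2 + 1)
    simp only [pow_succ] at b1 b2 b3 b4
    push_cast at b1 b2 b3 b4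
    constructor <;> linarith [hs.1, hs.2, b1.1, b1.2, b2.1, b2.2, b3.1, b3.2, b4.1, b4.2]

omit hJ in
theorem eventually_log_error_le :
    ∀ᶠ Λ : ℝ in atTop, 32 * ((Nat.log 2 ⌊Λ⌋₊ : ℝ) + 1) + 70 ≤ Λ / 2 := by
  have h1 := tendsto_log_floor_div_log (w := 1) le_rfl
  have h2 : Tendsto (fun Λ : ℝ => Real.log Λ / Λ) atTop (𝓝 0) :=
    Real.isLittleO_log_id_atTop.tendsto_div_nhds_zero
  have h3 : Tendsto (fun Λ : ℝ => 32 * ((((Nat.log 2 ⌊1 * Λ⌋₊ + 1 : ℕ) : ℝ) / Real.log Λ)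
      * (Real.log Λ / Λ)) + 70 / Λ) atTop (𝓝 (32 * (1 / Real.log 2 * 0) + 0)) :=
    ((h1.mul h2).const_mul 32).add (tendsto_id.const_div_atTop 70)
  rw [mul_zero, mul_zero, add_zero] at h3
  filter_upwards [h3.eventually (ge_mem_nhds (show (0 : ℝ) < 1 / 2 by norm_num)),
    eventually_gt_atTop 1] with Λ h4 h5
  have hlog := (Real.log_pos h5).ne'
  have hΛ : 0 < Λ := by linarith
  have h6 : 32 * ((((Nat.log 2 ⌊1 * Λ⌋₊ + 1 : ℕ) : ℝ) / Real.log Λ) * (Real.log Λ / Λ)) + 70 / Λ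
      = (32 * ((Nat.log 2 ⌊Λ⌋₊ : ℝ) + 1) + 70) / Λ := by
    rw [one_mul, div_mul_div_cancel₀ hlog]
    push_cast
    ring
  rw [h6, div_le_iff₀ hΛ] at h4
  linarith

/-- As `Λ/2^j` runs through `[1, 2)`, the main term `c 2^j/Λ` falls from 18 to 13.5, jumps to 16.5
at `4/3` and falls to 11. An error of at most `Λ/2` turns 11 into `21/2` and keeps the value at `Λ =
2^j` above 17. -/
theorem IsDyadicIndex.card_asymptotics {F : ℝ → Finset J}
    (hF : ∀ Λ, 1 ≤ Λ → ∀ i, i ∈ F Λ ↔ (pairDist i.1)⁻¹ ≤ Λ) :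
    (∀ᶠ Λ in atTop, 21 / 2 ≤ (2 * (F Λ).card : ℝ) / Λ) ∧
    (∃ᶠ Λ in atTop, (2 * (F Λ).card : ℝ) / Λ ≤ 13) ∧
    (∃ᶠ Λ in atTop, 17 ≤ (2 * (F Λ).card : ℝ) / Λ) ∧
    (∀ᶠ Λ in atTop, (2 * (F Λ).card : ℝ) / Λ ≤ 19) := by
  have hpow : ∀ a : ℝ, ∃ j : ℕ, a ≤ 2 ^ j := fun a => by
    obtain ⟨j, hj⟩ := pow_unbounded_of_one_lt a (show (1 : ℝ) < 2 by norm_num)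
    exact ⟨j, hj.le⟩
  have hup : ∀ᶠ Λ in atTop, (2 * (F Λ).card : ℝ) / Λ ≤ 19 := by
    filter_upwards [eventually_ge_atTop 2] with Λ hΛ
    have hb := pow_log_floor_bounds (t := Λ) (by linarith)
    obtain ⟨c, hc, h1, -⟩ := hJ.card_bounds hb.1 hb.2 (hF Λ (by linarith))
    rw [div_le_iff₀ (by linarith)]
    rcases hc with ⟨rfl, h⟩ | ⟨rfl, h⟩ <;> linarith [hb.1]
  have hlo : ∀ᶠ Λ in atTop, 21 / 2 ≤ (2 * (F Λ).card : ℝ) / Λ ∧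
      ((2 : ℝ) ^ Nat.log 2 ⌊Λ⌋₊ = Λ → 17 ≤ (2 * (F Λ).card : ℝ) / Λ) := by
    filter_upwards [eventually_ge_atTop 2, eventually_log_error_le] with Λ hΛ hE
    have hb := pow_log_floor_bounds (t := Λ) (by linarith)
    obtain ⟨c, hc, -, h1⟩ := hJ.card_bounds hb.1 hb.2 (hF Λ (by linarith))
    have hb2 := hb.2
    rw [pow_succ] at hb2
    rw [le_div_iff₀ (by linarith), le_div_iff₀ (by linarith)]
    refine ⟨?_, fun he => ?_⟩
    · rcases hc with ⟨rfl, h⟩ | ⟨rfl, h⟩ <;> linarith [hb.1]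
    · rcases hc with ⟨rfl, h⟩ | ⟨rfl, h⟩ <;> linarith [hb.1]
  refine ⟨hlo.mono fun _ h => h.1, ?_, ?_, hup⟩
  · rw [frequently_atTop]
    intro a
    obtain ⟨j, hj⟩ := hpow (max a 2)
    have hj1 := (le_max_left _ _).trans hj
    have hj2 := (le_max_right _ _).trans hj
    -- Near the right end of the dyadic interval, with `c = 22`, the ratio is about `22 · 8/15 <
    -- 12`.
    refine ⟨15 / 8 * 2 ^ j, by linarith, ?_⟩
    obtain ⟨c, hc, h1, -⟩ := hJ.card_bounds (Λ := 15 / 8 * 2 ^ j) (j := j) (by linarith)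
      (by rw [pow_succ]; linarith) (hF _ (by linarith))
    rw [div_le_iff₀ (by positivity)]
    rcases hc with ⟨rfl, h⟩ | ⟨rfl, h⟩ <;> linarith
  · have hfr : ∃ᶠ Λ : ℝ in atTop, (2 : ℝ) ^ Nat.log 2 ⌊Λ⌋₊ = Λ := by
      rw [frequently_atTop]
      intro a
      obtain ⟨j, hj⟩ := hpow a
      refine ⟨2 ^ j, hj, ?_⟩
      rw [log_floor_eq le_rfl (by rw [pow_succ]; linarith [show (0 : ℝ) < 2 ^ j by positivity])]
    exact (hfr.and_eventually hlo).mono fun Λ h => h.2.2 h.1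

end Counting

/-! ### Density of the Lipschitz functions -/

section Density

open ContinuousMap in
-- Stone–Weierstrass: the Lipschitz functions form a star subalgebra, and the coordinate function
-- separates points.
theorem dense_lipschitz : Dense {f : C(unitInterval, ℂ) | ∃ K, LipschitzWith K f} := by
  let A : StarSubalgebra ℂ C(unitInterval, ℂ) :=
    { carrier := {f | ∃ K, LipschitzWith K f}
      mul_mem' := by
        rintro f g ⟨K, hK⟩ ⟨K', hK'⟩
        refine ⟨‖f‖₊ * K' + K * ‖g‖₊, LipschitzWith.of_dist_le_mul fun s t => ?_⟩
        have h1 := hK.dist_le_mul s t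
        have h2 := hK'.dist_le_mul s t
        rw [dist_eq_norm] at h1 h2 ⊢
        have e : (f * g) s - (f * g) t = f s * (g s - g t) + (f s - f t) * g t := by
          simp only [ContinuousMap.mul_apply]; ring
        rw [e]
        refine (norm_add_le _ _).trans ?_
        rw [norm_mul, norm_mul]
        push_cast
        rw [add_mul]
        refine add_le_add ?_ ?_
        · rw [mul_assoc]
          exact mul_le_mul (f.norm_coe_le_norm s) h2 (norm_nonneg _) (norm_nonneg _)
        · rw [mul_right_comm]
          exact mul_le_mul h1 (g.norm_coe_le_norm t) (norm_nonneg _) (by positivity)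
      add_mem' := by
        rintro f g ⟨K, hK⟩ ⟨K', hK'⟩
        exact ⟨K + K', hK.add hK'⟩
      algebraMap_mem' := fun c => ⟨0, LipschitzWith.const c⟩
      star_mem' := by
        rintro f ⟨K, hK⟩
        refine ⟨K, LipschitzWith.of_dist_le_mul fun s t => ?_⟩
        have h1 := hK.dist_le_mul s t
        rw [dist_eq_norm] at h1 ⊢
        rwa [ContinuousMap.star_apply, ContinuousMap.star_apply, ← star_sub, norm_star] }
  have hA : A.SeparatesPoints := by
    intro s t hst
    let u : C(unitInterval, ℂ) := ⟨fun t => ((t : ℝ) : ℂ), by fun_prop⟩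
    refine ⟨u, ⟨u, ⟨1, LipschitzWith.of_dist_le_mul fun s t => ?_⟩, rfl⟩, ?_⟩
    · rw [dist_eq_norm]
      simp only [u, ContinuousMap.coe_mk]
      rw [← Complex.ofReal_sub, Complex.norm_real, NNReal.coe_one, one_mul]
      exact le_of_eq rfl
    · simp only [u, ContinuousMap.coe_mk]
      exact fun h => hst (Subtype.ext (Complex.ofReal_injective h))
  have := ContinuousMap.starSubalgebra_topologicalClosure_eq_top_of_separatesPoints A hA
  intro f
  have hf : f ∈ A.topologicalClosure := by rw [this]; trivial
  exact hf

end Density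

/-! ### Summability exactly above exponent one -/

section Summability

variable {J : Set (Sym2 unitInterval)} {p₀ : Sym2 unitInterval} (hJ : IsDyadicIndex J p₀)

include hJ

theorem IsDyadicIndex.pairDist_pos (i : J) : 0 < pairDist i.1 := by
  rw [pairDist_eq_out, dist_pos]
  intro h
  refine hJ.not_isDiag i.1 i.2 ?_
  rw [← Quot.out_eq i.1]
  exact Sym2.mk_isDiag_iff.2 h

theorem IsDyadicIndex.finite_inv_le (Λ : ℝ) : {i : J | (pairDist i.1)⁻¹ ≤ Λ}.Finite :=
  (hJ.finite (le_max_right Λ 1)).subset fun i (hi : (pairDist i.1)⁻¹ ≤ Λ) =>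
    (hi.trans (le_max_left _ _) : (pairDist i.1)⁻¹ ≤ max Λ 1)

theorem IsDyadicIndex.exists_level (s : Finset J) :
    ∃ Λ, 1 ≤ Λ ∧ ∀ i ∈ s, (pairDist i.1)⁻¹ ≤ Λ := by
  refine ⟨1 + ∑ i ∈ s, (pairDist i.1)⁻¹, ?_, fun i hi => ?_⟩
  · have : 0 ≤ ∑ i ∈ s, (pairDist i.1)⁻¹ :=
      Finset.sum_nonneg fun i _ => (inv_pos.2 (hJ.pairDist_pos i)).le
    linarith
  · have := Finset.single_le_sum (f := fun i : J => (pairDist i.1)⁻¹)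
      (fun i _ => (inv_pos.2 (hJ.pairDist_pos i)).le) hi
    linarith

/-- For each `w`, level `q` has at most `2^q` pairs of length at most `4/2^q`, so the sum is
dominated by a geometric series of ratio `2^(1-s) < 1`. -/
theorem IsDyadicIndex.summable_rpow {s : ℝ} (hs : 1 < s) :
    Summable fun i : J => pairDist i.1 ^ s := by
  have hd0 : ∀ p : Sym2 unitInterval, 0 ≤ pairDist p := fun p => by
    rw [pairDist_eq_out]; exact dist_nonneg
  set r : ℝ := 2 ^ (1 - s) with hr
  have hr0 : 0 < r := by positivity
  have hr1 : r < 1 := Real.rpow_lt_one_of_one_lt_of_neg (by norm_num) (by linarith)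
  have hlev : ∀ w ∈ Finset.Icc (1 : ℕ) 4, ∀ n : ℕ, ∑ q ∈ Finset.range n,
      ∑ u ∈ (Finset.range (2 ^ q - w)).filter (IsGood w), pairDist (dyadicPair q u w) ^ s
        ≤ 4 ^ s * (1 - r)⁻¹ := by
    intro w hw n
    have hw4 : (w : ℝ) ≤ 4 := by exact_mod_cast (Finset.mem_Icc.1 hw).2
    have hgeom : ∑ q ∈ Finset.range n, r ^ q ≤ (1 - r)⁻¹ := by
      rw [← tsum_geometric_of_lt_one hr0.le hr1]
      exact (summable_geometric_of_lt_one hr0.le hr1).sum_le_tsum _ fun _ _ => by positivity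
    refine le_trans ?_ (mul_le_mul_of_nonneg_left hgeom (by positivity))
    rw [Finset.mul_sum]
    refine Finset.sum_le_sum fun q _ => ?_
    have hterm : ∀ u ∈ (Finset.range (2 ^ q - w)).filter (IsGood w),
        pairDist (dyadicPair q u w) ^ s ≤ (4 / 2 ^ q) ^ s := by
      intro u hu
      have := Finset.mem_range.1 (Finset.mem_filter.1 hu).1
      rw [pairDist_dyadicPair (by omega)]
      gcongr
    refine (Finset.sum_le_sum hterm).trans ?_
    rw [Finset.sum_const, nsmul_eq_mul]
    have hc : (levelCount w q : ℝ) ≤ 2 ^ q := by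
      have h1 := (levelCount_bounds hw q).1
      have h2 : (0 : ℝ) < 2 ^ q := by positivity
      linarith
    refine (mul_le_mul_of_nonneg_right hc (by positivity)).trans (le_of_eq ?_)
    have e1 : (2 : ℝ) ^ q = 2 ^ (q : ℝ) := (Real.rpow_natCast 2 q).symm
    have e2 : r ^ q = (2 : ℝ) ^ (q : ℝ) / ((2 : ℝ) ^ (q : ℝ)) ^ s := by
      rw [hr, ← Real.rpow_natCast, ← Real.rpow_mul (by norm_num), ← Real.rpow_mul (by norm_num),
        ← Real.rpow_sub (by norm_num)]
      congr 1; ring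
    rw [Real.div_rpow (by norm_num) (by positivity), e2, e1]
    ring
  refine summable_of_sum_le (c := 4 * (4 ^ s * (1 - r)⁻¹) + pairDist p₀ ^ s)
    (fun i => Real.rpow_nonneg (hd0 _) _) fun S => ?_
  obtain ⟨Λ, hΛ, hS⟩ := hJ.exists_level S
  have hfin := hJ.finite hΛ
  have h1 : ∑ i ∈ S, pairDist i.1 ^ s ≤ ∑ i ∈ hfin.toFinset, pairDist i.1 ^ s :=
    Finset.sum_le_sum_of_subset_of_nonneg (fun i hi => by simpa using hS i hi)
      fun i _ _ => Real.rpow_nonneg (hd0 _) _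
  have h2 := hJ.norm_sum_sub_le hΛ (F := hfin.toFinset) (fun i => by simp)
    (fun p => pairDist p ^ s)
  rw [Real.norm_eq_abs, Real.norm_of_nonneg (Real.rpow_nonneg (hd0 _) _)] at h2
  have h3 : ∑ t ∈ levelSet Λ, pairDist (dyadicPair t.2.1 t.2.2 t.1) ^ s
      ≤ 4 * (4 ^ s * (1 - r)⁻¹) := by
    rw [sum_levelSet Λ fun w q u => pairDist (dyadicPair q u w) ^ s]
    refine (Finset.sum_le_sum fun w hw => hlev w hw _).trans (le_of_eq ?_)
    rw [Finset.sum_const, nsmul_eq_mul]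
    norm_num
  linarith [(abs_le.1 h2).2]

/-- A finite sum, divided by `log Λ`, would tend to 0. The weighted asymptotics with `f = 1`, where
a pair has weight `2d`, give the limit `10/log 2`. -/
theorem IsDyadicIndex.not_summable : ¬ Summable fun i : J => pairDist i.1 := by
  intro hsum
  have hfin := hJ.finite_inv_le
  have h1 := hJ.tendsto_sum_pairWeight (1 : C(unitInterval, ℂ)) (F := fun Λ => (hfin Λ).toFinset)
    (fun Λ _ i => by simp)
  have h2 : Tendsto (fun Λ : ℝ => ((1 / Real.log Λ : ℝ) : ℂ) *
      ∑ i ∈ (hfin Λ).toFinset, pairWeight 1 i.1) atTop (𝓝 0) := by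
    refine squeeze_zero_norm' ?_
      (Real.tendsto_log_atTop.const_div_atTop (2 * ∑' i : J, pairDist i.1))
    filter_upwards [eventually_ge_atTop 1] with Λ hΛ
    have hlog := Real.log_nonneg hΛ
    rw [norm_mul, Complex.norm_real, Real.norm_of_nonneg (by positivity), one_div_mul_eq_div]
    refine div_le_div_of_nonneg_right ?_ hlog
    refine (norm_sum_le_of_le _ (n := fun i : J => 2 * pairDist i.1) fun i _ => ?_).trans ?_
    · rw [pairWeight_eq_out, ← pairDist_eq_out, norm_mul, Complex.norm_real,
        Real.norm_of_nonneg (hJ.pairDist_pos i).le]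
      simp only [ContinuousMap.one_apply]
      rw [one_add_one_eq_two, Complex.norm_ofNat, mul_comm]
    · rw [← Finset.mul_sum]
      gcongr
      exact hsum.sum_le_tsum _ fun i _ => (hJ.pairDist_pos i).le
  have h3 := tendsto_nhds_unique h1 h2
  have hl2 : Real.log 2 ≠ 0 := (Real.log_pos (by norm_num)).ne'
  have e : Complex.log 2 = ((Real.log 2 : ℝ) : ℂ) := by
    rw [Complex.ofReal_log (by norm_num)]; norm_num
  simp at h3
  rw [e] at h3
  exact hl2 (Complex.ofReal_eq_zero.1 h3)

theorem IsDyadicIndex.fst_ne_snd (i : J) : (Quot.out i.1).1 ≠ (Quot.out i.1).2 := by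
  have := hJ.pairDist_pos i
  rwa [pairDist_eq_out, dist_pos] at this

theorem IsDyadicIndex.isSummableAt_pairDirac {s : ℝ} (hs : 1 < s) :
    IsSummableAt (pairDirac J) s := by
  refine (isSummableAt_blockDirac_iff hJ.fst_ne_snd (by linarith)).2 ?_
  refine lt_of_le_of_lt (ENNReal.tsum_le_tsum fun i => ?_)
    (((hJ.summable_rpow hs).mul_left 2).tsum_ofReal_lt_top)
  rw [← pairDist_eq_out, ENNReal.ofReal_mul (by norm_num), ENNReal.ofReal_ofNat]
  gcongr
  have hd := hJ.pairDist_pos i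
  have e : pairDist i.1 ^ s = (pairDist i.1 ^ 2) ^ (s / 2) := by
    rw [← Real.rpow_natCast, ← Real.rpow_mul hd.le]
    congr 1; push_cast; ring
  rw [e]
  refine Real.rpow_le_rpow (inv_one_add_inv_sq_nonneg _) ?_ (by linarith)
  rw [inv_pow]
  refine inv_le_of_inv_le₀ (by positivity) ?_
  linarith

/-- As `d ≤ 1`, the eigenvalue `(1 + d⁻²)^(-1/2)` is at least `d/2`, so the divergence of the sum of
the lengths carries over. -/
theorem IsDyadicIndex.not_isSummableAt_pairDirac_one : ¬ IsSummableAt (pairDirac J) 1 := by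
  intro h
  have h1 := (isSummableAt_blockDirac_iff hJ.fst_ne_snd zero_le_one).1 h
  refine hJ.not_summable ?_
  have h2 : ∑' i : J, ENNReal.ofReal (pairDist i.1) ≠ ⊤ := by
    refine (lt_of_le_of_lt (ENNReal.tsum_le_tsum fun i => ?_) h1).ne
    have hd := hJ.pairDist_pos i
    have hd1 := pairDist_le_one i.1
    rw [← pairDist_eq_out, ← ENNReal.ofReal_ofNat, ← ENNReal.ofReal_mul (by norm_num)]
    refine ENNReal.ofReal_le_ofReal ?_
    rw [← Real.sqrt_eq_rpow, ← div_le_iff₀' (by norm_num)]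
    refine Real.le_sqrt_of_sq_le ?_
    have e : (1 + ((pairDist i.1)⁻¹) ^ 2)⁻¹ = pairDist i.1 ^ 2 / (pairDist i.1 ^ 2 + 1) := by
      field_simp
    rw [e, div_pow, div_le_div_iff₀ (by norm_num) (by positivity)]
    exact mul_le_mul_of_nonneg_left (by nlinarith) (sq_nonneg _)
  have h3 := ENNReal.summable_toReal h2
  exact h3.congr fun i => ENNReal.toReal_ofReal (hJ.pairDist_pos i).le

end Summability

/-! ### The induced metric -/

section Metric

theorem tendsto_dyadic_odd (s : unitInterval) : ∃ a : ℕ → ℕ, (∀ q, a q < 2 ^ q) ∧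
    Tendsto (fun q => dyadic (q + 1) (2 * a q + 1)) atTop (𝓝 s) := by
  -- The point is the midpoint of a dyadic interval of length `2^(-q)` containing `s`; the minimum
  -- takes care of `s = 1`.
  refine ⟨fun q => min ⌊(s : ℝ) * 2 ^ q⌋₊ (2 ^ q - 1), fun q => ?_, ?_⟩
  · have : 0 < 2 ^ q := by positivity
    exact (min_le_right _ _).trans_lt (by omega)
  · have hb : Tendsto (fun q : ℕ => (1 : ℝ) / 2 ^ q) atTop (𝓝 0) := by
      simp only [one_div]
      exact tendsto_inv_atTop_zero.comp
        (tendsto_pow_atTop_atTop_of_one_lt (show (1 : ℝ) < 2 by norm_num))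
    rw [tendsto_iff_dist_tendsto_zero]
    refine squeeze_zero (fun _ => dist_nonneg) (fun q => ?_) hb
    beta_reduce
    have hP : (0 : ℝ) < 2 ^ q := by positivity
    have hPn : 0 < 2 ^ q := by positivity
    have hs0 : (0 : ℝ) ≤ s * 2 ^ q := mul_nonneg s.2.1 hP.le
    set a := min ⌊(s : ℝ) * 2 ^ q⌋₊ (2 ^ q - 1) with ha
    have haP : a < 2 ^ q := (min_le_right _ _).trans_lt (by omega)
    have h1 : (a : ℝ) ≤ s * 2 ^ q :=
      (Nat.cast_le.2 (min_le_left _ _)).trans (Nat.floor_le hs0)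
    have h2 : (s : ℝ) * 2 ^ q ≤ a + 1 := by
      rcases le_total ⌊(s : ℝ) * 2 ^ q⌋₊ (2 ^ q - 1) with h | h
      · rw [ha, min_eq_left h]; exact (Nat.lt_floor_add_one _).le
      · rw [ha, min_eq_right h]
        have : ((2 ^ q - 1 : ℕ) : ℝ) = 2 ^ q - 1 := by push_cast [hPn]; ring
        rw [this]
        nlinarith [s.2.2]
    rw [Subtype.dist_eq, Real.dist_eq, coe_dyadic (by rw [pow_succ]; omega)]
    have e : ((2 * a + 1 : ℕ) : ℝ) / 2 ^ (q + 1) = (a + 1 / 2) / 2 ^ q := by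
      rw [pow_succ]; push_cast; field_simp
    have e' : (s : ℝ) = s * 2 ^ q / 2 ^ q := by field_simp
    rw [e, e', ← sub_div, abs_div, abs_of_pos hP]
    gcongr
    rw [abs_le]
    constructor <;> linarith

variable {J : Set (Sym2 unitInterval)} {p₀ : Sym2 unitInterval} (hJ : IsDyadicIndex J p₀)

include hJ

/-- Consecutive odd multiples of `2^(-(q+1))` form pairs with `w = 2`. Their distances add up
exactly along the line, so the bound holds within each level, and it passes to the limit by
continuity of `f`. -/
theorem IsDyadicIndex.norm_sub_le_dist {f : C(unitInterval, ℂ)}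
    (hf : ∀ i : J, ‖f (Quot.out i.1).1 - f (Quot.out i.1).2‖ ≤
      1 * dist (Quot.out i.1).1 (Quot.out i.1).2) (s t : unitInterval) :
    ‖f s - f t‖ ≤ dist s t := by
  have hsym : ∀ p ∈ J, ∀ x y, p = s(x, y) → ‖f x - f y‖ ≤ dist x y := by
    intro p hp x y hxy
    have h := hf ⟨p, hp⟩
    simp only [one_mul] at h
    have : s((Quot.out p).1, (Quot.out p).2) = s(x, y) := by
      rw [← hxy]; exact Quot.out_eq p
    rcases Sym2.eq_iff.1 this with ⟨h1, h2⟩ | ⟨h1, h2⟩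
    · rwa [h1, h2] at h
    · rwa [h1, h2, norm_sub_rev, dist_comm] at h
  have hstep : ∀ q a k : ℕ, a + k < 2 ^ q →
      ‖f (dyadic (q + 1) (2 * a + 1)) - f (dyadic (q + 1) (2 * a + 1 + 2 * k))‖
        ≤ dist (dyadic (q + 1) (2 * a + 1)) (dyadic (q + 1) (2 * a + 1 + 2 * k)) := by
    intro q a k
    induction k with
    | zero => intro _; simp
    | succ k ih =>
      intro hlt
      have hlt' : 2 * a + 1 + 2 * k + 2 < 2 ^ (q + 1) := by rw [pow_succ]; omega
      have h1 := ih (by omega)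
      have h2 := hsym _ (hJ.dyadicPair_mem (q + 1) (2 * a + 1 + 2 * k) 2
        (Or.inr (Or.inl ⟨rfl, by omega⟩)) hlt') _ _ rfl
      rw [dist_dyadic (by omega)] at h1 h2
      rw [show 2 * a + 1 + 2 * (k + 1) = 2 * a + 1 + (2 * k + 2) by ring, dist_dyadic (by omega)]
      rw [add_assoc _ (2 * k) 2] at h2
      have h3 : ((2 * k + 2 : ℕ) : ℝ) / 2 ^ (q + 1)
          = ((2 * k : ℕ) : ℝ) / 2 ^ (q + 1) + ((2 : ℕ) : ℝ) / 2 ^ (q + 1) := by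
        rw [← add_div]; push_cast; ring
      rw [h3]
      refine (norm_sub_le_norm_sub_add_norm_sub _ (f (dyadic (q + 1) (2 * a + 1 + 2 * k))) _).trans ?_
      exact add_le_add h1 h2
  have hall : ∀ q a b : ℕ, a < 2 ^ q → b < 2 ^ q →
      ‖f (dyadic (q + 1) (2 * a + 1)) - f (dyadic (q + 1) (2 * b + 1))‖
        ≤ dist (dyadic (q + 1) (2 * a + 1)) (dyadic (q + 1) (2 * b + 1)) := by
    intro q a b ha hb
    rcases le_total a b with h | h
    · obtain ⟨k, rfl⟩ := Nat.exists_eq_add_of_le h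
      have := hstep q a k hb
      rwa [show 2 * a + 1 + 2 * k = 2 * (a + k) + 1 by ring] at this
    · obtain ⟨k, rfl⟩ := Nat.exists_eq_add_of_le h
      have := hstep q b k ha
      rwa [show 2 * b + 1 + 2 * k = 2 * (b + k) + 1 by ring, norm_sub_rev, dist_comm] at this
  obtain ⟨a, ha, hat⟩ := tendsto_dyadic_odd s
  obtain ⟨b, hb, hbt⟩ := tendsto_dyadic_odd t
  refine le_of_tendsto_of_tendsto'
    ((((f.continuous.tendsto s).comp hat).sub ((f.continuous.tendsto t).comp hbt)).norm)
    (hat.dist hbt) fun q => ?_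
  exact hall q (a q) (b q) (ha q) (hb q)

theorem IsDyadicIndex.inducedDist_eq (s t : unitInterval) :
    inducedDist (pairRep J) (pairDirac J) (ContinuousMap.evalCLM ℂ s) (ContinuousMap.evalCLM ℂ t)
      = ENNReal.ofReal (dist s t) := by
  refine le_antisymm (iSup₂_le fun f hf => ?_) ?_
  · refine ENNReal.ofReal_le_ofReal ?_
    exact hJ.norm_sub_le_dist
      ((commutatorNormLE_blockRep_iff hJ.fst_ne_snd f zero_le_one).1 hf) s t
  -- The coordinate function attains the supremum.
  · let u : C(unitInterval, ℂ) := ⟨fun t => ((t : ℝ) : ℂ), by fun_prop⟩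
    have hu : ∀ x y : unitInterval, ‖u x - u y‖ = dist x y := by
      intro x y
      simp only [u, ContinuousMap.coe_mk]
      rw [← Complex.ofReal_sub, Complex.norm_real]
      rfl
    refine le_iSup₂_of_le u ((commutatorNormLE_blockRep_iff hJ.fst_ne_snd u zero_le_one).2
      fun i => ?_) ?_
    · rw [hu, one_mul]
    · exact ENNReal.ofReal_le_ofReal (hu s t).ge

end Metric

/-! ### The Dixmier trace of `π(f)|D|⁻¹` -/

section DixmierTrace

/-- A real continuous function, regarded as a complex one. -/
def ofRealMap (g : C(unitInterval, ℝ)) : C(unitInterval, ℂ) :=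
  ⟨fun t => (g t : ℂ), by fun_prop⟩

/-- The positive part of a real continuous function. -/
def posMap (g : C(unitInterval, ℝ)) : C(unitInterval, ℝ) :=
  ⟨fun t => max (g t) 0, by fun_prop⟩

theorem integrable_unitInterval {E : Type*} [NormedAddCommGroup E] {g : unitInterval → E}
    (hg : Continuous g) : MeasureTheory.Integrable g :=
  hg.integrable_of_hasCompactSupport (HasCompactSupport.of_compactSpace _)

theorem posMap_sub_posMap_neg (g : C(unitInterval, ℝ)) (t : unitInterval) :
    posMap g t - posMap (-g) t = g t := by
  simp only [posMap, ContinuousMap.coe_mk, ContinuousMap.neg_apply]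
  rcases le_total (g t) 0 with h | h
  · rw [max_eq_right h, max_eq_left (by linarith)]; ring
  · rw [max_eq_left h, max_eq_right (by linarith)]; ring

theorem posMap_mul_posMap_neg (g : C(unitInterval, ℝ)) (t : unitInterval) :
    posMap g t * posMap (-g) t = 0 := by
  simp only [posMap, ContinuousMap.coe_mk, ContinuousMap.neg_apply]
  rcases le_total (g t) 0 with h | h
  · rw [max_eq_right h, zero_mul]
  · rw [max_eq_right (a := -g t) (by linarith), mul_zero]

theorem integral_posMap_sub (g : C(unitInterval, ℝ)) :
    (∫ t, posMap g t) - ∫ t, posMap (-g) t = ∫ t, g t := by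
  rw [← MeasureTheory.integral_sub (integrable_unitInterval (posMap g).continuous)
    (integrable_unitInterval (posMap (-g)).continuous)]
  exact MeasureTheory.integral_congr_ae (.of_forall (posMap_sub_posMap_neg g))

variable (J : Set (Sym2 unitInterval))

theorem norm_mul_dist_le (f : C(unitInterval, ℂ)) (i : J) (j : Fin 2) :
    ‖f (![(Quot.out i.1).1, (Quot.out i.1).2] j) * ((pairDist i.1 : ℝ) : ℂ)‖ ≤ ‖f‖ := by
  have h0 : 0 ≤ pairDist i.1 := by rw [pairDist_eq_out]; exact dist_nonneg
  rw [norm_mul, Complex.norm_real, Real.norm_of_nonneg h0]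
  exact (mul_le_mul (f.norm_coe_le_norm _) (pairDist_le_one i.1) h0 (norm_nonneg _)).trans
    (mul_one _).le

/-- The operator `π(f) |D|⁻¹`, as a diagonal operator. -/
def weightOp (f : C(unitInterval, ℂ)) : PairSpace J →L[ℂ] PairSpace J :=
  diagOp (ι := J) _ (norm_mul_dist_le J f)

theorem weightOp_apply (f : C(unitInterval, ℂ)) (ξ : PairSpace J) (i : J) (j : Fin 2) :
    weightOp J f ξ i j =
      f (![(Quot.out i.1).1, (Quot.out i.1).2] j) * ((pairDist i.1 : ℝ) : ℂ) * ξ i j :=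
  diagOp_apply _ ξ i j

theorem weightOp_nonneg {g : C(unitInterval, ℝ)} (hg : ∀ t, 0 ≤ g t) :
    0 ≤ weightOp J (ofRealMap g) := by
  have hd : ∀ i : J, 0 ≤ pairDist i.1 := fun i => by rw [pairDist_eq_out]; exact dist_nonneg
  have hb : ∀ (i : J) (j : Fin 2), ‖((g (![(Quot.out i.1).1, (Quot.out i.1).2] j) *
      pairDist i.1 : ℝ) : ℂ)‖ ≤ ‖ofRealMap g‖ := fun i j => by
    have := norm_mul_dist_le J (ofRealMap g) i j
    rw [Complex.ofReal_mul]
    exact this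
  have h := diagOp_nonneg _ (fun (i : J) j => mul_nonneg (hg _) (hd i)) hb
  refine h.trans_eq (BlockSpace.op_ext fun ξ i j => ?_)
  rw [diagOp_apply, Complex.ofReal_mul]
  exact (weightOp_apply J (ofRealMap g) ξ i j).symm

theorem weightOp_mul_weightOp_eq_zero {f g : C(unitInterval, ℂ)} (h : ∀ t, f t * g t = 0) :
    weightOp J f * weightOp J g = 0 := by
  refine BlockSpace.op_ext fun ξ i j => ?_
  rw [mul_apply_eq_comp, weightOp_apply, weightOp_apply]
  have := h (![(Quot.out i.1).1, (Quot.out i.1).2] j)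
  rw [show ∀ a b d z : ℂ, a * d * (b * d * z) = a * b * (d * d * z) by intros; ring, this, zero_mul]
  rfl

/-- This is the shape required by `dixmierTrace_eq`; the products of the paired terms vanish because
`posMap u` and `posMap (-u)` have product zero. -/
theorem weightOp_decompose (f : C(unitInterval, ℂ)) {u v : C(unitInterval, ℝ)}
    (hf : ∀ t, f t = u t + Complex.I * v t) :
    weightOp J f = (weightOp J (ofRealMap (posMap u)) - weightOp J (ofRealMap (posMap (-u))))
      + Complex.I • (weightOp J (ofRealMap (posMap v)) - weightOp J (ofRealMap (posMap (-v)))) := by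
  refine BlockSpace.op_ext fun ξ i j => ?_
  have e : ((weightOp J (ofRealMap (posMap u)) - weightOp J (ofRealMap (posMap (-u))))
      + Complex.I • (weightOp J (ofRealMap (posMap v)) - weightOp J (ofRealMap (posMap (-v))))) ξ i j
      = (weightOp J (ofRealMap (posMap u)) ξ i j - weightOp J (ofRealMap (posMap (-u))) ξ i j)
        + Complex.I * (weightOp J (ofRealMap (posMap v)) ξ i j
          - weightOp J (ofRealMap (posMap (-v))) ξ i j) := rfl
  rw [e]
  simp only [weightOp_apply, ofRealMap, ContinuousMap.coe_mk]
  rw [hf, ← posMap_sub_posMap_neg u, ← posMap_sub_posMap_neg v]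
  push_cast
  ring

theorem pairRep_mul_absInverse {J : Set (Sym2 unitInterval)} {p₀ : Sym2 unitInterval}
    (hJ : IsDyadicIndex J p₀) (f : C(unitInterval, ℂ)) :
    pairRep J f * absInverse (pairDirac J) = weightOp J f := by
  have h := absInverse_blockDirac hJ.fst_ne_snd (C := 1) fun i => by
    rw [← pairDist_eq_out]; exact pairDist_le_one _
  refine BlockSpace.op_ext fun ξ i j => ?_
  rw [mul_apply_eq_comp, show absInverse (pairDirac J) = _ from h]
  refine (blockRep_apply f _ i j).trans ?_
  rw [distOp_apply, weightOp_apply, pairDist_eq_out, mul_assoc]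

variable {J} {p₀ : Sym2 unitInterval} (hJ : IsDyadicIndex J p₀)

include hJ

theorem IsDyadicIndex.isCompactOperator_weightOp (f : C(unitInterval, ℂ)) :
    IsCompactOperator (weightOp J f) := by
  refine isCompactOperator_diagOp _ fun ε hε => ?_
  refine (hJ.finite_inv_le (‖f‖ / ε)).subset ?_
  rintro i ⟨j, hj⟩
  have hd := hJ.pairDist_pos i
  rw [norm_mul, Complex.norm_real, Real.norm_of_nonneg hd.le] at hj
  have h := hj.trans (mul_le_mul_of_nonneg_right (f.norm_coe_le_norm _) hd.le)
  change (pairDist i.1)⁻¹ ≤ ‖f‖ / ε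
  rw [inv_le_iff_one_le_mul₀ hd, div_mul_eq_mul_div, one_le_div hε]
  exact h

/-- The moduli of the two coefficients of a block add up to the `pairWeight` of `|f|`, so the
weighted asymptotics apply to `|f|`. `K = 19` is the upper bound from `card_asymptotics`. -/
theorem IsDyadicIndex.tendsto_logPartialSum_weightOp (f : C(unitInterval, ℂ)) :
    Tendsto (logPartialSum (weightOp J f)) atTop (𝓝 (10 / Real.log 2 * ∫ t, ‖f t‖)) := by
  have hF : ∀ Λ : ℝ, 1 ≤ Λ → ∀ i : J,
      i ∈ (hJ.finite_inv_le Λ).toFinset ↔ (pairDist i.1)⁻¹ ≤ Λ := fun Λ _ i => by simp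
  refine tendsto_logPartialSum_diagOp (norm_mul_dist_le J f)
    (fun Λ => (hJ.finite_inv_le Λ).toFinset) (K := 19) (B := ‖f‖) (by norm_num) (norm_nonneg _)
    ?_ ?_ ?_
  · filter_upwards [(hJ.card_asymptotics hF).2.2.2, eventually_gt_atTop 0] with Λ h hΛ
    rwa [div_le_iff₀ hΛ] at h
  · intro Λ hΛ i hi j
    have hd := hJ.pairDist_pos i
    have hi' : Λ < (pairDist i.1)⁻¹ := by simpa using hi
    rw [norm_mul, Complex.norm_real, Real.norm_of_nonneg hd.le, div_eq_mul_inv]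
    exact mul_le_mul (f.norm_coe_le_norm _) (le_inv_of_le_inv₀ hΛ hi'.le) hd.le (norm_nonneg _)
  · have h := (Complex.continuous_re.tendsto _).comp
      (hJ.tendsto_sum_pairWeight (ofRealMap ⟨fun t => ‖f t‖, by fun_prop⟩) hF)
    have e : ∫ t, ofRealMap ⟨fun t => ‖f t‖, by fun_prop⟩ t = ((∫ t, ‖f t‖ : ℝ) : ℂ) :=
      integral_ofReal
    rw [e, ← Complex.ofReal_mul, Complex.ofReal_re] at h
    refine h.congr fun Λ => ?_
    have hw : ∀ i : J, pairWeight (ofRealMap ⟨fun t => ‖f t‖, by fun_prop⟩) i.1 =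
        ((∑ j, ‖f (![(Quot.out i.1).1, (Quot.out i.1).2] j) * ((pairDist i.1 : ℝ) : ℂ)‖ : ℝ) : ℂ) := by
      intro i
      rw [pairWeight_eq_out, ← pairDist_eq_out, Fin.sum_univ_two]
      simp only [norm_mul, Complex.norm_real, Real.norm_of_nonneg (hJ.pairDist_pos i).le]
      simp only [ofRealMap, ContinuousMap.coe_mk, Matrix.cons_val_zero, Matrix.cons_val_one]
      push_cast
      ring
    simp only [Function.comp_apply, hw]
    rw [← Complex.ofReal_sum, ← Complex.ofReal_mul, Complex.ofReal_re, one_div_mul_eq_div]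

theorem IsDyadicIndex.memDixmierIdeal_weightOp (f : C(unitInterval, ℂ)) :
    MemDixmierIdeal (weightOp J f) := by
  obtain ⟨C, hC⟩ := (hJ.tendsto_logPartialSum_weightOp f).bddAbove_range
  exact ⟨hJ.isCompactOperator_weightOp f, C, fun N _ => hC ⟨N, rfl⟩⟩

theorem IsDyadicIndex.dixmierTracePos_weightOp {ω : Ultrafilter ℕ} (hω : ∀ n : ℕ, ω ≠ pure n)
    {g : C(unitInterval, ℝ)} (hg : ∀ t, 0 ≤ g t) :
    dixmierTracePos ω (weightOp J (ofRealMap g)) = 10 / Real.log 2 * ∫ t, g t := by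
  rw [dixmierTracePos_eq (hJ.tendsto_logPartialSum_weightOp _) hω]
  congr 2
  funext t
  exact (Complex.norm_real _).trans (Real.norm_of_nonneg (hg t))

theorem IsDyadicIndex.dixmierTrace_weightOp {ω : Ultrafilter ℕ} (hω : ∀ n : ℕ, ω ≠ pure n)
    (f : C(unitInterval, ℂ)) :
    dixmierTrace ω (weightOp J f) = ((10 / Real.log 2 : ℝ) : ℂ) * ∫ t, f t := by
  let u : C(unitInterval, ℝ) := ⟨fun t => (f t).re, by fun_prop⟩
  let v : C(unitInterval, ℝ) := ⟨fun t => (f t).im, by fun_prop⟩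
  have hpos : ∀ (g : C(unitInterval, ℝ)) (t), 0 ≤ posMap g t := fun g t => le_max_right _ _
  have hz : ∀ g : C(unitInterval, ℝ),
      weightOp J (ofRealMap (posMap g)) * weightOp J (ofRealMap (posMap (-g))) = 0 := fun g =>
    weightOp_mul_weightOp_eq_zero J fun t => by
      have := posMap_mul_posMap_neg g t
      simp only [ofRealMap, ContinuousMap.coe_mk]
      rw [← Complex.ofReal_mul, this, Complex.ofReal_zero]
  have hint : ∫ t, f t = ((∫ t, u t : ℝ) : ℂ) + ((∫ t, v t : ℝ) : ℂ) * Complex.I :=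
    (integral_re_add_im (integrable_unitInterval f.continuous)).symm
  rw [weightOp_decompose J f (u := u) (v := v) fun t => by
      rw [mul_comm]; exact (Complex.re_add_im _).symm,
    dixmierTrace_eq ω (weightOp_nonneg J (hpos _)) (weightOp_nonneg J (hpos _))
      (weightOp_nonneg J (hpos _)) (weightOp_nonneg J (hpos _)) (hz u) (hz v),
    hJ.dixmierTracePos_weightOp hω (hpos _), hJ.dixmierTracePos_weightOp hω (hpos _),
    hJ.dixmierTracePos_weightOp hω (hpos _), hJ.dixmierTracePos_weightOp hω (hpos _), hint,
    ← integral_posMap_sub u, ← integral_posMap_sub v]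
  push_cast
  ring

end DixmierTrace

/-! ### Transfer of the asymptotics to the operators -/

section Counting

variable {J : Set (Sym2 unitInterval)} {p₀ : Sym2 unitInterval} (hJ : IsDyadicIndex J p₀)

include hJ

theorem IsDyadicIndex.finite_inv_dist_le (Λ : ℝ) :
    {i : J | (dist (Quot.out i.1).1 (Quot.out i.1).2)⁻¹ ≤ Λ}.Finite := by
  simpa only [pairDist_eq_out] using hJ.finite_inv_le Λ

theorem IsDyadicIndex.finite_le_dist (ε : ℝ) (hε : 0 < ε) :
    {i : J | ε ≤ dist (Quot.out i.1).1 (Quot.out i.1).2}.Finite :=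
  (hJ.finite_inv_dist_le ε⁻¹).subset fun _ hi => inv_anti₀ hε hi

theorem IsDyadicIndex.eigenvalueCount_asymptotics :
    (∀ᶠ Λ : ℝ in atTop, 21 / 2 ≤ (eigenvalueCount (pairDirac J) Λ / Λ : ℝ)) ∧
    (∃ᶠ Λ : ℝ in atTop, (eigenvalueCount (pairDirac J) Λ / Λ : ℝ) ≤ 13) ∧
    (∃ᶠ Λ : ℝ in atTop, 17 ≤ (eigenvalueCount (pairDirac J) Λ / Λ : ℝ)) ∧
    (∀ᶠ Λ : ℝ in atTop, (eigenvalueCount (pairDirac J) Λ / Λ : ℝ) ≤ 19) := by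
  have hcount : ∀ Λ : ℝ, (eigenvalueCount (pairDirac J) Λ : ℝ)
      = 2 * (hJ.finite_inv_dist_le Λ).toFinset.card := fun Λ => by
    have := eigenvalueCount_blockDirac (hJ.finite_inv_dist_le Λ)
    exact_mod_cast this
  simp only [hcount]
  exact hJ.card_asymptotics fun Λ _ i => by simp [pairDist_eq_out]

theorem IsDyadicIndex.tendsto_opTrace (f : C(unitInterval, ℂ)) :
    Tendsto (fun Λ : ℝ => ((1 / Real.log Λ : ℝ) : ℂ) *
        opTrace (absInverse (pairDirac J) * spectralProjection (pairDirac J) Λ * pairRep J f))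
      atTop (𝓝 (((10 / Real.log 2 : ℝ) : ℂ) * ∫ x : unitInterval, f x)) := by
  have h := hJ.tendsto_sum_pairWeight f (F := fun Λ => (hJ.finite_inv_dist_le Λ).toFinset)
    fun Λ _ i => by simp [pairDist_eq_out]
  refine h.congr fun Λ => ?_
  congr 1
  refine Eq.trans ?_ (opTrace_blockRep hJ.fst_ne_snd (C := 1)
    (fun i => by rw [← pairDist_eq_out]; exact pairDist_le_one _) (hJ.finite_inv_dist_le Λ) f).symm
  exact Finset.sum_congr rfl fun i _ => pairWeight_eq_out f i.1

end Counting

end TwoPointSum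

end

/-! ### The main theorem -/

theorem mainTheorem3 (𝒯 : ℕ → Finset unitInterval)
    (h𝒯 : ∀ n : ℕ, 1 ≤ n → IsMinimalBallCover (1 * (1 / 2 : ℝ) ^ (n - 1)) (𝒯 n)) :
    let J : Set (Sym2 unitInterval) := pairIndex 9 1 (1 / 2) 𝒯
    let π : C(unitInterval, ℂ) →⋆ₐ[ℂ] (PairSpace J →L[ℂ] PairSpace J) := pairRep J
    let D : PairSpace J →ₗ.[ℂ] PairSpace J := pairDirac J
    -- the sum of two-point triples is a spectral triple, and `D` has a bounded inverse
    (IsSpectralTriple π D ∧ ∃ R, IsBoundedInverse D R) ∧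
    -- the induced metric on the interval is the usual one
    (∀ s t : unitInterval,
      inducedDist π D (ContinuousMap.evalCLM ℂ s) (ContinuousMap.evalCLM ℂ t)
        = ENNReal.ofReal (dist s t)) ∧
    -- summability exactly above exponent one
    ((∀ p : ℝ, 1 < p → IsSummableAt D p) ∧ ¬ IsSummableAt D 1) ∧
    -- growth of the eigenvalue counting function
    ((∀ Λ : ℝ, 0 < Λ → FiniteDimensional ℂ (spectralSubspace D {μ | |μ| ≤ Λ})) ∧
      (10 : EReal) < liminf (fun Λ : ℝ => ((eigenvalueCount D Λ / Λ : ℝ) : EReal)) atTop ∧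
      liminf (fun Λ : ℝ => ((eigenvalueCount D Λ / Λ : ℝ) : EReal)) atTop ≤ 13 ∧
      17 ≤ limsup (fun Λ : ℝ => ((eigenvalueCount D Λ / Λ : ℝ) : EReal)) atTop ∧
      limsup (fun Λ : ℝ => ((eigenvalueCount D Λ / Λ : ℝ) : EReal)) atTop < 20 ∧
      ¬ ∃ L : ℝ, Tendsto (fun Λ : ℝ => (eigenvalueCount D Λ / Λ : ℝ)) atTop (𝓝 L)) ∧
    -- logarithmic asymptotics of the truncated trace
    (∀ f : C(unitInterval, ℂ),
      Tendsto (fun Λ : ℝ =>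
          ((1 / Real.log Λ : ℝ) : ℂ) * opTrace (absInverse D * spectralProjection D Λ * π f))
        atTop (𝓝 (((10 / Real.log 2 : ℝ) : ℂ) * ∫ x : unitInterval, f x))) ∧
    -- the Dixmier trace
    (∀ f : C(unitInterval, ℂ), MemDixmierIdeal (π f * absInverse D) ∧
      ∀ ω : Ultrafilter ℕ, (∀ n : ℕ, ω ≠ pure n) →
        dixmierTrace ω (π f * absInverse D)
          = ((10 / Real.log 2 : ℝ) : ℂ) * ∫ x : unitInterval, f x) := by
  intro J π D
  obtain ⟨p₀, hJ⟩ := isDyadicIndex_pairIndex h𝒯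
  obtain ⟨hlow, hle13, hge17, hhigh⟩ := hJ.eigenvalueCount_asymptotics
  refine ⟨⟨isSpectralTriple_block hJ.fst_ne_snd hJ.finite_le_dist dense_lipschitz, _,
      isBoundedInverse_blockDirac hJ.fst_ne_snd (C := 1) fun i => by
        rw [← pairDist_eq_out]; exact pairDist_le_one _⟩,
    hJ.inducedDist_eq, ⟨fun p hp => hJ.isSummableAt_pairDirac hp, hJ.not_isSummableAt_pairDirac_one⟩,
    ⟨fun Λ _ => finiteDimensional_spectralSubspace (hJ.finite_inv_dist_le Λ), ?_, ?_, ?_, ?_, ?_⟩,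
    hJ.tendsto_opTrace, fun f => ?_⟩
  -- The eventual bounds `21/2` and 19 leave room for the strict inequalities with 10 and 20, which
  -- a limit inferior or superior would not otherwise preserve.
  · refine lt_of_lt_of_le (b := ((21 / 2 : ℝ) : EReal)) ?_
      (le_liminf_of_le (h := hlow.mono fun Λ h => EReal.coe_le_coe_iff.2 h))
    rw [show (10 : EReal) = ((10 : ℝ) : EReal) from rfl, EReal.coe_lt_coe_iff]
    norm_num
  · exact liminf_le_of_frequently_le' (hle13.mono fun Λ h => EReal.coe_le_coe_iff.2 h)
  · exact le_limsup_of_frequently_le' (hge17.mono fun Λ h => EReal.coe_le_coe_iff.2 h)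
  · refine lt_of_le_of_lt (b := ((19 : ℝ) : EReal))
      (limsup_le_of_le (h := hhigh.mono fun Λ h => EReal.coe_le_coe_iff.2 h)) ?_
    rw [show (20 : EReal) = ((20 : ℝ) : EReal) from rfl, EReal.coe_lt_coe_iff]
    norm_num
  · rintro ⟨L, hL⟩
    have h1 : L ≤ 13 := le_of_not_gt fun h =>
      hle13 ((hL.eventually (lt_mem_nhds h)).mono fun Λ h => not_le.2 h)
    have h2 : 17 ≤ L := le_of_not_gt fun h =>
      hge17 ((hL.eventually (gt_mem_nhds h)).mono fun Λ h => not_le.2 h)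
    linarith
  · have e : π f * absInverse D = weightOp J f := pairRep_mul_absInverse hJ f
    rw [e]
    exact ⟨hJ.memDixmierIdeal_weightOp f, fun ω hω => hJ.dixmierTrace_weightOp hω f⟩
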